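/- Let $\mathbb K$ be $\mathbb R$ or $\mathbb C$, let $M$ be a smooth (Hausdorff, second countable) manifold of dimension $m$, and write $C^\infty(M)$ for the smooth $\mathbb K$-valued functions on $M$. Let $A\to M$ be a smooth $\mathbb K$-vector bundle of rank $n$ such that both $A$ and its dual $A^*$ carry the structure of a ($\mathbb K$-)Lie algebroid, with brackets $[\cdot,\cdot]$, $[\cdot,\cdot]_*$, anchors $a,a_*$ (with values in $TM$, complexified if $\mathbb K=\mathbb C$) and differentials $d$ on $\Gamma(\wedge A^*)$, $d_*$ on $\Gamma(\wedge A)$. Let $\mathcal S\to M$ be a $\mathbb K$-line bundle with an isomorphism $\mathcal S\otimes\mathcal S\cong\wedge^nA^*\otimes\wedge^mT^*M$ ($T^*M$ complexified if $\mathbb K=\mathbb C$), that is, $\mathcal S=(\wedge^nA^*\otimes\wedge^mT^*M)^{1/2}$. **The operator Ð.** A section $\alpha$ of $A^*$ acts on $\Gamma(\wedge^nA^*\otimes\wedge^mT^*M)$ by $$\alpha\cdot(\alpha_1\wedge\dots\wedge\alpha_n\otimes\mu)=\sum_{i}\alpha_1\wedge\dots\wedge[\alpha,\alpha_i]_*\wedge\dots\wedge\alpha_n\otimes\mu+\alpha_1\wedge\dots\wedge\alpha_n\otimes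 L_{a_*(\alpha)}\mu .$$ This makes $\mathcal S$ a module over the Lie algebroid $A^*$, by $(\alpha\cdot s)\otimes t+s\otimes(\alpha\cdot t)=\alpha\cdot(s\otimes t)$. Let $\bar d_*:\Gamma(\wedge^kA\otimes\mathcal S)\to\Gamma(\wedge^{k+1}A\otimes\mathcal S)$ be the resulting Lie algebroid differential of $A^*$ with coefficients in $\mathcal S$. Let $\mathcal S'=\wedge^nA\otimes\mathcal S$, which is a square root of $\wedge^nA\otimes\wedge^mT^*M$. It is a module over the Lie algebroid $A$: a section $X$ of $A$ acts by the product rule, through the Lie derivative $L_X$ on $\wedge^nA$ and, on $\mathcal S$, through the operator $D_X$ determined by $D_Xs\otimes t+s\otimes D_Xt=L_X(s\otimes t)$, where $L_X$ is the Lie derivative on $\wedge^nA^*$ and $L_{a(X)}$ on $\wedge^mT^*M$. Let $\bar\partial:\Gamma(\wedge^kA\otimes\mathcal S)\to\Gamma(\wedge^{k-1}A\otimes\mathcal S)$ be the operator that corresponds to the Lie algebroid differential of $A$ with coefficients in $\mathcal S'$ under the isomorphisms $$\wedge^kA^*\otimes\mathcal S'\;\cong\;\wedge^{n-k}A\otimes\mathcal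 S,\qquad \xi_1\wedge\dots\wedge\xi_k\otimes v\mapsto i_{\xi_1}\cdots i_{\xi_k}v .$$ Put $Ð=\bar d_*+\bar\partial$ on $\Gamma(\wedge A\otimes\mathcal S)$. **Lie bialgebroids.** The pair $(A,A^*)$ is a *Lie bialgebroid* if $d_*$ is a derivation of the Gerstenhaber algebra $(\Gamma(\wedge A),\wedge,[\cdot,\cdot])$, i.e. $d_*[u,v]=[d_*u,v]+(-1)^{k-1}[u,d_*v]$ for $u\in\Gamma(\wedge^kA)$, $v\in\Gamma(\wedge A)$, where $[\cdot,\cdot]$ is the Schouten bracket of $A$. **Dirac generating operators.** Equip $A\oplus A^*$ with the pairing $\langle X_1+\xi_1,X_2+\xi_2\rangle=\tfrac12(\xi_1(X_2)+\xi_2(X_1))$, and let the Clifford algebra bundle of $A\oplus A^*$ (with relations $xy+yx=2\langle x,y\rangle$) act on $\wedge A\otimes\mathcal S$ by $X+\xi\mapsto X\wedge\cdot+i_\xi$. A $\mathbb K$-linear operator $Ð$ on $\Gamma(\wedge A\otimes\mathcal S)$ is a *Dirac generating operator* (Alekseev–Xu) for $A\oplus A^*$ if it is odd (it reverses the parity of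 the degree) and, with graded commutators of operators: 1. for every $f\in C^\infty(M)$, $[Ð,f]$ is the Clifford action of some section of $A\oplus A^*$; 2. for all sections $e_1,e_2$ of $A\oplus A^*$, $[[Ð,e_1],e_2]$ is the Clifford action of some section of $A\oplus A^*$; 3. $Ð^2$ is the multiplication by some function in $C^\infty(M)$. **Statement.** The operator $Ð=\bar d_*+\bar\partial$ is well defined (it exists and is uniquely determined by the data above), and the pair $(A,A^*)$ is a Lie bialgebroid if and only if $Ð$ is a Dirac generating operator for $A\oplus A^*$ with the pairing above. -/

import Mathlib

open scoped TensorProduct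
open Module

/-! ## Algebra of Lie algebroids over the ring of functions

Everything in this first part is written for a commutative `𝕜`-algebra `R` (the smooth functions on
the base) and an `R`-module `L` (the smooth sections of a vector bundle `A`).  The sections of the
dual bundle are the `R`-linear functionals `Module.Dual R L`, and the sections of
`⋀ᵏ A* ⊗ E` are the `R`-multilinear alternating maps `L [⋀^Fin k]→ₗ[R] E`.  -/

instance AlternatingMap.instIsScalarTowerBase {𝕜 R N E ι : Type*} [CommSemiring R] [AddCommGroup N]
    [Module R N] [AddCommGroup E] [Module R E] [CommSemiring 𝕜] [Algebra 𝕜 R] [Module 𝕜 E]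
    [IsScalarTower 𝕜 R E] : IsScalarTower 𝕜 R (N [⋀^ι]→ₗ[R] E) :=
  ⟨fun c f ω => by ext v; exact smul_assoc c f (ω v)⟩

noncomputable section LieAlgebroids

variable {𝕜 R L N E S : Type*} [Field 𝕜] [CommRing R] [Algebra 𝕜 R]
  [AddCommGroup L] [Module R L] [Module 𝕜 L]
  [AddCommGroup N] [Module R N] [Module 𝕜 N]
  [AddCommGroup E] [Module R E] [Module 𝕜 E]
  [AddCommGroup S] [Module R S] [Module 𝕜 S]

/-- A `𝕜`-linear operator `T` on an `R`-module `N` satisfying the Leibniz rule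
`T (f x) = δ(f) x + f T(x)` over the derivation `δ` of `R` (Lie derivatives and covariant
derivatives along a fixed direction are of this kind). -/
structure DerEnd (δ : Derivation 𝕜 R R) (N : Type*) [AddCommGroup N] [Module R N] [Module 𝕜 N]
    extends N →ₗ[𝕜] N where
  leibniz' : ∀ (f : R) (x : N), toFun (f • x) = δ f • x + f • toFun x

namespace DerEnd

variable {δ : Derivation 𝕜 R R}

instance : CoeFun (DerEnd δ N) (fun _ => N → N) := ⟨fun T => T.toLinearMap⟩

theorem leibniz (T : DerEnd δ N) (f : R) (x : N) : T (f • x) = δ f • x + f • T x :=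
  T.leibniz' f x

/-- The derivation `δ` itself, acting on functions. -/
def scalar (δ : Derivation 𝕜 R R) : DerEnd δ R where
  toLinearMap := δ.toLinearMap
  leibniz' f x := by simp [mul_comm, add_comm]

/-- Product rule on homomorphisms: `(L φ)(x) = U (φ x) - φ (T x)`. -/
def hom [IsScalarTower 𝕜 R E] (T : DerEnd δ N) (U : DerEnd δ E) : DerEnd δ (N →ₗ[R] E) where
  toFun φ :=
    { toFun := fun x => U (φ x) - φ (T x)
      map_add' := fun x y => by simp only [map_add]; abel
      map_smul' := fun f x => by
        simp only [map_smul, leibniz, map_add, RingHom.id_apply, smul_sub]; abel }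
  map_add' φ ψ := by ext x; simp; abel
  map_smul' c φ := by ext x; simp [smul_sub]
  leibniz' f φ := by
    ext x
    simp only [LinearMap.coe_mk, AddHom.coe_mk, LinearMap.smul_apply, leibniz, LinearMap.add_apply,
      smul_sub]
    abel

open Function in
/-- Product rule on alternating forms:
`(L ω)(v₁, …, v_k) = U (ω (v₁, …, v_k)) - ∑ i, ω (v₁, …, T vᵢ, …, v_k)`. -/
def alt [IsScalarTower 𝕜 R E] (T : DerEnd δ N) (U : DerEnd δ E) (k : ℕ) : DerEnd δ (N [⋀^Fin k]→ₗ[R] E) where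
  toFun ω :=
    { toFun := fun v => U (ω v) - ∑ i, ω (update v i (T (v i)))
      map_update_add' := by
        intro inst v i x y
        obtain rfl : inst = instDecidableEqFin k := Subsingleton.elim _ _
        have h (z : N) : ∑ j, ω (update (update v i z) j (T (update v i z j)))
            = ω (update v i (T z)) + ∑ j ∈ Finset.univ.erase i,
              ω (update (update v j (T (v j))) i z) := by
          rw [← Finset.add_sum_erase _ _ (Finset.mem_univ i)]
          congr 1
          · simp
          · refine Finset.sum_congr rfl fun j hj => ?_
            have hj' : j ≠ i := Finset.ne_of_mem_erase hj
            rw [update_of_ne hj', update_comm hj']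
        rw [h, h, h]
        simp only [AlternatingMap.map_update_add, map_add, Finset.sum_add_distrib]
        abel
      map_update_smul' := by
        intro inst v i f x
        obtain rfl : inst = instDecidableEqFin k := Subsingleton.elim _ _
        have h (z : N) : ∑ j, ω (update (update v i z) j (T (update v i z j)))
            = ω (update v i (T z)) + ∑ j ∈ Finset.univ.erase i,
              ω (update (update v j (T (v j))) i z) := by
          rw [← Finset.add_sum_erase _ _ (Finset.mem_univ i)]
          congr 1
          · simp
          · refine Finset.sum_congr rfl fun j hj => ?_
            have hj' : j ≠ i := Finset.ne_of_mem_erase hj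
            rw [update_of_ne hj', update_comm hj']
        rw [h, h]
        simp only [AlternatingMap.map_update_smul, leibniz, AlternatingMap.map_update_add,
          smul_sub, smul_add, Finset.smul_sum]
        abel
      map_eq_zero_of_eq' := by
        intro v i j hv hij
        have hz : ω v = 0 := ω.map_eq_zero_of_eq v hv hij
        rw [hz, map_zero, zero_sub, neg_eq_zero]
        rw [Fintype.sum_eq_add i j hij]
        · have := ω.map_swap (update v i (T (v i))) hij
          rw [← add_eq_zero_iff_eq_neg, add_comm] at this
          convert this using 3
          ext l
          by_cases hl : l = i
          · subst hl; simp [hij, hv.symm, Function.comp, update_of_ne hij.symm]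
          · by_cases hl' : l = j
            · subst hl'; simp [hv]
            · simp [Function.comp, Equiv.swap_apply_of_ne_of_ne hl hl', hl, hl'] 
        · rintro l ⟨hl, hl'⟩
          exact ω.map_eq_zero_of_eq _ (by rw [update_of_ne hl.symm, update_of_ne hl'.symm, hv]) hij }
  map_add' ω η := by
    ext v
    simp [Finset.sum_add_distrib]; abel
  map_smul' c ω := by
    ext v
    simp [smul_sub, Finset.smul_sum]
  leibniz' f ω := by
    ext v
    simp only [AlternatingMap.smul_apply, AlternatingMap.add_apply, leibniz,
      ← Finset.smul_sum, smul_sub, AlternatingMap.coe_mk, MultilinearMap.coe_mk]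
    abel

/-- The Lie derivative of vector fields (derivations of `R`) along `δ`. -/
def lieDer (δ : Derivation 𝕜 R R) : DerEnd δ (Derivation 𝕜 R R) where
  toFun D := ⁅δ, D⁆
  map_add' D D' := lie_add δ D D'
  map_smul' c D := by ext f; simp [Derivation.commutator_apply, smul_sub]
  leibniz' f D := by
    ext g
    simp only [Derivation.commutator_apply, Derivation.smul_apply, Derivation.add_apply,
      Derivation.leibniz, smul_eq_mul]
    ring

end DerEnd


/-- A Lie algebroid, described on sections: a `𝕜`-bilinear Lie bracket on the sections `L` and a
bundle map `anchor` to the (complexified, if `𝕜 = ℂ`) tangent bundle, whose sections are the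
derivations of `R`, such that the anchor is a morphism of Lie algebras and the Leibniz rule holds. -/
structure LieAlgebroid (𝕜 R L : Type*) [Field 𝕜] [CommRing R] [Algebra 𝕜 R]
    [AddCommGroup L] [Module R L] [Module 𝕜 L] where
  bracket : L →ₗ[𝕜] L →ₗ[𝕜] L
  anchor : L →ₗ[R] Derivation 𝕜 R R
  bracket_self : ∀ X, bracket X X = 0
  jacobi : ∀ X Y Z, bracket X (bracket Y Z) = bracket (bracket X Y) Z + bracket Y (bracket X Z)
  anchor_bracket : ∀ X Y, anchor (bracket X Y) = ⁅anchor X, anchor Y⁆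
  leibniz : ∀ X (f : R) Y, bracket X (f • Y) = anchor X f • Y + f • bracket X Y

namespace LieAlgebroid

variable (ℒ : LieAlgebroid 𝕜 R L)

theorem bracket_swap (X Y : L) : ℒ.bracket Y X = -ℒ.bracket X Y := by
  have h := ℒ.bracket_self (X + Y)
  simp only [map_add, LinearMap.add_apply, ℒ.bracket_self, zero_add, add_zero] at h
  exact eq_neg_of_add_eq_zero_right (by rw [← h]; abel)

/-- The Lie derivative `[X, ·]` on sections of `A`. -/
def ad (X : L) : DerEnd (ℒ.anchor X) L where
  toLinearMap := ℒ.bracket X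
  leibniz' f Y := ℒ.leibniz X f Y

/-- The Lie derivative on sections of `A*`:
`(L_X θ)(Y) = a(X)(θ(Y)) - θ([X, Y])`. -/
def coad (X : L) : DerEnd (ℒ.anchor X) (Dual R L) :=
  (ℒ.ad X).hom (DerEnd.scalar (ℒ.anchor X))

/-- The differential of a function: `(d f)(X) = a(X) f`. -/
def dFun (f : R) : Dual R L where
  toFun X := ℒ.anchor X f
  map_add' X Y := by simp
  map_smul' g X := by simp

/-- A module over the Lie algebroid: a flat action of its sections on the module `E`. -/
structure Rep (E : Type*) [AddCommGroup E] [Module R E] [Module 𝕜 E] where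
  act : ∀ X, DerEnd (ℒ.anchor X) E
  act_add : ∀ X Y e, act (X + Y) e = act X e + act Y e
  act_smul : ∀ (f : R) X e, act (f • X) e = f • act X e
  act_bracket : ∀ X Y e, act (ℒ.bracket X Y) e = act X (act Y e) - act Y (act X e)

/-- The module of functions, on which `X` acts through the anchor. -/
def trivialRep : ℒ.Rep R where
  act X := DerEnd.scalar (ℒ.anchor X)
  act_add X Y f := by simp [DerEnd.scalar]
  act_smul f X g := by simp [DerEnd.scalar]
  act_bracket X Y f := by
    change ℒ.anchor (ℒ.bracket X Y) f = _
    rw [ℒ.anchor_bracket, Derivation.commutator_apply]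
    rfl

namespace Rep

variable {ℒ}

open Fin in
/-- The formula for the differential of an `E`-valued `k`-form `ω`,
`(dω)(X₀, …, X_k) = ∑ i, (-1)^i Xᵢ · ω(…, X̂ᵢ, …)
  + ∑ i < j, (-1)^(i+j) ω([Xᵢ, Xⱼ], …, X̂ᵢ, …, X̂ⱼ, …)`.
The pair `(i, j)` with `i ≤ j` in the second sum stands for the positions `(i, j + 1)`, whence
the minus sign; for `k = 0` the second sum is empty. -/
def differentialFormula (ρ : ℒ.Rep E) : ∀ {k : ℕ}, ((Fin k → L) → E) → (Fin (k + 1) → L) → E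
  | 0, ω, X => ρ.act (X 0) (ω (removeNth 0 X))
  | k + 1, ω, X =>
      (∑ i : Fin (k + 2), (-1 : ℤ) ^ (i : ℕ) • ρ.act (X i) (ω (removeNth i X))) -
        ∑ i : Fin (k + 1), ∑ j ≥ i, (-1 : ℤ) ^ (i + j : ℕ) •
          ω (Matrix.vecCons (ℒ.bracket (X i.castSucc) (X j.succ))
            (removeNth j (removeNth i.castSucc X)))

section aux
open Fin AlternatingMap

/-- An `R`-multilinear alternating map, regarded as `𝕜`-multilinear. -/
def toBase (𝕜 : Type*) [Field 𝕜] [Algebra 𝕜 R] [Module 𝕜 L] [IsScalarTower 𝕜 R L]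
    [Module 𝕜 E] [IsScalarTower 𝕜 R E] {k : ℕ} (ω : L [⋀^Fin k]→ₗ[R] E) :
    L [⋀^Fin k]→ₗ[𝕜] E where
  toMultilinearMap := ω.toMultilinearMap.restrictScalars 𝕜
  map_eq_zero_of_eq' v _ _ h hij := ω.map_eq_zero_of_eq v h hij

/-- The action, as a `𝕜`-linear map. -/
def actBase [IsScalarTower 𝕜 R L] [IsScalarTower 𝕜 R E] (ρ : ℒ.Rep E) : L →ₗ[𝕜] (E →ₗ[𝕜] E) where
  toFun X := (ρ.act X).toLinearMap
  map_add' X Y := by ext e; exact ρ.act_add X Y e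
  map_smul' c X := by
    ext e
    have := ρ.act_smul (algebraMap 𝕜 R c) X e
    rw [algebraMap_smul R c X, algebraMap_smul R c] at this
    exact this

theorem exists_base [IsScalarTower 𝕜 R L] [IsScalarTower 𝕜 R E] [CharZero 𝕜] (ρ : ℒ.Rep E) : ∀ {k : ℕ} (ω : L [⋀^Fin k]→ₗ[R] E),
    ∃ F : L [⋀^Fin (k + 1)]→ₗ[𝕜] E, ∀ v, F v = ρ.differentialFormula ω v := by
  intro k ω
  let f₁ : L →ₗ[𝕜] L [⋀^Fin k]→ₗ[𝕜] E :=
    { toFun := fun X => (ρ.actBase X).compAlternatingMap (toBase 𝕜 ω)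
      map_add' := fun X Y => by ext v; simp
      map_smul' := fun c X => by ext v; simp }
  have h₁ (v : Fin (k + 1) → L) : alternatizeUncurryFin f₁ v
      = ∑ i : Fin (k + 1), (-1 : ℤ) ^ (i : ℕ) • ρ.act (v i) (ω (removeNth i v)) :=
    alternatizeUncurryFin_apply f₁ v
  cases k with
  | zero => exact ⟨alternatizeUncurryFin f₁, fun v => by rw [h₁]; simp [differentialFormula]⟩
  | succ k =>
    let f₂ : L →ₗ[𝕜] L →ₗ[𝕜] L [⋀^Fin k]→ₗ[𝕜] E :=
      ℒ.bracket.compr₂ (curryLeft (toBase 𝕜 ω))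
    have h₂ (v : Fin (k + 2) → L) :
        alternatizeUncurryFin (alternatizeUncurryFinLM ∘ₗ f₂) v =
        (2 : 𝕜) • ∑ i : Fin (k + 1), ∑ j ≥ i, (-1 : ℤ) ^ (i + j : ℕ) •
          ω (Matrix.vecCons (ℒ.bracket (v i.castSucc) (v j.succ))
            (removeNth j (removeNth i.castSucc v))) := by
      rw [alternatizeUncurryFin_alternatizeUncurryFinLM_comp_apply, Finset.smul_sum]
      refine Finset.sum_congr rfl fun i _ => ?_
      rw [Finset.smul_sum]
      refine Finset.sum_congr rfl fun j _ => ?_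
      rw [smul_comm (2 : 𝕜)]
      congr 1
      change ω (Matrix.vecCons (ℒ.bracket _ _) _) - ω (Matrix.vecCons (ℒ.bracket _ _) _) = _
      rw [ℒ.bracket_swap (v i.castSucc), two_smul, sub_eq_add_neg]
      congr 1
      have := ω.map_vecCons_smul (removeNth j (removeNth i.castSucc v)) (-1)
        (ℒ.bracket (v i.castSucc) (v j.succ))
      rw [neg_one_smul, neg_one_smul] at this
      rw [this, neg_neg]
    refine ⟨alternatizeUncurryFin f₁
      - (2 : 𝕜)⁻¹ • alternatizeUncurryFin (alternatizeUncurryFinLM ∘ₗ f₂), fun v => ?_⟩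
    rw [AlternatingMap.sub_apply, AlternatingMap.smul_apply, h₁, h₂, smul_smul,
      inv_mul_cancel₀ two_ne_zero, one_smul]
    rfl

theorem removeNth_succ_vecCons {V : Type*} {k : ℕ} (i : Fin (k + 1)) (x : V)
    (v : Fin (k + 1) → V) :
    removeNth i.succ (Matrix.vecCons x v) = Matrix.vecCons x (removeNth i v) :=
  funext (Fin.cases rfl fun _ => by simp [removeNth, Matrix.vecCons])

theorem differentialFormula_vecCons_smul (ρ : ℒ.Rep E) {k : ℕ} (ω : L [⋀^Fin k]→ₗ[R] E) (f : R)
    (x : L) (v : Fin k → L) : ρ.differentialFormula ω (Matrix.vecCons (f • x) v)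
      = f • ρ.differentialFormula ω (Matrix.vecCons x v) := by
  cases k with
  | zero =>
    simp only [differentialFormula, removeNth_zero, Matrix.cons_val_zero, ρ.act_smul]
    rfl
  | succ k =>
    have hb (y : L) : ℒ.bracket (f • x) y = f • ℒ.bracket x y - ℒ.anchor y f • x := by
      rw [ℒ.bracket_swap y (f • x), ℒ.leibniz, ℒ.bracket_swap x y, smul_neg]; abel
    have hc (y z : L) (w : Fin k → L) : ω (Matrix.vecCons (y - z) w)
        = ω (Matrix.vecCons y w) - ω (Matrix.vecCons z w) := by
      have := ω.map_vecCons_add w (y - z) z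
      rw [sub_add_cancel] at this
      rw [this, add_sub_cancel_right]
    have hs (i : Fin k) (j : Fin (k + 1)) (hj : j ≥ i.succ) (y : L) :
        (-1 : ℤ) ^ ((i.succ : Fin (k + 1)) + j : ℕ) • ω (Matrix.vecCons
          (ℒ.bracket ((Matrix.vecCons (f • y) v : Fin (k + 2) → L) i.succ.castSucc)
            ((Matrix.vecCons (f • y) v : Fin (k + 2) → L) j.succ))
          (removeNth j (removeNth i.succ.castSucc (Matrix.vecCons (f • y) v)))) =
        f • (-1 : ℤ) ^ ((i.succ : Fin (k + 1)) + j : ℕ) • ω (Matrix.vecCons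
          (ℒ.bracket ((Matrix.vecCons y v : Fin (k + 2) → L) i.succ.castSucc)
            ((Matrix.vecCons y v : Fin (k + 2) → L) j.succ))
          (removeNth j (removeNth i.succ.castSucc (Matrix.vecCons y v)))) := by
      obtain ⟨j, rfl⟩ := Fin.exists_succ_eq.2 (ne_of_gt (lt_of_lt_of_le (Fin.succ_pos i) hj))
      cases k with
      | zero => exact i.elim0
      | succ k =>
        rw [smul_comm f]
        congr 1
        rw [← Fin.succ_castSucc]
        simp only [Matrix.cons_val_succ, removeNth_succ_vecCons]
        have := ω.map_update_smul (Matrix.vecCons (ℒ.bracket (v i.castSucc) (v j.succ))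
          (Matrix.vecCons y (removeNth j (removeNth i.castSucc v)))) 1 f y
        have hu (z : L) : Function.update (Matrix.vecCons (ℒ.bracket (v i.castSucc) (v j.succ))
            (Matrix.vecCons y (removeNth j (removeNth i.castSucc v)))) 1 z =
            Matrix.vecCons (ℒ.bracket (v i.castSucc) (v j.succ))
            (Matrix.vecCons z (removeNth j (removeNth i.castSucc v))) := by
          ext l
          refine Fin.cases ?_ (fun l => Fin.cases ?_ (fun l => ?_) l) l
          · simp
          · simp
          · rw [Function.update_of_ne (by
              rw [← Fin.succ_zero_eq_one]
              exact fun h => Fin.succ_ne_zero _ (Fin.succ_injective _ h))]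
            simp
        rw [hu, hu] at this
        exact this
    have h0 (y : L) (j : Fin (k + 1)) :
        removeNth j (removeNth (0 : Fin (k + 1)).castSucc (Matrix.vecCons y v))
          = removeNth j v := by
      rw [Fin.castSucc_zero, removeNth_zero]; rfl
    have h1 (y : L) : removeNth (0 : Fin (k + 2)) (Matrix.vecCons y v) = v := by
      rw [removeNth_zero]; rfl
    have hIci (g : Fin (k + 1) → E) : ∑ j ≥ (0 : Fin (k + 1)), g j = ∑ j, g j :=
      Finset.sum_congr (by ext; simp) fun _ _ => rfl
    let T : L → E := fun y => ∑ i : Fin k, ∑ j ≥ i.succ,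
      (-1 : ℤ) ^ ((i.succ : Fin (k + 1)) + j : ℕ) • ω (Matrix.vecCons
          (ℒ.bracket ((Matrix.vecCons y v : Fin (k + 2) → L) i.succ.castSucc)
            ((Matrix.vecCons y v : Fin (k + 2) → L) j.succ))
          (removeNth j (removeNth i.succ.castSucc (Matrix.vecCons y v))))
    have hT : T (f • x) = f • T x := by
      simp only [T, Finset.smul_sum]
      exact Finset.sum_congr rfl fun i _ => Finset.sum_congr rfl fun j hj =>
        hs i j (Finset.mem_Ici.1 hj) x
    have hy (y : L) : ρ.differentialFormula ω (Matrix.vecCons y v) = ρ.act y (ω v) -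
        (∑ i : Fin (k + 1), (-1 : ℤ) ^ (i : ℕ) •
          ρ.act (v i) (ω (Matrix.vecCons y (removeNth i v)))) -
        (∑ j : Fin (k + 1), (-1 : ℤ) ^ (j : ℕ) •
          ω (Matrix.vecCons (ℒ.bracket y (v j)) (removeNth j v))) - T y := by
      simp only [differentialFormula]
      refine (congrArg₂ (· - ·) (Fin.sum_univ_succ _) (Fin.sum_univ_succ _)).trans ?_
      have hTy : T y = ∑ i : Fin k, ∑ j ≥ i.succ,
        (-1 : ℤ) ^ ((i.succ : Fin (k + 1)) + j : ℕ) • ω (Matrix.vecCons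
          (ℒ.bracket ((Matrix.vecCons y v : Fin (k + 2) → L) i.succ.castSucc)
            ((Matrix.vecCons y v : Fin (k + 2) → L) j.succ))
          (removeNth j (removeNth i.succ.castSucc (Matrix.vecCons y v)))) := rfl
      have ha (i : Fin (k + 1)) (e : E) : ρ.act ((Matrix.vecCons y v : Fin (k + 2) → L) i.succ) e
        = ρ.act (v i) e := rfl
      rw [hIci, ← hTy]
      clear_value T
      simp only [h0, ha, h1, removeNth_succ_vecCons, Matrix.cons_val_succ, Matrix.cons_val_zero,
        Fin.val_zero, pow_zero, one_smul, zero_add, Fin.val_succ, pow_succ,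
        mul_neg, mul_one, neg_smul, Finset.sum_neg_distrib]
      simp only [Fin.castSucc_zero, Matrix.cons_val_zero]
      abel
    rw [hy, hy, hT]
    simp only [ρ.act_smul, AlternatingMap.map_vecCons_smul, DerEnd.leibniz, hb, hc,
      smul_add, smul_sub, Finset.sum_add_distrib, Finset.sum_sub_distrib, Finset.smul_sum,
      smul_comm f]
    abel

end aux

variable [IsScalarTower 𝕜 R L] [IsScalarTower 𝕜 R E]

open Fin in
/-- The differential of an alternating form is an alternating form. -/
def differentialAlt [CharZero 𝕜] (ρ : ℒ.Rep E) {k : ℕ} (ω : L [⋀^Fin k]→ₗ[R] E) :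
    L [⋀^Fin (k + 1)]→ₗ[R] E where
  toFun := ρ.differentialFormula ω
  map_update_add' := by
    intro inst v i x y
    obtain rfl : inst = instDecidableEqFin _ := Subsingleton.elim _ _
    obtain ⟨F, hF⟩ := ρ.exists_base ω
    simp only [← hF]
    exact F.map_update_add v i x y
  map_update_smul' := by
    intro inst v i f x
    obtain rfl : inst = instDecidableEqFin _ := Subsingleton.elim _ _
    obtain ⟨F, hF⟩ := ρ.exists_base ω
    rw [← Fin.insertNth_removeNth, ← Fin.insertNth_removeNth, ← hF, ← hF, F.map_insertNth,
      F.map_insertNth, hF, hF, differentialFormula_vecCons_smul, smul_comm]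
  map_eq_zero_of_eq' := by
    intro v i j hv hij
    obtain ⟨F, hF⟩ := ρ.exists_base ω
    rw [← hF]
    exact F.map_eq_zero_of_eq v hv hij

end Rep
end LieAlgebroid

/-- Families of alternating forms on `N` with values in `E`, one in each degree. -/
abbrev Cochain (R N E : Type*) [CommRing R] [AddCommGroup N] [Module R N] [AddCommGroup E]
    [Module R E] := ∀ k : ℕ, N [⋀^Fin k]→ₗ[R] E

namespace LieAlgebroid.Rep
variable [IsScalarTower 𝕜 R L] [IsScalarTower 𝕜 R E] {ℒ : LieAlgebroid 𝕜 R L}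

/-- The differential of the Lie algebroid with coefficients in the module `E`, raising the degree
by one. -/
def differential [CharZero 𝕜] (ρ : ℒ.Rep E) : Cochain R L E →ₗ[𝕜] Cochain R L E where
  toFun ω := fun
    | 0 => 0
    | k + 1 => ρ.differentialAlt (ω k)
  map_add' ω η := by
    funext k
    rcases k with _ | _ | k
    · simp
    · ext v
      simp [differentialAlt, differentialFormula]
    · ext v
      simp [differentialAlt, differentialFormula, Finset.sum_add_distrib]
      abel
  map_smul' c ω := by
    funext k
    rcases k with _ | _ | k
    · simp
    · ext v
      simp [differentialAlt, differentialFormula]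
    · ext v
      simp [differentialAlt, differentialFormula, Finset.smul_sum, smul_sub, smul_comm c]

end LieAlgebroid.Rep

namespace Cochain
open AlternatingMap

/-- Exterior multiplication by `φ`:
`(φ ∧ ω)(v₀, …, v_k) = ∑ i, (-1)^i φ(vᵢ) ω(…, v̂ᵢ, …)`. -/
def wedge (φ : Dual R N) : Cochain R N E →ₗ[R] Cochain R N E where
  toFun ω := fun
    | 0 => 0
    | k + 1 => alternatizeUncurryFin (φ.smulRight (ω k))
  map_add' ω η := by
    funext k
    cases k with
    | zero => simp
    | succ k => ext v; simp [alternatizeUncurryFin_apply, Finset.sum_add_distrib]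
  map_smul' f ω := by
    funext k
    cases k with
    | zero => simp
    | succ k =>
      ext v
      simp [alternatizeUncurryFin_apply, Finset.smul_sum, smul_comm f]

/-- Interior multiplication by `x`: `(i_x ω)(v₁, …, v_k) = ω(x, v₁, …, v_k)`. -/
def contract (x : N) : Cochain R N E →ₗ[R] Cochain R N E where
  toFun ω := fun k => curryLeft (ω (k + 1)) x
  map_add' _ _ := rfl
  map_smul' _ _ := rfl

theorem wedge_add (φ ψ : Dual R N) : wedge (E := E) (φ + ψ) = wedge (E := E) φ + wedge (E := E) ψ := by
  refine LinearMap.ext fun ω => funext fun k => ?_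
  cases k with
  | zero => exact (add_zero _).symm
  | succ k =>
    ext v
    simp [wedge, alternatizeUncurryFin_apply, add_smul, Finset.sum_add_distrib]

theorem wedge_smul (f : R) (φ : Dual R N) : wedge (E := E) (f • φ) = f • wedge (E := E) φ := by
  refine LinearMap.ext fun ω => funext fun k => ?_
  cases k with
  | zero => exact (smul_zero f).symm
  | succ k =>
    ext v
    simp [wedge, alternatizeUncurryFin_apply, mul_smul, Finset.smul_sum, smul_comm f]

theorem contract_add (x y : N) : contract (R := R) (E := E) (x + y) =
    contract (R := R) (E := E) x + contract (R := R) (E := E) y :=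
  LinearMap.ext fun ω => funext fun k => (curryLeft (ω (k + 1))).map_add x y

theorem contract_smul (f : R) (x : N) : contract (R := R) (E := E) (f • x) =
    f • contract (R := R) (E := E) x :=
  LinearMap.ext fun ω => funext fun k => (curryLeft (ω (k + 1))).map_smul f x

theorem wedge_wedge (φ : Dual R N) (ω : Cochain R N E) : wedge φ (wedge φ ω) = 0 := by
  funext k
  rcases k with _ | _ | k
  · rfl
  · ext v
    simp [wedge, alternatizeUncurryFin_apply]
  · have h : φ.smulRight (alternatizeUncurryFin (φ.smulRight (ω k)))
        = alternatizeUncurryFinLM ∘ₗ φ.smulRight (φ.smulRight (ω k)) := by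
      refine LinearMap.ext fun x => ?_
      simp
    change alternatizeUncurryFin (φ.smulRight (alternatizeUncurryFin (φ.smulRight (ω k)))) = 0
    rw [h]
    exact alternatizeUncurryFin_alternatizeUncurryFinLM_comp_of_symmetric
      (f := φ.smulRight (φ.smulRight (ω k))) (fun x y => by simp [smul_comm (φ x)])

theorem contract_contract (x : N) (ω : Cochain R N E) : contract x (contract x ω) = 0 := by
  funext k
  exact curryLeft_same (ω (k + 2)) x

theorem contract_wedge (φ : Dual R N) (x : N) (ω : Cochain R N E) :
    contract x (wedge φ ω) = φ x • ω - wedge φ (contract x ω) := by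
  have hc {k : ℕ} (i : Fin (k + 1)) (v : Fin (k + 1) → N) :
      Fin.removeNth i.succ (Matrix.vecCons x v) = Matrix.vecCons x (Fin.removeNth i v) :=
    funext (Fin.cases rfl fun _ => by simp [Fin.removeNth, Matrix.vecCons])
  funext k
  ext v
  change alternatizeUncurryFin (φ.smulRight (ω k)) (Matrix.vecCons x v)
    = φ x • ω k v - wedge φ (contract x ω) k v
  rw [alternatizeUncurryFin_apply, Fin.sum_univ_succ]
  have h0 : Fin.removeNth 0 (Matrix.vecCons x v) = v := by rw [Fin.removeNth_zero]; rfl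
  cases k with
  | zero => simp [wedge, h0]
  | succ k =>
    change _ = _ - alternatizeUncurryFin (φ.smulRight (curryLeft (ω (k + 1)) x)) v
    rw [alternatizeUncurryFin_apply]
    simp only [LinearMap.smulRight_apply, AlternatingMap.smul_apply, hc, h0, curryLeft_apply_apply,
      Matrix.cons_val_zero, Matrix.cons_val_succ, Fin.val_zero, pow_zero, one_smul, Fin.val_succ,
      pow_succ, mul_neg, mul_one, neg_smul, Finset.sum_neg_distrib, sub_eq_add_neg]

end Cochain

end LieAlgebroids

noncomputable section Spinors

variable {𝕜 R L S : Type*} [Field 𝕜] [CommRing R] [Algebra 𝕜 R]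
  [AddCommGroup L] [Module R L] [AddCommGroup S] [Module R S]

/-- The sections of `⋀ A ⊗ 𝒮`, graded by degree: a section of `⋀ᵏ A ⊗ 𝒮` is an alternating
form of degree `k` on the sections of `A*` with values in the sections of `𝒮`.  (The components
of degree larger than the rank of `A` vanish.)  For `S = R` these are the multivectors `Γ(⋀ A)`. -/
abbrev Spinor (R L S : Type*) [CommRing R] [AddCommGroup L] [Module R L] [AddCommGroup S]
    [Module R S] := Cochain R (Dual R L) S

/-- The pseudo-metric `⟨X₁ + ξ₁, X₂ + ξ₂⟩ = ½ (ξ₁(X₂) + ξ₂(X₁))` on `A ⊕ A*`. -/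
def pairing (𝕜 R L : Type*) [Field 𝕜] [CommRing R] [Algebra 𝕜 R] [AddCommGroup L] [Module R L] :
    LinearMap.BilinForm R (L × Dual R L) :=
  (2⁻¹ : 𝕜) •
    ((LinearMap.id : Dual R L →ₗ[R] Dual R L).compl₁₂ (LinearMap.snd R L (Dual R L)) (LinearMap.fst R L (Dual R L)) +
      ((LinearMap.id : Dual R L →ₗ[R] Dual R L).compl₁₂ (LinearMap.snd R L (Dual R L))
        (LinearMap.fst R L (Dual R L))).flip)

theorem pairing_apply (e₁ e₂ : L × Dual R L) :
    pairing 𝕜 R L e₁ e₂ = (2⁻¹ : 𝕜) • (e₁.2 e₂.1 + e₂.2 e₁.1) := rfl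

/-- The quadratic form `e ↦ ⟨e, e⟩`; its Clifford algebra has the relations
`x y + y x = 2 ⟨x, y⟩`. -/
abbrev pairingForm (𝕜 R L : Type*) [Field 𝕜] [CommRing R] [Algebra 𝕜 R] [AddCommGroup L]
    [Module R L] : QuadraticForm R (L × Dual R L) :=
  LinearMap.BilinMap.toQuadraticMap (pairing 𝕜 R L)

namespace Spinor

/-- Exterior multiplication by a section `X` of `A`. -/
def extMul : L →ₗ[R] End R (Spinor R L S) where
  toFun X := Cochain.wedge (Dual.eval R L X)
  map_add' X Y := by rw [map_add, Cochain.wedge_add]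
  map_smul' f X := by rw [map_smul, Cochain.wedge_smul, RingHom.id_apply]

/-- Interior multiplication by a section `ξ` of `A*`. -/
def intMul : Dual R L →ₗ[R] End R (Spinor R L S) where
  toFun ξ := Cochain.contract ξ
  map_add' ξ η := Cochain.contract_add ξ η
  map_smul' f ξ := Cochain.contract_smul f ξ

/-- The Clifford action of `X + ξ`: `X ∧ · + i_ξ`. -/
def cliffordAction : (L × Dual R L) →ₗ[R] End R (Spinor R L S) :=
  extMul ∘ₗ LinearMap.fst R L (Dual R L) + intMul ∘ₗ LinearMap.snd R L (Dual R L)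

theorem cliffordAction_sq [CharZero 𝕜] (e : L × Dual R L) :
    cliffordAction (S := S) e * cliffordAction e
      = algebraMap R (End R (Spinor R L S)) (pairingForm 𝕜 R L e) := by
  have hQ : pairingForm 𝕜 R L e = e.2 e.1 := by
    rw [LinearMap.BilinMap.toQuadraticMap_apply, pairing_apply, ← two_smul 𝕜, smul_smul,
      inv_mul_cancel₀ two_ne_zero, one_smul]
  rw [hQ]
  refine LinearMap.ext fun ω => ?_
  simp only [cliffordAction, extMul, intMul, LinearMap.coe_mk, AddHom.coe_mk,
    LinearMap.comp_apply, LinearMap.fst_apply, LinearMap.snd_apply, Module.End.mul_apply,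
    LinearMap.add_apply, map_add, Cochain.wedge_wedge, Cochain.contract_contract,
    Cochain.contract_wedge, Dual.eval_apply, Module.algebraMap_end_apply]
  abel

/-- The spin module of the Clifford algebra of `A ⊕ A*`. -/
def spinModule (𝕜 R L S : Type*) [Field 𝕜] [CharZero 𝕜] [CommRing R] [Algebra 𝕜 R]
    [AddCommGroup L] [Module R L] [AddCommGroup S] [Module R S] :
    CliffordAlgebra (pairingForm 𝕜 R L) →ₐ[R] End R (Spinor R L S) :=
  CliffordAlgebra.lift _ ⟨cliffordAction, cliffordAction_sq⟩

/-- The `ℤ/2`-grading by the parity of the degree. -/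
def parity (R L S : Type*) [CommRing R] [AddCommGroup L] [Module R L] [AddCommGroup S]
    [Module R S] (i : ZMod 2) : Submodule R (Spinor R L S) where
  carrier := {ω | ∀ k : ℕ, (k : ZMod 2) ≠ i → ω k = 0}
  add_mem' hω hη k hk := by rw [Pi.add_apply, hω k hk, hη k hk, add_zero]
  zero_mem' _ _ := rfl
  smul_mem' f ω hω k hk := by rw [Pi.smul_apply, hω k hk, smul_zero]

theorem extMul_sq (X : L) : extMul (R := R) (S := S) X * extMul (R := R) (S := S) X = 0 := by
  refine LinearMap.ext fun ω => ?_
  exact Cochain.wedge_wedge (Dual.eval R L X) ω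

/-- Exterior multiplication by elements of the exterior algebra of `L`. -/
def wedgeMul : ExteriorAlgebra R L →ₐ[R] End R (Spinor R L S) :=
  ExteriorAlgebra.lift R ⟨extMul, extMul_sq⟩

/-- The isomorphism `⋀ A ⊗ 𝒮 ≅ ⋀ A* ⊗ 𝒮'`, where `𝒮' = ⋀ⁿ A ⊗ 𝒮` and `n` is the rank of `A`
(so that `⋀ⁿ A* ⊗ 𝒮' = 𝒮`).  It sends `ω` of degree `n - k` to the `𝒮'`-valued `k`-form
`(X₁, …, X_k) ↦ X_k ∧ ⋯ ∧ X₁ ∧ ω`; its inverse is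
`ξ₁ ∧ ⋯ ∧ ξ_k ⊗ v ↦ i_{ξ₁} ⋯ i_{ξ_k} v` for `v` a section of `𝒮'`. -/
def complement (n : ℕ) (ω : Spinor R L S) : Cochain R L (Dual R L [⋀^Fin n]→ₗ[R] S) := fun k =>
  (LinearMap.proj n ∘ₗ LinearMap.applyₗ ω ∘ₗ wedgeMul.toLinearMap).compAlternatingMap
    ((ExteriorAlgebra.ιMulti R k).domDomCongr Fin.revPerm)

/-- The exterior product `X₁ ∧ ⋯ ∧ X_k ∧ ·`. -/
def listMul (Xs : List L) : End R (Spinor R L S) := (Xs.map extMul).prod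

/-- The multivector `f X₁ ∧ ⋯ ∧ X_k`. -/
def decomposable (f : R) (Xs : List L) : Spinor R L R :=
  f • listMul Xs (Pi.single 0 (AlternatingMap.constOfIsEmpty R (Dual R L) (Fin 0) 1))

end Spinor

/-- Dirac generating operators, on the sections `Sp` of a `ℤ/2`-graded bundle of Clifford modules
for the quadratic form `Q` (with Clifford action `γ` and homogeneous parts `grading i`): odd
operators `Ð` such that `[Ð, f]` and `[[Ð, e₁], e₂]` are Clifford actions of sections, and `Ð²` is
the multiplication by a function.  Here `[Ð, f] = Ð f - f Ð`, `[Ð, e₁] = Ð e₁ + e₁ Ð`, and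
`[T, e₂] = T e₂ - e₂ T` for the even operator `T = [Ð, e₁]`. -/
structure IsDiracGeneratingOperator {V Sp : Type*} [AddCommGroup V] [Module R V]
    [AddCommGroup Sp] [Module R Sp] [Module 𝕜 Sp] (Q : QuadraticForm R V)
    (γ : CliffordAlgebra Q →ₐ[R] End R Sp) (grading : ZMod 2 → Submodule R Sp)
    (Ð : Sp →ₗ[𝕜] Sp) : Prop where
  odd : ∀ i, ∀ s ∈ grading i, Ð s ∈ grading (i + 1)
  comm_function : ∀ f : R, ∃ e : V, ∀ s, Ð (f • s) - f • Ð s = γ (CliffordAlgebra.ι Q e) s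
  comm_section : ∀ e₁ e₂ : V, ∃ e : V, ∀ s,
    (Ð (γ (CliffordAlgebra.ι Q e₁) (γ (CliffordAlgebra.ι Q e₂) s)) +
        γ (CliffordAlgebra.ι Q e₁) (Ð (γ (CliffordAlgebra.ι Q e₂) s))) -
      γ (CliffordAlgebra.ι Q e₂) (Ð (γ (CliffordAlgebra.ι Q e₁) s) +
        γ (CliffordAlgebra.ι Q e₁) (Ð s)) = γ (CliffordAlgebra.ι Q e) s
  sq_function : ∃ f : R, ∀ s, Ð (Ð s) = f • s

end Spinors

noncomputable section Pairs

variable {𝕜 R L S : Type*} [Field 𝕜] [CharZero 𝕜] [CommRing R] [Algebra 𝕜 R]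
  [AddCommGroup L] [Module R L] [Module 𝕜 L] [IsScalarTower 𝕜 R L]
  [AddCommGroup S] [Module R S] [Module 𝕜 S] [IsScalarTower 𝕜 R S]

namespace LieAlgebroid

/-! ### Lie bialgebroids -/

/-- The Lie derivative of multivectors along a section `X` of `A`. -/
def lieMulti (ℒ : LieAlgebroid 𝕜 R L) (X : L) (v : Spinor R L R) : Spinor R L R := fun k =>
  (ℒ.coad X).alt (DerEnd.scalar (ℒ.anchor X)) k (v k)

/-- The Schouten bracket `[X₁ ∧ ⋯ ∧ X_k, v]`, by the Leibniz rule
`[X ∧ w, v] = X ∧ [w, v] + (-1)^|w| w ∧ [X, v]` and `[X, v] = L_X v`. -/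
def schoutenList (ℒ : LieAlgebroid 𝕜 R L) : List L → Spinor R L R → Spinor R L R
  | [], _ => 0
  | X :: Xs, v => Spinor.extMul X (ℒ.schoutenList Xs v) +
      (-1 : R) ^ Xs.length • Spinor.listMul Xs (ℒ.lieMulti X v)

/-- The bracket `[f X₁ ∧ ⋯ ∧ X_k, v]` of the Gerstenhaber algebra `Γ(⋀ A)` for an arbitrary
multivector `v`, by the Leibniz rule `[f w, v] = f [w, v] + w ∧ [f, v]` and `[f, v] = - i_{df} v`.
-/
def schouten (ℒ : LieAlgebroid 𝕜 R L) (f : R) (Xs : List L) (v : Spinor R L R) : Spinor R L R :=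
  f • ℒ.schoutenList Xs v - Spinor.listMul Xs (Spinor.intMul (ℒ.dFun f) v)

/-- `(A, A*)` is a Lie bialgebroid: the differential `d_*` of the Lie algebroid `A*` is a derivation
of the Gerstenhaber algebra `Γ(⋀ A)`, i.e. `d_*[u, v] = [d_* u, v] + (-1)^(k-1) [u, d_* v]` for `u`
of degree `k` and `v` of degree `l`.  Both sides are additive in `u` and `v`, and every
multivector is a finite sum of products `f X₁ ∧ ⋯ ∧ X_k`; so it is required for those.
The bracket `[d_* u, v]` is written as `-(-1)^(k (l-1)) [v, d_* u]`. -/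
def IsLieBialgebroid (ℒ : LieAlgebroid 𝕜 R L) (ℒ' : LieAlgebroid 𝕜 R (Dual R L)) : Prop :=
  ∀ (f g : R) (Xs Ys : List L),
    ℒ'.trivialRep.differential (ℒ.schouten f Xs (Spinor.decomposable g Ys)) =
      -((-1 : R) ^ (Xs.length * (Ys.length + 1)) •
          ℒ.schouten g Ys (ℒ'.trivialRep.differential (Spinor.decomposable f Xs))) +
        (-1 : R) ^ (Xs.length + 1) •
          ℒ.schouten f Xs (ℒ'.trivialRep.differential (Spinor.decomposable g Ys))

end LieAlgebroid

/-! ### The operator `Ð` -/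

/-- The differential forms of degree `m` on the base. -/
abbrev BaseForm (𝕜 R : Type*) [Field 𝕜] [CommRing R] [Algebra 𝕜 R] (m : ℕ) :=
  Derivation 𝕜 R R [⋀^Fin m]→ₗ[R] R

/-- The sections of `⋀ⁿ A* ⊗ ⋀ᵐ T*M = Hom(⋀ⁿ A, ⋀ᵐ T*M)`. -/
abbrev DetLine (𝕜 R L : Type*) [Field 𝕜] [CommRing R] [Algebra 𝕜 R] [AddCommGroup L]
    [Module R L] (n m : ℕ) :=
  (Dual R L [⋀^Fin n]→ₗ[R] R) →ₗ[R] BaseForm 𝕜 R m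

/-- The action on the sections of `⋀ⁿ A* ⊗ ⋀ᵐ T*M` induced, through the product rule, by an
operator `T` on the sections of `A*` and the Lie derivative along `δ` of forms on the base. -/
def DerEnd.detLine {δ : Derivation 𝕜 R R} (T : DerEnd δ (Dual R L)) (n m : ℕ) :
    DerEnd δ (DetLine 𝕜 R L n m) :=
  (T.alt (DerEnd.scalar δ) n).hom ((DerEnd.lieDer δ).alt (DerEnd.scalar δ) m)

/-- `D` is the square root of the operator `T`, where `sq : 𝒮 ⊗ 𝒮 ≅ K`:
`D s ⊗ t + s ⊗ D t = T (s ⊗ t)`. -/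
def IsSquareRoot {δ : Derivation 𝕜 R R} {K : Type*} [AddCommGroup K] [Module R K] [Module 𝕜 K]
    (sq : S ⊗[R] S ≃ₗ[R] K) (T : DerEnd δ K) (D : DerEnd δ S) : Prop :=
  ∀ s t : S, sq (D s ⊗ₜ t) + sq (s ⊗ₜ D t) = T (sq (s ⊗ₜ t))

variable {n m : ℕ}

/-- The `A*`-module structure on `𝒮 = (⋀ⁿ A* ⊗ ⋀ᵐ T*M)^½`: a section `α` of `A*` acts on
`⋀ⁿ A* ⊗ ⋀ᵐ T*M` through `[α, ·]_*` on `A*` and the Lie derivative along its anchor on forms. -/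
def IsDualAction (ℒ' : LieAlgebroid 𝕜 R (Dual R L)) (sq : S ⊗[R] S ≃ₗ[R] DetLine 𝕜 R L n m)
    (ρ : ℒ'.Rep S) : Prop :=
  ∀ α, IsSquareRoot sq ((ℒ'.ad α).detLine n m) (ρ.act α)

/-- The `A`-module structure on `𝒮' = (⋀ⁿ A ⊗ ⋀ᵐ T*M)^½ = ⋀ⁿ A ⊗ 𝒮`: a section `X` of `A` acts by
the product rule, through its Lie derivatives on `⋀ⁿ A` and on `𝒮 = (⋀ⁿ A* ⊗ ⋀ᵐ T*M)^½`. -/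
def IsComplementAction (ℒ : LieAlgebroid 𝕜 R L) (sq : S ⊗[R] S ≃ₗ[R] DetLine 𝕜 R L n m)
    (ρ : ℒ.Rep (Dual R L [⋀^Fin n]→ₗ[R] S)) : Prop :=
  ∀ X, ∃ D : DerEnd (ℒ.anchor X) S,
    IsSquareRoot sq ((ℒ.coad X).detLine n m) D ∧ ∀ v, ρ.act X v = (ℒ.coad X).alt D n v

/-- `Ð` is the operator `d̄_* + ∂̄` on the sections of `⋀ A ⊗ 𝒮`: here `d̄_*` is the differential of
the Lie algebroid `A*` with coefficients in `𝒮`, and `∂̄` corresponds, under the isomorphism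
`⋀ A ⊗ 𝒮 ≅ ⋀ A* ⊗ 𝒮'`, to the differential of the Lie algebroid `A` with coefficients in `𝒮'`. -/
def IsCanonicalDirac (ℒ : LieAlgebroid 𝕜 R L) (ℒ' : LieAlgebroid 𝕜 R (Dual R L))
    (sq : S ⊗[R] S ≃ₗ[R] DetLine 𝕜 R L n m) (Ð : Spinor R L S →ₗ[𝕜] Spinor R L S) : Prop :=
  ∃ (ρ' : ℒ'.Rep S) (ρ : ℒ.Rep (Dual R L [⋀^Fin n]→ₗ[R] S))
    (bdel : Spinor R L S →ₗ[𝕜] Spinor R L S),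
    IsDualAction ℒ' sq ρ' ∧ IsComplementAction ℒ sq ρ ∧
    (∀ ω, Spinor.complement n (bdel ω) = ρ.differential (Spinor.complement n ω)) ∧
    Ð = ρ'.differential + bdel

end Pairs

/-! ## Smooth functions and sections -/

open scoped Manifold ContDiff Bundle

noncomputable section Geometry

variable (m : ℕ) (M : Type*) (𝕜 : Type*) [RCLike 𝕜] [TopologicalSpace M]
  [ChartedSpace (EuclideanSpace ℝ (Fin m)) M]

/-- The algebra of smooth `𝕜`-valued functions on `M`. -/
def smoothFunctions : Subalgebra 𝕜 (M → 𝕜) where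
  carrier := {f | ContMDiff (𝓡 m) 𝓘(ℝ, 𝕜) ∞ f}
  mul_mem' hf hg :=
    (contDiff_mul (𝕜 := ℝ) (𝔸 := 𝕜) (n := ∞)).contMDiff.comp (hf.prodMk_space hg)
  add_mem' hf hg := ContMDiff.add hf hg
  algebraMap_mem' _ := contMDiff_const

variable (F : Type*) [NormedAddCommGroup F] [NormedSpace ℝ F] [NormedSpace 𝕜 F]
  (A : M → Type*) [∀ x, AddCommGroup (A x)] [∀ x, Module ℝ (A x)] [∀ x, Module 𝕜 (A x)]
  [∀ x, TopologicalSpace (A x)] [TopologicalSpace (Bundle.TotalSpace F A)]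
  [FiberBundle F A] [VectorBundle ℝ F A] [VectorBundle 𝕜 F A]

/-- The smooth sections of the `𝕜`-vector bundle `A` with fibre `F`, a module over the smooth
functions. -/
def smoothSections : Submodule (smoothFunctions m M 𝕜) (∀ x, A x) where
  carrier := {s | ContMDiff (𝓡 m) ((𝓡 m).prod 𝓘(ℝ, F)) ∞ (fun x => Bundle.TotalSpace.mk' F x (s x))}
  add_mem' hs ht := ContMDiff.add_section hs ht
  zero_mem' := Bundle.contMDiff_zeroSection ℝ A
  smul_mem' f s hs := by
    intro x
    have hx := (Bundle.contMDiffAt_section x).1 (hs x)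
    refine (Bundle.contMDiffAt_section x).2 ?_
    have hsm : ContMDiffAt (𝓡 m) 𝓘(ℝ, F) ∞
        (fun y => f.1 y • (trivializationAt F A x ⟨y, s y⟩).2) x :=
      ((contDiff_fst.smul contDiff_snd : ContDiff ℝ ∞ fun p : 𝕜 × F => p.1 • p.2).contMDiff.contMDiffAt).comp
        x ((f.2 x).prodMk_space hx)
    refine hsm.congr_of_eventuallyEq ?_
    filter_upwards [(trivializationAt F A x).open_baseSet.mem_nhds
      (FiberBundle.mem_baseSet_trivializationAt' x)] with y hy
    exact ((trivializationAt F A x).linear 𝕜 hy).map_smul (f.1 y) (s y)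

/-- The type of smooth functions, `C^∞(M, 𝕜)`. -/
def SmoothFunctions : Type _ := smoothFunctions m M 𝕜

instance : CommRing (SmoothFunctions m M 𝕜) := inferInstanceAs (CommRing (smoothFunctions m M 𝕜))

instance : Algebra 𝕜 (SmoothFunctions m M 𝕜) :=
  inferInstanceAs (Algebra 𝕜 (smoothFunctions m M 𝕜))

/-- The type of smooth sections, `Γ(A)`. -/
def SmoothSections : Type _ := smoothSections m M 𝕜 F A

instance : AddCommGroup (SmoothSections m M 𝕜 F A) :=
  inferInstanceAs (AddCommGroup (smoothSections m M 𝕜 F A))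

instance : Module (SmoothFunctions m M 𝕜) (SmoothSections m M 𝕜 F A) :=
  inferInstanceAs (Module (smoothFunctions m M 𝕜) (smoothSections m M 𝕜 F A))

instance : Module 𝕜 (SmoothSections m M 𝕜 F A) :=
  Module.compHom _ (algebraMap 𝕜 (SmoothFunctions m M 𝕜))

instance : IsScalarTower 𝕜 (SmoothFunctions m M 𝕜) (SmoothSections m M 𝕜 F A) :=
  IsScalarTower.of_algebraMap_smul fun _ _ => rfl

end Geometry

/-! Put `Q = d̄_* ∂̄ + ∂̄ d̄_*`. Both summands of `Ð` square to zero, so `Ð² = Q`. Oddness and the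
first two conditions on a Dirac generating operator hold for every pair of Lie algebroid structures,
because `[Ð, f]` and `[[Ð, e₁], e₂]` are computed by the two Cartan calculi
(`diracPair_differential`, `isDiracGeneratingOperator_iff`). Hence `Ð` is a Dirac generating
operator exactly when `Q` is the multiplication by a function.

On the other side, a multivector is faithfully represented by its exterior multiplication on spinors
(`IsMultiplication`). In this picture `d_* u` is the graded commutator of `d̄_*` with `u`, and the
Schouten bracket is, up to sign, the derived bracket `[[∂̄, u], v]`. The graded Jacobi identity
turns the failure of `d_*` to be a derivation of this bracket into `± [[Q, u], v]`
(`derived_bracket_derivation`, `isLieBialgebroid_iff_forall`). So the Lie bialgebroid condition says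
that `[[Q, u], v] = 0` for all multivectors `u`, `v`, which clearly holds if `Q` is a function.

The converse is the substance, and it is here that the square root of the canonical line matters.
The operators `[Q, f]` and `[[Q, X], ξ]` are spin derivations: each is induced by an operator `T` on
sections of `A*` that covers a derivation of functions, together with the action on `𝒮` that `T`
forces through `𝒮 ⊗ 𝒮 ≅ ⋀ⁿA* ⊗ ⋀ᵐT*M`. No additive scalar remains free, so a spin derivation that
commutes with functions and with exterior multiplications is zero (`IsSpinDerivation.eq_zero`). The
hypothesis provides these commutations, whence `[Q, f] = 0` and `[[Q, X], ξ] = 0`. For reasons of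
degree then `[Q, X] = 0`, so `Q` is determined by its action on `𝒮` in degree zero, which is linear
over functions and therefore a multiplication (`exists_eq_opM`).

All of this is algebra over a commutative ring `R`. Geometry enters through two facts. Sections of a
bundle of rank `n` possess a finite global system `xᵢ`, `φᵢ` with `v = ∑ φᵢ(v) xᵢ` and `∑ φᵢ(xᵢ) =
n` (`FrameOfRank`), which replaces local frames and computes ranks as traces. Alternating forms of
degree `m + 1` on vector fields vanish, so that forms of degree `m` behave as densities. -/

noncomputable section CochainCalculus

variable {𝕜 R N E : Type*} [Field 𝕜] [CommRing R] [Algebra 𝕜 R]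
  [AddCommGroup N] [Module R N] [AddCommGroup E] [Module R E]

/-! ### Forms with values in a module: contraction, exterior product, dual bases -/

namespace Cochain
open AlternatingMap

theorem contract_apply (x : N) (Ω : Cochain R N E) (k : ℕ) (v : Fin k → N) :
    contract x Ω k v = Ω (k + 1) (Matrix.vecCons x v) := rfl

theorem ext_zero {Ω η : Cochain R N E} (h : Ω 0 ![] = η 0 ![]) : Ω 0 = η 0 := by
  ext v
  rw [Subsingleton.elim v ![], h]

/-- The induction principle behind most identities between forms below: contract with an arbitrary
element and descend one degree. -/
theorem ext_succ {Ω η : Cochain R N E} {k : ℕ} (h : ∀ x, contract x Ω k = contract x η k) :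
    Ω (k + 1) = η (k + 1) := by
  ext v
  have := congrArg (fun a => a (Matrix.vecTail v)) (h (Matrix.vecHead v))
  simpa only [contract_apply, Matrix.cons_head_tail] using this

theorem contract_anticomm (x y : N) (Ω : Cochain R N E) :
    contract x (contract y Ω) = -contract y (contract x Ω) := by
  have h := contract_contract (x + y) Ω
  simp only [contract_add, LinearMap.add_apply, map_add, contract_contract, zero_add,
    add_zero] at h
  exact eq_neg_of_add_eq_zero_left (by rw [← h]; abel)

theorem wedge_anticomm (φ ψ : Dual R N) (Ω : Cochain R N E) :
    wedge φ (wedge ψ Ω) = -wedge ψ (wedge φ Ω) := by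
  have h := wedge_wedge (φ + ψ) Ω
  simp only [wedge_add, LinearMap.add_apply, map_add, wedge_wedge, zero_add,
    add_zero] at h
  exact eq_neg_of_add_eq_zero_left (by rw [← h]; abel)

theorem wedge_zero_degree (φ : Dual R N) (Ω : Cochain R N E) : wedge φ Ω 0 = 0 := rfl

theorem wedge_congr (φ : Dual R N) {Ω η : Cochain R N E} {k : ℕ} (h : Ω k = η k) :
    wedge φ Ω (k + 1) = wedge φ η (k + 1) := by
  simp [wedge, h]

section DualBasis

variable {ι : Type*} [Fintype ι] {x : ι → N} {φ : ι → Dual R N}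

theorem contract_sum (g : ι → R) (y : ι → N) (Ω : Cochain R N E) :
    ∑ i, g i • contract (y i) Ω = contract (∑ i, g i • y i) Ω := by
  let c : N →ₗ[R] Cochain R N E :=
    { toFun := fun x => contract x Ω
      map_add' := fun x y => by rw [contract_add]; rfl
      map_smul' := fun f x => by rw [contract_smul]; rfl }
  exact (by simp : ∑ i, g i • c (y i) = c (∑ i, g i • y i))

/-- Euler's formula. -/
theorem sum_wedge_contract (hx : ∀ v, ∑ i, φ i v • x i = v) (Ω : Cochain R N E) (k : ℕ) :
    (∑ i, wedge (φ i) (contract (x i) Ω)) k = k • Ω k := by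
  induction k generalizing Ω with
  | zero => simp [wedge_zero_degree]
  | succ k ih =>
    change _ = ((k + 1) • Ω) (k + 1)
    refine ext_succ fun y => ?_
    have h : contract y (∑ i, wedge (φ i) (contract (x i) Ω)) =
        contract y Ω + ∑ i, wedge (φ i) (contract (x i) (contract y Ω)) := by
      rw [map_sum]
      simp only [contract_wedge, contract_anticomm y, map_neg, sub_neg_eq_add,
        Finset.sum_add_distrib]
      rw [contract_sum, hx]
    rw [h, Pi.add_apply, ih, map_nsmul, Pi.smul_apply, succ_nsmul, add_comm]

/-- Sum the identity `i_x (φ ∧ Ω) = φ(x) Ω - φ ∧ i_x Ω`: the first terms add up to the trace and the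
second ones to Euler's formula. Over a field of characteristic zero the resulting factor `n - k` is
invertible for `k ≠ n`, which is how the rank controls degrees. -/
theorem sum_contract_wedge (hx : ∀ v, ∑ i, φ i v • x i = v) (Ω : Cochain R N E) (k : ℕ) :
    (∑ i, contract (x i) (wedge (φ i) Ω)) k = (∑ i, φ i (x i)) • Ω k - k • Ω k := by
  rw [← sum_wedge_contract hx Ω k]
  simp only [contract_wedge, Finset.sum_sub_distrib, Pi.sub_apply, ← Finset.sum_smul,
    Pi.smul_apply]

/-- The `xᵢ` exhibit `N` as a quotient of a free module. There a form is determined by its values on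
tuples of distinct basis vectors, and too few are available. The bound is the size of the system,
not yet the rank. -/
theorem eq_zero_of_card_lt (hx : ∀ v, ∑ i, φ i v • x i = v) {k : ℕ} (hk : Fintype.card ι < k)
    (Ω : N [⋀^Fin k]→ₗ[R] E) : Ω = 0 := by
  classical
  let g : (ι → R) →ₗ[R] N := ∑ i, (LinearMap.proj i).smulRight (x i)
  have hg : Ω.compLinearMap g = 0 := by
    refine (Pi.basisFun R ι).ext_alternating fun v hv => ?_
    exact absurd (Fintype.card_le_of_injective v hv) (by simpa using hk)
  ext v
  have := congrArg (fun a => a fun j i => φ i (v j)) hg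
  simpa [g, hx] using this

variable (𝕜) in
/-- If the identity of `N` has trace `n`, there are no forms of degree larger than `n`. -/
theorem eq_zero_of_lt [CharZero 𝕜] [Module 𝕜 E] [IsScalarTower 𝕜 R E] (hx : ∀ v, ∑ i, φ i v • x i = v) {n : ℕ}
    (hn : ∑ i, φ i (x i) = n) {k : ℕ} (hk : n < k) (Ω : N [⋀^Fin k]→ₗ[R] E) : Ω = 0 := by
  -- Descending induction on the degree, starting beyond the size of the system. If forms of degree
  -- `k + 1` vanish, then so do all `φᵢ ∧ Ω`, and `sum_contract_wedge` leaves `(n - k) Ω = 0`.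
  obtain ⟨l, hl⟩ : ∃ l, Fintype.card ι < k + l := ⟨Fintype.card ι + 1, by omega⟩
  induction l generalizing k with
  | zero => exact eq_zero_of_card_lt hx hl Ω
  | succ l ih =>
    let η : Cochain R N E := Pi.single k Ω
    have h := sum_contract_wedge hx η k
    have hz : (∑ i, contract (x i) (wedge (φ i) η)) k = 0 := by
      rw [Finset.sum_apply]
      refine Finset.sum_eq_zero fun i _ => ?_
      change curryLeft (wedge (φ i) η (k + 1)) (x i) = 0
      rw [ih (by omega) (wedge (φ i) η (k + 1)) (by omega)]
      rfl
    have hη : η k = Ω := Pi.single_eq_same (M := fun k => N [⋀^Fin k]→ₗ[R] E) k Ω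
    rw [hz, hη, hn] at h
    have h2 : ((n : 𝕜) - k) • Ω = 0 := by
      rw [sub_smul, Nat.cast_smul_eq_nsmul, Nat.cast_smul_eq_nsmul]
      rw [Nat.cast_smul_eq_nsmul] at h
      exact h.symm
    have h3 : ((n : 𝕜) - k) ≠ 0 := sub_ne_zero.2 fun h => hk.ne (Nat.cast_injective h)
    exact (smul_eq_zero.1 h2).resolve_left h3

variable (𝕜) in
/-- Families of forms are determined by their top-degree parts and exterior products. -/
theorem eq_zero_of_wedge [CharZero 𝕜] [Module 𝕜 E] [IsScalarTower 𝕜 R E] (hx : ∀ v, ∑ i, φ i v • x i = v) {n : ℕ}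
    (hn : ∑ i, φ i (x i) = n) {k : ℕ} (hk : k ≠ n) {Ω : Cochain R N E}
    (h : ∀ i, wedge (φ i) Ω (k + 1) = 0) : Ω k = 0 := by
  have h1 := sum_contract_wedge hx Ω k
  have hz : (∑ i, contract (x i) (wedge (φ i) Ω)) k = 0 := by
    rw [Finset.sum_apply]
    refine Finset.sum_eq_zero fun i _ => ?_
    change curryLeft (wedge (φ i) Ω (k + 1)) (x i) = 0
    rw [h]
    rfl
  rw [hz, hn] at h1
  have h2 : ((n : 𝕜) - k) • Ω k = 0 := by
    rw [sub_smul, Nat.cast_smul_eq_nsmul, Nat.cast_smul_eq_nsmul]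
    rw [Nat.cast_smul_eq_nsmul] at h1
    exact h1.symm
  have h3 : ((n : 𝕜) - k) ≠ 0 := sub_ne_zero.2 fun h => hk (Nat.cast_injective h).symm
  exact (smul_eq_zero.1 h2).resolve_left h3

end DualBasis

/-- The expansion of a form of top degree: `φ(y) μ(v) = ∑ i, φ(vᵢ) μ(v₁, …, y, …, v_n)`. -/
theorem sum_update_eq_of_top {n : ℕ} (htop : ∀ Ω : N [⋀^Fin (n + 1)]→ₗ[R] E, Ω = 0)
    (μ : N [⋀^Fin n]→ₗ[R] E) (φ : Dual R N) (y : N) (v : Fin n → N) :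
    ∑ i, φ (v i) • μ (Function.update v i y) = φ y • μ v := by
  -- The form `φ ∧ μ` has degree `n + 1`, hence is zero; its value on `(y, v₁, …, v_n)` is the
  -- expansion sought.
  have h := congrArg (fun a => a (Matrix.vecCons y v))
    (htop (alternatizeUncurryFin (φ.smulRight μ)))
  simp only [alternatizeUncurryFin_apply, AlternatingMap.zero_apply] at h
  rw [Fin.sum_univ_succ] at h
  have h0 : Fin.removeNth 0 (Matrix.vecCons y v) = v := by rw [Fin.removeNth_zero]; rfl
  simp only [Fin.val_zero, pow_zero, one_smul, Matrix.cons_val_zero, LinearMap.smulRight_apply,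
    AlternatingMap.smul_apply, h0, Matrix.cons_val_succ] at h
  rw [add_comm, add_eq_zero_iff_eq_neg'] at h
  rw [h, ← Finset.sum_neg_distrib]
  refine Finset.sum_congr rfl fun i _ => ?_
  obtain ⟨m, rfl⟩ : ∃ m, n = m + 1 := ⟨n - 1, by have := i.2; omega⟩
  rw [LieAlgebroid.Rep.removeNth_succ_vecCons, smul_comm, ← smul_neg]
  congr 1
  have h1 : Function.update v i y = i.insertNth y (i.removeNth v) := by
    rw [Fin.insertNth_removeNth]
  rw [h1, AlternatingMap.map_insertNth, Fin.val_succ, pow_succ, mul_neg_one, neg_smul, neg_neg]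

end Cochain

/-! ### Operators over a derivation and their extension by the product rule -/

namespace DerEnd

variable [Module 𝕜 N] [Module 𝕜 E] {δ δ' : Derivation 𝕜 R R}

theorem ext {T U : DerEnd δ N} (h : ∀ x, T x = U x) : T = U := by
  cases T; cases U
  congr
  exact LinearMap.ext h

/-- The sum of two operators. -/
def add (T : DerEnd δ N) (U : DerEnd δ' N) : DerEnd (δ + δ') N where
  toLinearMap := T.toLinearMap + U.toLinearMap
  leibniz' f x := by
    change T (f • x) + U (f • x) = (δ f + δ' f) • x + f • (T x + U x)
    rw [leibniz, leibniz, add_smul, smul_add]; abel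

/-- A constant multiple of an operator. -/
def smul [IsScalarTower 𝕜 R N] (c : 𝕜) (T : DerEnd δ N) : DerEnd (c • δ) N where
  toLinearMap := c • T.toLinearMap
  leibniz' f x := by
    change c • T (f • x) = (c • δ f) • x + f • c • T x
    rw [leibniz, smul_add, smul_assoc, smul_comm c f]

/-- The commutator of two operators. -/
def comm (T : DerEnd δ N) (U : DerEnd δ' N) : DerEnd ⁅δ, δ'⁆ N where
  toLinearMap := T.toLinearMap * U.toLinearMap - U.toLinearMap * T.toLinearMap
  leibniz' f x := by
    change T (U (f • x)) - U (T (f • x)) = ⁅δ, δ'⁆ f • x + f • (T (U x) - U (T x))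
    simp only [leibniz, map_add, Derivation.commutator_apply, sub_smul, smul_sub]
    abel

/-- An `R`-linear operator. -/
def ofLinear [IsScalarTower 𝕜 R N] (T : N →ₗ[R] N) : DerEnd (0 : Derivation 𝕜 R R) N where
  toLinearMap := T.restrictScalars 𝕜
  leibniz' f x := by simp

@[simp] theorem add_apply (T : DerEnd δ N) (U : DerEnd δ' N) (x : N) : T.add U x = T x + U x := rfl
@[simp] theorem smul_apply [IsScalarTower 𝕜 R N] (c : 𝕜) (T : DerEnd δ N) (x : N) :
    T.smul c x = c • T x := rfl
@[simp] theorem comm_apply (T : DerEnd δ N) (U : DerEnd δ' N) (x : N) :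
    T.comm U x = T (U x) - U (T x) := rfl
@[simp] theorem ofLinear_apply [IsScalarTower 𝕜 R N] (T : N →ₗ[R] N) (x : N) :
    ofLinear (𝕜 := 𝕜) T x = T x := rfl
@[simp] theorem scalar_apply (f : R) : scalar δ f = δ f := rfl
@[simp] theorem lieDer_apply (D : Derivation 𝕜 R R) : lieDer δ D = ⁅δ, D⁆ := rfl

variable [IsScalarTower 𝕜 R E]

@[simp] theorem hom_apply (T : DerEnd δ N) (U : DerEnd δ E) (φ : N →ₗ[R] E) (x : N) :
    T.hom U φ x = U (φ x) - φ (T x) := rfl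

theorem alt_apply (T : DerEnd δ N) (U : DerEnd δ E) (k : ℕ) (Ω : N [⋀^Fin k]→ₗ[R] E)
    (v : Fin k → N) :
    T.alt U k Ω v = U (Ω v) - ∑ i, Ω (Function.update v i (T (v i))) := rfl

/-- The product-rule extension of a pair of operators to forms of all degrees. -/
def altC (T : DerEnd δ N) (U : DerEnd δ E) : Cochain R N E →ₗ[𝕜] Cochain R N E where
  toFun Ω k := T.alt U k (Ω k)
  map_add' Ω η := funext fun k => map_add (T.alt U k).toLinearMap (Ω k) (η k)
  map_smul' c Ω := funext fun k => map_smul (T.alt U k).toLinearMap c (Ω k)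

theorem altC_apply (T : DerEnd δ N) (U : DerEnd δ E) (Ω : Cochain R N E) (k : ℕ) :
    T.altC U Ω k = T.alt U k (Ω k) := rfl

theorem altC_zero (T : DerEnd δ N) (U : DerEnd δ E) (Ω : Cochain R N E) (v : Fin 0 → N) :
    T.altC U Ω 0 v = U (Ω 0 v) := by
  rw [altC_apply, alt_apply]; simp

theorem altC_leibniz (T : DerEnd δ N) (U : DerEnd δ E) (f : R) (Ω : Cochain R N E) :
    T.altC U (f • Ω) = δ f • Ω + f • T.altC U Ω :=
  funext fun k => (T.alt U k).leibniz f (Ω k)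

theorem contract_altC (T : DerEnd δ N) (U : DerEnd δ E) (x : N) (Ω : Cochain R N E) :
    Cochain.contract x (T.altC U Ω) =
      T.altC U (Cochain.contract x Ω) - Cochain.contract (T x) Ω := by
  funext k
  ext v
  change T.alt U (k + 1) (Ω (k + 1)) (Matrix.vecCons x v) =
    T.alt U k (AlternatingMap.curryLeft (Ω (k + 1)) x) v - Ω (k + 1) (Matrix.vecCons (T x) v)
  rw [alt_apply, alt_apply, Fin.sum_univ_succ]
  have h0 : Function.update (Matrix.vecCons x v) 0 (T (Matrix.vecCons x v 0)) =
      Matrix.vecCons (T x) v := by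
    simp [Matrix.vecCons]
  have h1 (i : Fin k) (y : N) : Function.update (Matrix.vecCons x v) i.succ y =
      Matrix.vecCons x (Function.update v i y) := by
    simp [Matrix.vecCons, Fin.cons_update]
  rw [h0]
  simp only [h1, Matrix.cons_val_succ, AlternatingMap.curryLeft_apply_apply]
  abel

/-- Induction on the degree: after contraction with `y` both sides contain the same lower-degree
terms, and the scalar `δ(φ y) - φ(T y)` on the right is the derivative of `φ` evaluated at `y`. -/
theorem altC_wedge (T : DerEnd δ N) (U : DerEnd δ E) (φ : Dual R N) (Ω : Cochain R N E) :
    T.altC U (Cochain.wedge φ Ω) =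
      Cochain.wedge (T.hom (scalar δ) φ) Ω + Cochain.wedge φ (T.altC U Ω) := by
  funext k
  induction k generalizing Ω with
  | zero =>
    refine Cochain.ext_zero ?_
    rw [altC_zero]
    simp [Cochain.wedge_zero_degree]
  | succ k ih =>
    refine Cochain.ext_succ fun y => ?_
    rw [contract_altC, Cochain.contract_wedge, Cochain.contract_wedge, map_sub, altC_leibniz,
      Pi.sub_apply, Pi.sub_apply, ih, map_add, Cochain.contract_wedge, Cochain.contract_wedge,
      contract_altC, hom_apply, scalar_apply]
    simp only [Pi.add_apply, Pi.sub_apply, map_sub, Pi.smul_apply, sub_smul]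
    abel

/-- An operator compatible with contractions in the same way as `T.altC U` is equal to it. -/
theorem eq_altC (T : DerEnd δ N) (U : DerEnd δ E) (Θ : Cochain R N E → Cochain R N E)
    (h0 : ∀ Ω, Θ Ω 0 ![] = U (Ω 0 ![]))
    (h : ∀ x Ω, Cochain.contract x (Θ Ω) =
      Θ (Cochain.contract x Ω) - Cochain.contract (T x) Ω) (Ω : Cochain R N E) :
    Θ Ω = T.altC U Ω := by
  funext k
  induction k generalizing Ω with
  | zero => exact Cochain.ext_zero (by rw [h0, altC_zero])
  | succ k ih =>
    refine Cochain.ext_succ fun y => ?_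
    rw [h, contract_altC, Pi.sub_apply, Pi.sub_apply, ih]

theorem altC_add (T : DerEnd δ N) (U : DerEnd δ E) (T' : DerEnd δ' N) (U' : DerEnd δ' E)
    (Ω : Cochain R N E) : (T.add T').altC (U.add U') Ω = T.altC U Ω + T'.altC U' Ω := by
  refine (eq_altC _ _ (fun Ω => T.altC U Ω + T'.altC U' Ω) (fun Ω => ?_) (fun x Ω => ?_) Ω).symm
  · simp [altC_zero]
  · simp only [map_add, contract_altC, add_apply, Cochain.contract_add, LinearMap.add_apply]
    abel

theorem altC_smul [IsScalarTower 𝕜 R N] (c : 𝕜) (T : DerEnd δ N) (U : DerEnd δ E)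
    (Ω : Cochain R N E) : (T.smul c).altC (U.smul c) Ω = c • T.altC U Ω := by
  refine (eq_altC _ _ (fun Ω => c • T.altC U Ω) (fun Ω => ?_) (fun x Ω => ?_) Ω).symm
  · simp [altC_zero]
  · rw [smul_apply, ← algebraMap_smul R c (T x), Cochain.contract_smul,
      ← algebraMap_smul R c (T.altC U Ω), map_smul, contract_altC, smul_sub, LinearMap.smul_apply,
      algebraMap_smul]

theorem altC_comm (T : DerEnd δ N) (U : DerEnd δ E) (T' : DerEnd δ' N) (U' : DerEnd δ' E)
    (Ω : Cochain R N E) :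
    (T.comm T').altC (U.comm U') Ω = T.altC U (T'.altC U' Ω) - T'.altC U' (T.altC U Ω) := by
  refine (eq_altC _ _ (fun Ω => T.altC U (T'.altC U' Ω) - T'.altC U' (T.altC U Ω))
    (fun Ω => ?_) (fun x Ω => ?_) Ω).symm
  · simp [altC_zero]
  · have hc (y z : N) : Cochain.contract (R := R) (E := E) (y - z) Ω =
        Cochain.contract (R := R) (E := E) y Ω - Cochain.contract (R := R) (E := E) z Ω := by
      rw [eq_sub_iff_add_eq, ← LinearMap.add_apply, ← Cochain.contract_add, sub_add_cancel]
    simp only [map_sub, contract_altC, comm_apply, hc]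
    abel

theorem alt_eq_altC (T : DerEnd δ N) (U : DerEnd δ E) (k : ℕ) (Ω : N [⋀^Fin k]→ₗ[R] E) :
    T.alt U k Ω = T.altC U (Pi.single k Ω) k := by
  rw [altC_apply, Pi.single_eq_same]

theorem altC_single (T : DerEnd δ N) (U : DerEnd δ E) (k : ℕ) (Ω : N [⋀^Fin k]→ₗ[R] E) :
    T.altC U (Pi.single k Ω) = Pi.single k (T.alt U k Ω) := by
  funext j
  by_cases h : j = k
  · subst h; rw [altC_apply, Pi.single_eq_same, Pi.single_eq_same]
  · rw [altC_apply, Pi.single_eq_of_ne h, Pi.single_eq_of_ne h]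
    exact map_zero (T.alt U j).toLinearMap

theorem alt_add (T : DerEnd δ N) (U : DerEnd δ E) (T' : DerEnd δ' N) (U' : DerEnd δ' E) (k : ℕ) :
    (T.add T').alt (U.add U') k = (T.alt U k).add (T'.alt U' k) :=
  ext fun Ω => by
    rw [alt_eq_altC, altC_add, Pi.add_apply, ← alt_eq_altC, ← alt_eq_altC, add_apply]

theorem alt_smul [IsScalarTower 𝕜 R N] (c : 𝕜) (T : DerEnd δ N) (U : DerEnd δ E) (k : ℕ) :
    (T.smul c).alt (U.smul c) k = (T.alt U k).smul c :=
  ext fun Ω => by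
    rw [alt_eq_altC, altC_smul, Pi.smul_apply, ← alt_eq_altC, smul_apply]

theorem alt_comm (T : DerEnd δ N) (U : DerEnd δ E) (T' : DerEnd δ' N) (U' : DerEnd δ' E) (k : ℕ) :
    (T.comm T').alt (U.comm U') k = (T.alt U k).comm (T'.alt U' k) :=
  ext fun Ω => by
    rw [alt_eq_altC, altC_comm, altC_single, altC_single, altC_single, altC_single, Pi.sub_apply,
      Pi.single_eq_same, Pi.single_eq_same, comm_apply]

theorem hom_add (T : DerEnd δ N) (U : DerEnd δ E) (T' : DerEnd δ' N) (U' : DerEnd δ' E) :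
    (T.add T').hom (U.add U') = (T.hom U).add (T'.hom U') :=
  ext fun φ => by ext x; simp; abel

theorem hom_smul [IsScalarTower 𝕜 R N] (c : 𝕜) (T : DerEnd δ N) (U : DerEnd δ E) :
    (T.smul c).hom (U.smul c) = (T.hom U).smul c :=
  ext fun φ => by
    ext x
    rw [smul_apply, LinearMap.smul_apply, hom_apply, hom_apply, smul_apply, smul_apply, smul_sub,
      ← algebraMap_smul R c (T x), map_smul, algebraMap_smul]

theorem hom_comm (T : DerEnd δ N) (U : DerEnd δ E) (T' : DerEnd δ' N) (U' : DerEnd δ' E) :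
    (T.comm T').hom (U.comm U') = (T.hom U).comm (T'.hom U') :=
  ext fun φ => by ext x; simp; abel

theorem scalar_add : scalar (δ + δ') = (scalar δ).add (scalar δ') := ext fun _ => rfl
theorem scalar_smul (c : 𝕜) : scalar (c • δ) = (scalar δ).smul c := ext fun _ => rfl
theorem scalar_comm : scalar ⁅δ, δ'⁆ = (scalar δ).comm (scalar δ') :=
  ext fun f => Derivation.commutator_apply f
theorem lieDer_add : lieDer (δ + δ') = (lieDer δ).add (lieDer δ') :=
  ext fun D => add_lie δ δ' D
theorem lieDer_smul (c : 𝕜) : lieDer (c • δ) = (lieDer δ).smul c :=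
  ext fun D => by ext f; simp [Derivation.commutator_apply, smul_sub]
theorem lieDer_comm : lieDer ⁅δ, δ'⁆ = (lieDer δ).comm (lieDer δ') :=
  ext fun D => lie_lie δ δ' D

end DerEnd
end CochainCalculus

/-! ### Cartan calculus of a Lie algebroid with coefficients -/

noncomputable section CartanCalculus

variable {𝕜 R L E : Type*} [Field 𝕜] [CommRing R] [Algebra 𝕜 R]
  [AddCommGroup L] [Module R L] [Module 𝕜 L] [IsScalarTower 𝕜 R L]
  [AddCommGroup E] [Module R E] [Module 𝕜 E] [IsScalarTower 𝕜 R E]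

namespace LieAlgebroid
namespace Rep
variable {ℒ : LieAlgebroid 𝕜 R L} (ρ : ℒ.Rep E)

/-- The Lie derivative of `E`-valued forms along a section. -/
def lie (X : L) : Cochain R L E →ₗ[𝕜] Cochain R L E := (ℒ.ad X).altC (ρ.act X)

theorem map_vecCons_swap {k : ℕ} (Ω : L [⋀^Fin (k + 2)]→ₗ[R] E) (x y : L) (v : Fin k → L) :
    Ω (Matrix.vecCons x (Matrix.vecCons y v)) = -Ω (Matrix.vecCons y (Matrix.vecCons x v)) := by
  have h (z : L) : Ω (Matrix.vecCons z (Matrix.vecCons z v)) = 0 :=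
    Ω.map_eq_zero_of_eq _ (i := 0) (j := 1) (by simp) (by simp)
  have hl (x y : L) (w : Fin (k + 1) → L) : Ω (Matrix.vecCons (x + y) w) =
      Ω (Matrix.vecCons x w) + Ω (Matrix.vecCons y w) := Ω.map_vecCons_add w x y
  have hr (x y z : L) : Ω (Matrix.vecCons z (Matrix.vecCons (x + y) v)) =
      Ω (Matrix.vecCons z (Matrix.vecCons x v)) + Ω (Matrix.vecCons z (Matrix.vecCons y v)) :=
    (AlternatingMap.curryLeft Ω z).map_vecCons_add v x y
  have := h (x + y)
  rw [hl, hr, hr, h, h] at this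
  exact eq_neg_of_add_eq_zero_left (by rw [← this]; abel)

theorem sum_Ici_succ {k : ℕ} {G : Type*} [AddCommMonoid G] (i : Fin k) (g : Fin (k + 1) → G) :
    ∑ j ≥ i.succ, g j = ∑ j ≥ i, g j.succ := by
  have : Finset.Ici i.succ = (Finset.Ici i).map (Fin.succEmb k) := by
    ext j
    refine Fin.cases ?_ (fun j => ?_) j
    · simp [Fin.ext_iff]
    · simp
  rw [this, Finset.sum_map]
  rfl

/-- Cartan's formula read off from the explicit differential: the terms with `i = 0` of the two sums
make up the Lie derivative along `y`, and in the remaining ones `y` is a mere argument. -/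
theorem differentialFormula_vecCons {k : ℕ} (Ω : L [⋀^Fin (k + 1)]→ₗ[R] E) (y : L)
    (v : Fin (k + 1) → L) :
    ρ.differentialFormula Ω (Matrix.vecCons y v) = (ℒ.ad y).alt (ρ.act y) (k + 1) Ω v -
      ρ.differentialFormula (AlternatingMap.curryLeft Ω y) v := by
  have hu : ∑ i, Ω (Function.update v i (ℒ.ad y (v i))) = ∑ j : Fin (k + 1), (-1 : ℤ) ^ (j : ℕ) •
      Ω (Matrix.vecCons (ℒ.bracket y (v j)) (Fin.removeNth j v)) := by
    refine Finset.sum_congr rfl fun j _ => ?_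
    have h1 (z : L) : Function.update v j z = j.insertNth z (j.removeNth v) := by
      rw [Fin.insertNth_removeNth]
    rw [h1, AlternatingMap.map_insertNth]
    rfl
  rw [DerEnd.alt_apply, hu]
  simp only [differentialFormula]
  refine (congrArg₂ (· - ·) (Fin.sum_univ_succ _) (Fin.sum_univ_succ _)).trans ?_
  have hIci (g : Fin (k + 1) → E) : ∑ j ≥ (0 : Fin (k + 1)), g j = ∑ j, g j :=
    Finset.sum_congr (by ext; simp) fun _ _ => rfl
  have h1 : Fin.removeNth (0 : Fin (k + 2)) (Matrix.vecCons y v) = v := by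
    rw [Fin.removeNth_zero]; rfl
  have ha (i : Fin (k + 1)) (e : E) : ρ.act ((Matrix.vecCons y v : Fin (k + 2) → L) i.succ) e
      = ρ.act (v i) e := rfl
  rw [hIci]
  simp only [ha, h1, removeNth_succ_vecCons, Matrix.cons_val_succ, Matrix.cons_val_zero,
    Fin.val_zero, pow_zero, one_smul, zero_add, Fin.val_succ, pow_succ,
    mul_neg, mul_one, neg_smul, Finset.sum_neg_distrib, Fin.castSucc_zero]
  cases k with
  | zero =>
    simp
    abel
  | succ k =>
    -- For `i ≥ 1` the bracket stands in front of `y`. Exchanging the two gives a sign, and the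
    -- shift of both indices changes the exponent by two.
    have hT : (∑ i : Fin (k + 1), ∑ j ≥ i.succ, (-1 : ℤ) ^ ((i : ℕ) + 1 + (j : ℕ)) •
        Ω (Matrix.vecCons (ℒ.bracket ((Matrix.vecCons y v : Fin (k + 3) → L) i.succ.castSucc)
          (v j)) (Fin.removeNth j (Fin.removeNth i.succ.castSucc (Matrix.vecCons y v))))) =
        -∑ i : Fin (k + 1), ∑ j ≥ i, (-1 : ℤ) ^ (i + j : ℕ) •
          AlternatingMap.curryLeft Ω y (Matrix.vecCons (ℒ.bracket (v i.castSucc) (v j.succ))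
            (Fin.removeNth j (Fin.removeNth i.castSucc v))) := by
      rw [← Finset.sum_neg_distrib]
      refine Finset.sum_congr rfl fun i _ => ?_
      rw [sum_Ici_succ, ← Finset.sum_neg_distrib]
      refine Finset.sum_congr rfl fun j _ => ?_
      rw [← Fin.succ_castSucc]
      simp only [Matrix.cons_val_succ, removeNth_succ_vecCons]
      rw [AlternatingMap.curryLeft_apply_apply, map_vecCons_swap, ← smul_neg]
      congr 1
      rw [Fin.val_succ]
      ring
    rw [hT]
    simp only [AlternatingMap.curryLeft_apply_apply]
    change _ = ρ.act y (Ω v) - _ - _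
    abel

variable [CharZero 𝕜]

theorem differential_zero (Ω : Cochain R L E) : ρ.differential Ω 0 = 0 := rfl

theorem differential_succ (Ω : Cochain R L E) (k : ℕ) (v : Fin (k + 1) → L) :
    ρ.differential Ω (k + 1) v = ρ.differentialFormula (Ω k) v := rfl

theorem differential_congr {Ω η : Cochain R L E} {k : ℕ} (h : Ω k = η k) :
    ρ.differential Ω (k + 1) = ρ.differential η (k + 1) := by
  ext v
  rw [differential_succ, differential_succ, h]

/-- Cartan's formula. -/
theorem contract_differential (X : L) (Ω : Cochain R L E) :
    Cochain.contract X (ρ.differential Ω) =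
      ρ.lie X Ω - ρ.differential (Cochain.contract X Ω) := by
  funext k
  ext v
  cases k with
  | zero =>
    rw [Cochain.contract_apply, differential_succ, Pi.sub_apply, differential_zero, sub_zero]
    rw [lie, DerEnd.altC_zero]
    simp only [differentialFormula, Matrix.cons_val_zero]
    congr 2
  | succ k =>
    exact ρ.differentialFormula_vecCons (Ω (k + 1)) X v

theorem contract_lie (X Y : L) (Ω : Cochain R L E) :
    Cochain.contract Y (ρ.lie X Ω) =
      ρ.lie X (Cochain.contract Y Ω) - Cochain.contract (ℒ.bracket X Y) Ω :=
  DerEnd.contract_altC _ _ _ _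

theorem lie_bracket (X Y : L) (Ω : Cochain R L E) :
    ρ.lie (ℒ.bracket X Y) Ω = ρ.lie X (ρ.lie Y Ω) - ρ.lie Y (ρ.lie X Ω) := by
  refine (DerEnd.eq_altC _ _ (fun Ω => ρ.lie X (ρ.lie Y Ω) - ρ.lie Y (ρ.lie X Ω))
    (fun Ω => ?_) (fun x Ω => ?_) Ω).symm
  · simp [lie, DerEnd.altC_zero, ρ.act_bracket]
  · simp only [map_sub, contract_lie]
    have hc (y z : L) : Cochain.contract (R := R) (E := E) (y - z) Ω =
        Cochain.contract (R := R) (E := E) y Ω - Cochain.contract (R := R) (E := E) z Ω := by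
      rw [eq_sub_iff_add_eq, ← LinearMap.add_apply, ← Cochain.contract_add, sub_add_cancel]
    have hj : ℒ.ad (ℒ.bracket X Y) x =
        ℒ.bracket X (ℒ.bracket Y x) - ℒ.bracket Y (ℒ.bracket X x) := by
      rw [ℒ.jacobi X Y x, add_sub_cancel_right]; rfl
    rw [hj, hc]
    abel

/-- By induction on the degree: contracting with `y` reduces the claim to lower degree, and the
remaining terms cancel by `lie_bracket`. -/
theorem lie_differential (X : L) (Ω : Cochain R L E) :
    ρ.lie X (ρ.differential Ω) = ρ.differential (ρ.lie X Ω) := by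
  funext k
  induction k generalizing Ω with
  | zero =>
    refine Cochain.ext_zero ?_
    rw [lie, DerEnd.altC_zero]
    simp [differential_zero]
  | succ k ih =>
    refine Cochain.ext_succ fun y => ?_
    rw [contract_lie, contract_differential, contract_differential, contract_differential,
      contract_lie, map_sub, map_sub, lie_bracket]
    simp only [Pi.sub_apply, ih]
    abel

/-- Cartan's formula used twice gives `i_y d d Ω = L_y d Ω - d L_y Ω + d d i_y Ω`. The first two
terms cancel and the last one has lower degree. -/
theorem differential_differential (Ω : Cochain R L E) :
    ρ.differential (ρ.differential Ω) = 0 := by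
  funext k
  induction k generalizing Ω with
  | zero => rfl
  | succ k ih =>
    refine Cochain.ext_succ fun y => ?_
    rw [contract_differential, contract_differential, map_sub, lie_differential, sub_sub_cancel,
      ih, map_zero]

/-- The Leibniz rule of the differential with respect to functions. -/
theorem differential_smul (f : R) (Ω : Cochain R L E) :
    ρ.differential (f • Ω) = Cochain.wedge (ℒ.dFun f) Ω + f • ρ.differential Ω := by
  funext k
  induction k generalizing Ω with
  | zero => simp [differential_zero, Cochain.wedge_zero_degree]
  | succ k ih =>
    refine Cochain.ext_succ fun y => ?_
    rw [contract_differential, map_add, Cochain.contract_wedge, map_smul (Cochain.contract y),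
      map_smul (Cochain.contract y), contract_differential, lie, DerEnd.altC_leibniz,
      Pi.sub_apply, ih]
    simp only [Pi.add_apply, Pi.sub_apply, Pi.smul_apply, smul_sub]
    change _ = (ℒ.anchor y f) • Ω k - _ + _
    abel

end Rep
end LieAlgebroid
end CartanCalculus

/-! ### Finite projective modules with a prescribed trace -/

noncomputable section Frames

/-- A finite system `xᵢ` of elements of `N` with functionals `φᵢ` such that `v = ∑ i, φᵢ(v) xᵢ`
for all `v` and `∑ i, φᵢ(xᵢ) = n`: it exhibits `N` as a finitely generated projective module of
rank `n`, if the base ring is a `ℚ`-algebra. -/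
structure FrameOfRank (R N : Type*) [CommRing R] [AddCommGroup N] [Module R N] (n : ℕ) where
  ι : Type
  fintype : Fintype ι
  vec : ι → N
  coord : ι → Dual R N
  sum_smul : ∀ v, ∑ i, coord i v • vec i = v
  trace : ∑ i, coord i (vec i) = n

attribute [instance] FrameOfRank.fintype

namespace FrameOfRank

variable {R N : Type*} [CommRing R] [AddCommGroup N] [Module R N] {n : ℕ}

theorem sum_apply_smul_coord (F : FrameOfRank R N n) (ξ : Dual R N) :
    ∑ i, ξ (F.vec i) • F.coord i = ξ := by
  ext v
  conv_rhs => rw [← F.sum_smul v]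
  simp [mul_comm]

/-- The dual frame. -/
def dual (F : FrameOfRank R N n) : FrameOfRank R (Dual R N) n where
  ι := F.ι
  fintype := F.fintype
  vec := F.coord
  coord i := Dual.eval R N (F.vec i)
  sum_smul := F.sum_apply_smul_coord
  trace := F.trace

/-- The element of `N` that represents a functional on the dual. -/
def ofBidual (F : FrameOfRank R N n) (Φ : Dual R (Dual R N)) : N :=
  ∑ i, Φ (F.coord i) • F.vec i

theorem apply_ofBidual (F : FrameOfRank R N n) (Φ : Dual R (Dual R N)) (ξ : Dual R N) :
    ξ (F.ofBidual Φ) = Φ ξ := by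
  conv_rhs => rw [← F.sum_apply_smul_coord ξ]
  simp [ofBidual, mul_comm]

theorem eval_ofBidual (F : FrameOfRank R N n) (Φ : Dual R (Dual R N)) :
    Dual.eval R N (F.ofBidual Φ) = Φ :=
  LinearMap.ext fun ξ => F.apply_ofBidual Φ ξ

theorem eq_zero_of_forall (F : FrameOfRank R N n) {v : N} (h : ∀ ξ : Dual R N, ξ v = 0) :
    v = 0 := by
  rw [← F.sum_smul v]
  simp [h]

/-- The tensor product of frames of rank one. -/
def tensor (F : FrameOfRank R N 1) : FrameOfRank R (N ⊗[R] N) 1 where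
  ι := F.ι × F.ι
  fintype := inferInstance
  vec p := F.vec p.1 ⊗ₜ F.vec p.2
  coord p := TensorProduct.dualDistrib R N N (F.coord p.1 ⊗ₜ F.coord p.2)
  sum_smul v := by
    induction v with
    | zero => simp
    | add v w hv hw => simp only [map_add, add_smul, Finset.sum_add_distrib, hv, hw]
    | tmul v w =>
      conv_rhs => rw [← F.sum_smul v, ← F.sum_smul w]
      rw [Fintype.sum_prod_type]
      simp only [TensorProduct.dualDistrib_apply, TensorProduct.sum_tmul, TensorProduct.tmul_sum,
        TensorProduct.smul_tmul_smul]
      exact Finset.sum_comm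
  trace := by
    rw [Fintype.sum_prod_type]
    simp only [TensorProduct.dualDistrib_apply, ← Finset.mul_sum, F.trace]
    simp [F.trace]

theorem alternatingMap_eq_zero (𝕜 : Type*) [Field 𝕜] [CharZero 𝕜] [Algebra 𝕜 R] {E : Type*}
    [AddCommGroup E] [Module R E] [Module 𝕜 E] [IsScalarTower 𝕜 R E] (F : FrameOfRank R N n)
    {k : ℕ} (hk : n < k) (Ω : N [⋀^Fin k]→ₗ[R] E) : Ω = 0 :=
  Cochain.eq_zero_of_lt 𝕜 F.sum_smul F.trace hk Ω

/-- The `N`-valued two-form `φ ∧ id` vanishes for reasons of rank; this is the expansion of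
top-degree forms for the identity regarded as a one-form. -/
theorem smul_comm_of_rank_one (𝕜 : Type*) [Field 𝕜] [CharZero 𝕜] [Algebra 𝕜 R] [Module 𝕜 N]
    [IsScalarTower 𝕜 R N] (F : FrameOfRank R N 1) (φ : Dual R N) (v w : N) :
    φ v • w = φ w • v := by
  have h := Cochain.sum_update_eq_of_top (n := 1)
    (fun Ω => F.alternatingMap_eq_zero 𝕜 (E := N) one_lt_two Ω)
    (AlternatingMap.ofSubsingleton R N N (0 : Fin 1) LinearMap.id) φ w ![v]
  simpa using h

/-- Endomorphisms of a module of rank one are multiplications. -/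
theorem exists_eq_smul (𝕜 : Type*) [Field 𝕜] [CharZero 𝕜] [Algebra 𝕜 R] [Module 𝕜 N]
    [IsScalarTower 𝕜 R N] (F : FrameOfRank R N 1) (T : N →ₗ[R] N) : ∃ h : R, ∀ v, T v = h • v := by
  -- In rank one the factor is the trace of `T`.
  refine ⟨∑ i, F.coord i (T (F.vec i)), fun v => ?_⟩
  conv_lhs => rw [← F.sum_smul v]
  rw [map_sum, Finset.sum_smul]
  refine Finset.sum_congr rfl fun i _ => ?_
  rw [map_smul]
  exact (F.smul_comm_of_rank_one 𝕜 (F.coord i) _ _).symm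

end FrameOfRank
end Frames

/-! ### Square roots of operators on a line -/

noncomputable section SquareRoots

variable {𝕜 R L S : Type*} [Field 𝕜] [CharZero 𝕜] [CommRing R] [Algebra 𝕜 R]
  [AddCommGroup L] [Module R L] [Module 𝕜 L] [IsScalarTower 𝕜 R L]
  [AddCommGroup S] [Module R S] [Module 𝕜 S] [IsScalarTower 𝕜 R S]
  {K : Type*} [AddCommGroup K] [Module R K] [Module 𝕜 K]
  {δ δ' : Derivation 𝕜 R R}

namespace FrameOfRank

/-- An operator whose extension to `S ⊗ S` by the product rule vanishes is zero. -/
theorem eq_zero_of_tmul (F : FrameOfRank R S 1) (A : S →ₗ[𝕜] S)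
    (hA : ∀ s t : S, A s ⊗ₜ[R] t + s ⊗ₜ[R] A t = 0) (s : S) : A s = 0 := by
  have hswap (s t : S) : s ⊗ₜ[R] t = t ⊗ₜ[R] s := by
    conv_lhs => rw [← F.sum_smul t]
    conv_rhs => rw [← F.sum_smul s]
    simp only [TensorProduct.tmul_sum, TensorProduct.tmul_smul, TensorProduct.smul_tmul',
      F.smul_comm_of_rank_one 𝕜 _ s t]
  -- As tensors over a rank-one module are symmetric, the hypothesis reads `A s ⊗ t + A t ⊗ s = 0`;
  -- apply the `i`-th coordinate to the second factor.
  have h1 (i : F.ι) (s t : S) : F.coord i t • A s = -(F.coord i s • A t) := by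
    have h := hA s t
    rw [hswap s (A t)] at h
    have h2 := congrArg (TensorProduct.lift ((LinearMap.lsmul R S ∘ₗ F.coord i).flip)) h
    simp only [map_add, TensorProduct.lift.tmul, LinearMap.flip_apply, LinearMap.comp_apply,
      LinearMap.lsmul_apply, map_zero] at h2
    exact eq_neg_of_add_eq_zero_left h2
  have h2 (s : S) : A s = -∑ i, F.coord i s • A (F.vec i) := by
    rw [← Finset.sum_neg_distrib]
    simp only [← h1]
    rw [← Finset.sum_smul, F.trace, Nat.cast_one, one_smul]
  -- `A` is only `𝕜`-linear by assumption, but `h2` shows that it is `R`-linear. Linearity then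
  -- gives the formula of `h2` with the opposite sign, so `A s = -A s`.
  have h3 (s : S) : A s = ∑ i, F.coord i s • A (F.vec i) := by
    conv_lhs => rw [← F.sum_smul s, map_sum]
    refine Finset.sum_congr rfl fun i _ => ?_
    rw [h2, h2 (F.vec i), smul_neg, Finset.smul_sum]
    simp only [map_smul, smul_smul, smul_eq_mul]
  have h4 : A s = -A s := by
    conv_lhs => rw [h2]
    rw [← h3]
  have h5 : (2 : 𝕜) • A s = 0 := by
    rw [two_smul]
    nth_rewrite 1 [h4]
    exact neg_add_cancel _
  exact (smul_eq_zero.1 h5).resolve_left two_ne_zero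

theorem square_root_unique (F : FrameOfRank R S 1) {sq : S ⊗[R] S ≃ₗ[R] K} {A B : S →ₗ[𝕜] S}
    (h : ∀ s t, sq (A s ⊗ₜ t) + sq (s ⊗ₜ A t) = sq (B s ⊗ₜ t) + sq (s ⊗ₜ B t)) (s : S) :
    A s = B s := by
  rw [← sub_eq_zero]
  refine F.eq_zero_of_tmul (A - B) (fun s t => ?_) s
  rw [← sq.map_eq_zero_iff]
  simp only [LinearMap.sub_apply, TensorProduct.sub_tmul, TensorProduct.tmul_sub, map_add,
    map_sub]
  rw [← sub_eq_zero.2 (h s t)]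
  abel

/-- Differentiating the coordinates gives some operator `D₀` over `δ`. Then `sq⁻¹ T sq - D₀ ⊗ 1 - 1
⊗ D₀` is linear over functions on `S ⊗ S`, which has rank one, so it is the multiplication by a
function `h`. Adding `h / 2` to `D₀` corrects the defect. -/
theorem exists_square_root (F : FrameOfRank R S 1) (sq : S ⊗[R] S ≃ₗ[R] K) (T : DerEnd δ K) :
    ∃ D : DerEnd δ S, IsSquareRoot sq T D := by
  let D₀ : DerEnd δ S :=
    { toFun := fun s => ∑ i, δ (F.coord i s) • F.vec i
      map_add' := fun s t => by simp [add_smul, Finset.sum_add_distrib]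
      map_smul' := fun c s => by
        have h (i : F.ι) : F.coord i (c • s) = c • F.coord i s := by
          rw [← algebraMap_smul R c s, map_smul, algebraMap_smul]
        simp [h, Finset.smul_sum]
      leibniz' := fun f s => by
        have : δ f • s = ∑ i, (δ f * F.coord i s) • F.vec i := by
          conv_lhs => rw [← F.sum_smul s]
          simp [Finset.smul_sum, mul_smul]
        rw [this, Finset.smul_sum, ← Finset.sum_add_distrib]
        refine Finset.sum_congr rfl fun i _ => ?_
        rw [map_smul, smul_eq_mul, Derivation.leibniz, add_smul, smul_eq_mul, smul_eq_mul,
          mul_smul, mul_comm (δ f), add_comm] }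
  let G : S →ₗ[R] S →ₗ[R] S ⊗[R] S := LinearMap.mk₂ R
    (fun s t => sq.symm (T (sq (s ⊗ₜ t))) - D₀ s ⊗ₜ t - s ⊗ₜ D₀ t)
    (fun s s' t => by simp only [TensorProduct.add_tmul, map_add]; abel)
    (fun f s t => by
      rw [DerEnd.leibniz, ← TensorProduct.smul_tmul', map_smul, DerEnd.leibniz, map_add, map_smul,
        map_smul, LinearEquiv.symm_apply_apply, TensorProduct.add_tmul,
        ← TensorProduct.smul_tmul', ← TensorProduct.smul_tmul', ← TensorProduct.smul_tmul']
      simp only [smul_sub]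
      abel)
    (fun s t t' => by simp only [TensorProduct.tmul_add, map_add]; abel)
    (fun f s t => by
      rw [DerEnd.leibniz, TensorProduct.tmul_smul, map_smul, DerEnd.leibniz, map_add, map_smul,
        map_smul, LinearEquiv.symm_apply_apply, TensorProduct.tmul_add,
        TensorProduct.tmul_smul, TensorProduct.tmul_smul, TensorProduct.tmul_smul]
      simp only [smul_sub]
      abel)
  obtain ⟨h, hh⟩ := F.tensor.exists_eq_smul 𝕜 (TensorProduct.lift G)
  refine ⟨⟨D₀.toLinearMap + ((algebraMap 𝕜 R 2⁻¹ * h) • (LinearMap.id : S →ₗ[R] S)).restrictScalars 𝕜,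
    fun f s => ?_⟩, fun s t => ?_⟩
  · change D₀ (f • s) + (algebraMap 𝕜 R 2⁻¹ * h) • f • s =
      δ f • s + f • (D₀ s + (algebraMap 𝕜 R 2⁻¹ * h) • s)
    rw [DerEnd.leibniz, smul_add, smul_comm f]
    abel
  · change sq ((D₀ s + (algebraMap 𝕜 R 2⁻¹ * h) • s) ⊗ₜ t) +
      sq (s ⊗ₜ (D₀ t + (algebraMap 𝕜 R 2⁻¹ * h) • t)) = T (sq (s ⊗ₜ t))
    have h1 := congrArg sq (hh (s ⊗ₜ t))
    rw [TensorProduct.lift.tmul] at h1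
    change sq (sq.symm (T (sq (s ⊗ₜ t))) - D₀ s ⊗ₜ t - s ⊗ₜ D₀ t) = _ at h1
    rw [map_sub, map_sub, LinearEquiv.apply_symm_apply, map_smul] at h1
    have h2 : algebraMap 𝕜 R 2⁻¹ * h + algebraMap 𝕜 R 2⁻¹ * h = h := by
      rw [← add_mul, ← map_add, ← two_mul, mul_inv_cancel₀ two_ne_zero, map_one, one_mul]
    rw [TensorProduct.add_tmul, TensorProduct.tmul_add, ← TensorProduct.smul_tmul',
      TensorProduct.tmul_smul, map_add, map_add, map_smul]
    have h3 : h • sq (s ⊗ₜ[R] t) = (algebraMap 𝕜 R 2⁻¹ * h) • sq (s ⊗ₜ[R] t) +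
        (algebraMap 𝕜 R 2⁻¹ * h) • sq (s ⊗ₜ[R] t) := by rw [← add_smul, h2]
    rw [sub_sub, sub_eq_iff_eq_add, h3] at h1
    rw [h1]
    abel

end FrameOfRank

namespace DerEnd

variable {n m : ℕ}

theorem detLine_add (T : DerEnd δ (Dual R L)) (T' : DerEnd δ' (Dual R L)) :
    (T.add T').detLine n m = (T.detLine n m).add (T'.detLine n m) := by
  rw [detLine, scalar_add, lieDer_add, alt_add, alt_add, hom_add]; rfl

theorem detLine_smul (c : 𝕜) (T : DerEnd δ (Dual R L)) :
    (T.smul c).detLine n m = (T.detLine n m).smul c := by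
  rw [detLine, scalar_smul, lieDer_smul, alt_smul, alt_smul, hom_smul]; rfl

theorem detLine_comm (T : DerEnd δ (Dual R L)) (T' : DerEnd δ' (Dual R L)) :
    (T.comm T').detLine n m = (T.detLine n m).comm (T'.detLine n m) := by
  rw [detLine, scalar_comm, lieDer_comm, alt_comm, alt_comm, hom_comm]; rfl

theorem detLine_apply (T : DerEnd δ (Dual R L)) (κ : DetLine 𝕜 R L n m)
    (Ω : Dual R L [⋀^Fin n]→ₗ[R] R) :
    T.detLine n m κ Ω = (lieDer δ).alt (scalar δ) m (κ Ω) - κ (T.alt (scalar δ) n Ω) := rfl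

/-- The effect on top-degree forms of rescaling an operator up to a term of rank one. -/
theorem alt_of_eq_smul_add {N E : Type*} [AddCommGroup N] [Module R N] [Module 𝕜 N]
    [AddCommGroup E] [Module R E] [Module 𝕜 E] [IsScalarTower 𝕜 R E]
    (htop : ∀ Ω : N [⋀^Fin (n + 1)]→ₗ[R] E, Ω = 0) {T : DerEnd δ N} {U : DerEnd δ E}
    {T' : DerEnd δ' N} {U' : DerEnd δ' E} {f c : R} {g : Dual R N} {w : N}
    (hT : ∀ v, T' v = f • T v + g v • w) (hU : ∀ e, U' e = f • U e + c • e)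
    (Ω : N [⋀^Fin n]→ₗ[R] E) :
    T'.alt U' n Ω = f • T.alt U n Ω + (c - g w) • Ω := by
  ext v
  rw [alt_apply, AlternatingMap.add_apply, AlternatingMap.smul_apply, AlternatingMap.smul_apply,
    alt_apply, sub_smul, ← Cochain.sum_update_eq_of_top htop Ω g w v, hU]
  simp only [hT, AlternatingMap.map_update_add, AlternatingMap.map_update_smul,
    Finset.sum_add_distrib, smul_sub, Finset.smul_sum]
  abel

/-- The two contributions to the scalar are divergences: `δ f` comes from `L_{fδ} μ = f L_δ μ + δ(f)
μ` on forms of top degree on the base, and `g w` is the trace of the rank-one term acting on `⋀ⁿ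
A*`. -/
theorem detLine_of_eq_smul_add (F : FrameOfRank R L n)
    (hm : ∀ Ω : Derivation 𝕜 R R [⋀^Fin (m + 1)]→ₗ[R] R, Ω = 0)
    {T : DerEnd δ (Dual R L)} {T' : DerEnd δ' (Dual R L)} {f : R} {g : Dual R (Dual R L)}
    {w : Dual R L} (hδ : δ' = f • δ) (hT : ∀ v, T' v = f • T v + g v • w)
    (κ : DetLine 𝕜 R L n m) :
    T'.detLine n m κ = f • T.detLine n m κ + (δ f + g w) • κ := by
  subst hδ
  refine LinearMap.ext fun Ω => ?_
  -- Since `[f δ, D] = f [δ, D] - D(f) δ`, the Lie derivative of vector fields is also rescaled up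
  -- to a term of rank one, with functional `D ↦ -D f` and vector `δ`.
  let g' : Dual R (Derivation 𝕜 R R) :=
    { toFun := fun D => -D f
      map_add' := fun D D' => by simp; abel
      map_smul' := fun r D => by simp }
  have h1 : T'.alt (scalar (f • δ)) n Ω = f • T.alt (scalar δ) n Ω + (0 - g w) • Ω :=
    alt_of_eq_smul_add (fun Ω => F.dual.alternatingMap_eq_zero 𝕜 (Nat.lt_succ_self n) Ω) hT
      (fun e => by simp) Ω
  have h2 (μ : BaseForm 𝕜 R m) : (lieDer (f • δ)).alt (scalar (f • δ)) m μ =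
      f • (lieDer δ).alt (scalar δ) m μ + (0 - g' δ) • μ := by
    refine alt_of_eq_smul_add hm (fun D => ?_) (fun e => by simp) μ
    ext r
    simp only [lieDer_apply, Derivation.commutator_apply, Derivation.smul_apply,
      Derivation.add_apply, Derivation.leibniz, smul_eq_mul, g', LinearMap.coe_mk, AddHom.coe_mk]
    ring
  rw [detLine_apply, h1, h2, LinearMap.add_apply, LinearMap.smul_apply, LinearMap.smul_apply,
    detLine_apply, map_add, map_smul, map_smul]
  have h3 : g' δ = -δ f := rfl
  rw [h3]
  module

end DerEnd
end SquareRoots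

/-! ### The module structures on `𝒮` and on `⋀ⁿ A ⊗ 𝒮` -/

noncomputable section Actions

variable {𝕜 R L S : Type*} [Field 𝕜] [CharZero 𝕜] [CommRing R] [Algebra 𝕜 R]
  [AddCommGroup L] [Module R L] [Module 𝕜 L] [IsScalarTower 𝕜 R L]
  [AddCommGroup S] [Module R S] [Module 𝕜 S] [IsScalarTower 𝕜 R S]
  {K : Type*} [AddCommGroup K] [Module R K] [Module 𝕜 K]
  {δ δ' : Derivation 𝕜 R R} {n m : ℕ}

namespace IsSquareRoot

variable {sq : S ⊗[R] S ≃ₗ[R] K}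

theorem apply {T : DerEnd δ K} {D : DerEnd δ S} (h : IsSquareRoot sq T D) (s t : S) :
    sq (D s ⊗ₜ t) + sq (s ⊗ₜ D t) = T (sq (s ⊗ₜ t)) := h s t

theorem add {T : DerEnd δ K} {D : DerEnd δ S} {T' : DerEnd δ' K} {D' : DerEnd δ' S}
    (h : IsSquareRoot sq T D) (h' : IsSquareRoot sq T' D') :
    IsSquareRoot sq (T.add T') (D.add D') := fun s t => by
  simp only [DerEnd.add_apply, TensorProduct.add_tmul, TensorProduct.tmul_add, map_add,
    ← h s t, ← h' s t]
  abel

theorem comm {T : DerEnd δ K} {D : DerEnd δ S} {T' : DerEnd δ' K} {D' : DerEnd δ' S}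
    (h : IsSquareRoot sq T D) (h' : IsSquareRoot sq T' D') :
    IsSquareRoot sq (T.comm T') (D.comm D') := fun s t => by
  simp only [DerEnd.comm_apply, TensorProduct.sub_tmul, TensorProduct.tmul_sub, map_sub,
    ← IsSquareRoot.apply h, ← IsSquareRoot.apply h', map_add]
  abel

theorem smul [IsScalarTower 𝕜 R K] {T : DerEnd δ K} {D : DerEnd δ S}
    (h : IsSquareRoot sq T D) (c : 𝕜) : IsSquareRoot sq (T.smul c) (D.smul c) := fun s t => by
  rw [DerEnd.smul_apply, DerEnd.smul_apply, DerEnd.smul_apply, ← h s t,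
    ← algebraMap_smul R c (D s), ← algebraMap_smul R c (D t), ← TensorProduct.smul_tmul',
    TensorProduct.tmul_smul, map_smul, map_smul, ← smul_add, algebraMap_smul]

theorem unique (F : FrameOfRank R S 1) {T : DerEnd δ K} {D : DerEnd δ S} {T' : DerEnd δ' K}
    {D' : DerEnd δ' S} (h : IsSquareRoot sq T D) (h' : IsSquareRoot sq T' D')
    (hT : ∀ κ, T κ = T' κ) (s : S) : D s = D' s :=
  F.square_root_unique (sq := sq) (A := D.toLinearMap) (B := D'.toLinearMap)
    (fun s t => by rw [h s t, h' s t, hT]) s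

end IsSquareRoot

theorem DerEnd.detLine_congr {T : DerEnd δ (Dual R L)} {T' : DerEnd δ' (Dual R L)} (hδ : δ = δ')
    (hT : ∀ x, T x = T' x) (κ : DetLine 𝕜 R L n m) : T.detLine n m κ = T'.detLine n m κ := by
  subst hδ
  rw [DerEnd.ext hT]

theorem DerEnd.altC_congr {N E : Type*} [AddCommGroup N] [Module R N] [Module 𝕜 N]
    [AddCommGroup E] [Module R E] [Module 𝕜 E] [IsScalarTower 𝕜 R E]
    {T : DerEnd δ N} {U : DerEnd δ E} {T' : DerEnd δ' N} {U' : DerEnd δ' E}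
    (hT : ∀ x, T x = T' x) (hU : ∀ e, U e = U' e) (Ω : Cochain R N E) :
    T.altC U Ω = T'.altC U' Ω :=
  DerEnd.eq_altC T' U' (T.altC U) (fun Ω => by rw [altC_zero, hU])
    (fun x Ω => by rw [contract_altC, hT]) Ω

theorem DerEnd.alt_congr {N E : Type*} [AddCommGroup N] [Module R N] [Module 𝕜 N]
    [AddCommGroup E] [Module R E] [Module 𝕜 E] [IsScalarTower 𝕜 R E]
    {T : DerEnd δ N} {U : DerEnd δ E} {T' : DerEnd δ' N} {U' : DerEnd δ' E}
    (hT : ∀ x, T x = T' x) (hU : ∀ e, U e = U' e) (Ω : N [⋀^Fin n]→ₗ[R] E) :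
    T.alt U n Ω = T'.alt U' n Ω := by
  rw [alt_eq_altC, alt_eq_altC, altC_congr hT hU]

namespace LieAlgebroid

theorem Rep.ext {ℒ : LieAlgebroid 𝕜 R L} {ρ σ : ℒ.Rep S} (h : ∀ X e, ρ.act X e = σ.act X e) :
    ρ = σ := by
  have : ρ.act = σ.act := funext fun X => DerEnd.ext (h X)
  cases ρ; cases σ
  congr

variable (ℒ : LieAlgebroid 𝕜 R L) (ℒ' : LieAlgebroid 𝕜 R (Dual R L))

theorem smul_bracket (f : R) (X Y : L) :
    ℒ.bracket (f • X) Y = f • ℒ.bracket X Y - ℒ.anchor Y f • X := by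
  rw [ℒ.bracket_swap Y (f • X), ℒ.leibniz, ℒ.bracket_swap X Y, smul_neg]
  abel

theorem bracket_bracket (X Y Z : L) : ℒ.bracket (ℒ.bracket X Y) Z =
    ℒ.bracket X (ℒ.bracket Y Z) - ℒ.bracket Y (ℒ.bracket X Z) := by
  rw [ℒ.jacobi X Y Z, add_sub_cancel_right]

theorem coad_apply (X : L) (ξ : Dual R L) (Y : L) :
    ℒ.coad X ξ Y = ℒ.anchor X (ξ Y) - ξ (ℒ.bracket X Y) := rfl

theorem ad_apply (X Y : L) : ℒ.ad X Y = ℒ.bracket X Y := rfl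

theorem coad_add (X Y : L) (ξ : Dual R L) : ℒ.coad (X + Y) ξ = ℒ.coad X ξ + ℒ.coad Y ξ := by
  ext Z
  simp only [coad_apply, map_add, LinearMap.add_apply, Derivation.add_apply]
  abel

theorem coad_smul (f : R) (X : L) (ξ : Dual R L) :
    ℒ.coad (f • X) ξ = f • ℒ.coad X ξ + ξ X • ℒ.dFun f := by
  ext Z
  simp only [coad_apply, map_smul, LinearMap.add_apply, Derivation.smul_apply,
    LinearMap.smul_apply, smul_bracket, map_sub, smul_eq_mul]
  change _ = _ + ξ X * ℒ.anchor Z f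
  ring

theorem coad_bracket (X Y : L) (ξ : Dual R L) :
    ℒ.coad (ℒ.bracket X Y) ξ = ℒ.coad X (ℒ.coad Y ξ) - ℒ.coad Y (ℒ.coad X ξ) := by
  ext Z
  simp only [coad_apply, LinearMap.sub_apply, anchor_bracket, Derivation.commutator_apply,
    bracket_bracket, map_sub]
  ring

/-- `𝒮` is a module over the Lie algebroid `A*`. -/
theorem exists_dualAction (F : FrameOfRank R L n) (FS : FrameOfRank R S 1)
    (hm : ∀ Ω : Derivation 𝕜 R R [⋀^Fin (m + 1)]→ₗ[R] R, Ω = 0)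
    (sq : S ⊗[R] S ≃ₗ[R] DetLine 𝕜 R L n m) : ∃ ρ : ℒ'.Rep S, IsDualAction ℒ' sq ρ := by
  choose D hD using fun α => FS.exists_square_root sq ((ℒ'.ad α).detLine n m)
  refine ⟨⟨D, fun α β s => ?_, fun f α s => ?_, fun α β s => ?_⟩, hD⟩
  · refine IsSquareRoot.unique FS (hD (α + β)) ((hD α).add (hD β)) (fun κ => ?_) s
    rw [← DerEnd.detLine_add]
    exact DerEnd.detLine_congr (map_add _ _ _) (fun x => by simp [ad_apply]) κ
  · refine FS.square_root_unique (K := DetLine 𝕜 R L n m) (sq := sq) (A := (D (f • α)).toLinearMap)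
      (B := (f • (LinearMap.id : S →ₗ[R] S)).restrictScalars 𝕜 ∘ₗ (D α).toLinearMap)
      (fun s t => ?_) s
    rw [hD, DerEnd.detLine_of_eq_smul_add F hm (T := ℒ'.ad α) (f := f) (g := -ℒ'.dFun f) (w := α)
      (map_smul _ _ _) (fun β => ?_)]
    · change _ = sq ((f • D α s) ⊗ₜ t) + sq (s ⊗ₜ (f • D α t))
      rw [← TensorProduct.smul_tmul', TensorProduct.tmul_smul, map_smul, map_smul, ← smul_add,
        hD α s t]
      -- The divergence on forms of the base cancels the trace of `β ↦ -a_*(β)(f) α`, which is why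
      -- `𝒮` itself carries an action of `A*` that is linear in `α`.
      have : ℒ'.anchor α f + (-ℒ'.dFun f) α = 0 := add_neg_cancel _
      rw [this, zero_smul, add_zero]
    · have h1 : (-ℒ'.dFun f) β • α = -(ℒ'.anchor β f • α) := by
        refine LinearMap.ext fun X => ?_
        change -(ℒ'.anchor β f) * α X = -(ℒ'.anchor β f * α X)
        ring
      rw [ad_apply, smul_bracket, h1, sub_eq_add_neg]
      rfl
  · refine IsSquareRoot.unique FS (hD (ℒ'.bracket α β)) ((hD α).comm (hD β)) (fun κ => ?_) s
    rw [← DerEnd.detLine_comm]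
    exact DerEnd.detLine_congr (ℒ'.anchor_bracket _ _)
      (fun x => by simp [ad_apply, bracket_bracket]) κ

/-- `⋀ⁿ A ⊗ 𝒮` is a module over the Lie algebroid `A`. -/
theorem exists_complementAction (F : FrameOfRank R L n) (FS : FrameOfRank R S 1)
    (hm : ∀ Ω : Derivation 𝕜 R R [⋀^Fin (m + 1)]→ₗ[R] R, Ω = 0)
    (sq : S ⊗[R] S ≃ₗ[R] DetLine 𝕜 R L n m) :
    ∃ ρ : ℒ.Rep (Dual R L [⋀^Fin n]→ₗ[R] S), IsComplementAction ℒ sq ρ := by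
  choose D hD using fun X => FS.exists_square_root sq ((ℒ.coad X).detLine n m)
  have hadd (X Y : L) (s : S) : D (X + Y) s = D X s + D Y s := by
    refine IsSquareRoot.unique FS (hD (X + Y)) ((hD X).add (hD Y)) (fun κ => ?_) s
    rw [← DerEnd.detLine_add]
    exact DerEnd.detLine_congr (map_add _ _ _) (fun x => ℒ.coad_add X Y x) κ
  -- For `A` the two divergences have the same sign and add up to `2 a(X) f` on `𝒮 ⊗ 𝒮`, hence `a(X)
  -- f` on `𝒮`. So `D` is not linear over functions in `X` and is not an action on `𝒮`.
  have hsmul (f : R) (X : L) (s : S) : D (f • X) s = f • D X s + ℒ.anchor X f • s := by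
    refine FS.square_root_unique (K := DetLine 𝕜 R L n m) (sq := sq) (A := (D (f • X)).toLinearMap)
      (B := (f • (LinearMap.id : S →ₗ[R] S)).restrictScalars 𝕜 ∘ₗ (D X).toLinearMap +
        (ℒ.anchor X f • (LinearMap.id : S →ₗ[R] S)).restrictScalars 𝕜) (fun s t => ?_) s
    rw [hD, DerEnd.detLine_of_eq_smul_add F hm (T := ℒ.coad X) (f := f) (g := Dual.eval R L X)
      (w := ℒ.dFun f) (map_smul _ _ _) (fun ξ => ℒ.coad_smul f X ξ)]
    change _ = sq ((f • D X s + ℒ.anchor X f • s) ⊗ₜ t) +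
      sq (s ⊗ₜ (f • D X t + ℒ.anchor X f • t))
    rw [TensorProduct.add_tmul, TensorProduct.tmul_add, ← TensorProduct.smul_tmul',
      ← TensorProduct.smul_tmul', TensorProduct.tmul_smul, TensorProduct.tmul_smul, map_add,
      map_add, map_smul, map_smul, map_smul, ← hD X s t]
    have : (Dual.eval R L X) (ℒ.dFun f) = ℒ.anchor X f := rfl
    rw [this]
    module
  have hbr (X Y : L) (s : S) : D (ℒ.bracket X Y) s = D X (D Y s) - D Y (D X s) := by
    refine IsSquareRoot.unique FS (hD (ℒ.bracket X Y)) ((hD X).comm (hD Y)) (fun κ => ?_) s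
    rw [← DerEnd.detLine_comm]
    exact DerEnd.detLine_congr (ℒ.anchor_bracket _ _) (fun x => ℒ.coad_bracket X Y x) κ
  refine ⟨⟨fun X => (ℒ.coad X).alt (D X) n, fun X Y e => ?_, fun f X e => ?_, fun X Y e => ?_⟩,
    fun X => ⟨D X, hD X, fun _ => rfl⟩⟩
  · rw [← DerEnd.add_apply, ← DerEnd.alt_add]
    exact DerEnd.alt_congr (fun x => ℒ.coad_add X Y x) (hadd X Y) e
  -- On `⋀ⁿ A ⊗ 𝒮` the extra term disappears: the factor `⋀ⁿ A` contributes `-a(X) f`.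
  · rw [DerEnd.alt_of_eq_smul_add
      (fun Ω => F.dual.alternatingMap_eq_zero 𝕜 (Nat.lt_succ_self n) Ω)
      (g := Dual.eval R L X) (fun ξ => ℒ.coad_smul f X ξ) (hsmul f X)]
    have : (Dual.eval R L X) (ℒ.dFun f) = ℒ.anchor X f := rfl
    rw [show ℒ.anchor X f - (Dual.eval R L X) (ℒ.dFun f) = 0 by rw [this, sub_self], zero_smul,
      add_zero]
  · rw [← DerEnd.comm_apply, ← DerEnd.alt_comm]
    exact DerEnd.alt_congr (fun x => ℒ.coad_bracket X Y x) (hbr X Y) e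

end LieAlgebroid

theorem IsDualAction.unique {ℒ' : LieAlgebroid 𝕜 R (Dual R L)} (FS : FrameOfRank R S 1)
    {sq : S ⊗[R] S ≃ₗ[R] DetLine 𝕜 R L n m} {ρ σ : ℒ'.Rep S} (h : IsDualAction ℒ' sq ρ)
    (h' : IsDualAction ℒ' sq σ) : ρ = σ :=
  LieAlgebroid.Rep.ext fun α => IsSquareRoot.unique FS (h α) (h' α) fun _ => rfl

theorem IsComplementAction.unique {ℒ : LieAlgebroid 𝕜 R L} (FS : FrameOfRank R S 1)
    {sq : S ⊗[R] S ≃ₗ[R] DetLine 𝕜 R L n m} {ρ σ : ℒ.Rep (Dual R L [⋀^Fin n]→ₗ[R] S)}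
    (h : IsComplementAction ℒ sq ρ) (h' : IsComplementAction ℒ sq σ) : ρ = σ :=
  LieAlgebroid.Rep.ext fun X v => by
    obtain ⟨D, hD, hv⟩ := h X
    obtain ⟨D', hD', hv'⟩ := h' X
    rw [hv, hv', DerEnd.ext (IsSquareRoot.unique FS hD hD' fun _ => rfl)]

end Actions

/-! ### The duality between `⋀ A ⊗ 𝒮` and `⋀ A* ⊗ ⋀ⁿ A ⊗ 𝒮` -/

noncomputable section Complement

variable {𝕜 R L S : Type*} [Field 𝕜] [CharZero 𝕜] [CommRing R] [Algebra 𝕜 R]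
  [AddCommGroup L] [Module R L] [Module 𝕜 L] [IsScalarTower 𝕜 R L]
  [AddCommGroup S] [Module R S] [Module 𝕜 S] [IsScalarTower 𝕜 R S] {n : ℕ}

namespace Spinor

theorem extMul_apply (X : L) (Ω : Spinor R L S) :
    extMul X Ω = Cochain.wedge (Dual.eval R L X) Ω := rfl

theorem intMul_apply (ξ : Dual R L) (Ω : Spinor R L S) : intMul ξ Ω = Cochain.contract ξ Ω := rfl

theorem complement_apply (Ω : Spinor R L S) (k : ℕ) (v : Fin k → L) :
    complement n Ω k v = wedgeMul (ExteriorAlgebra.ιMulti R k (v ∘ Fin.rev)) Ω n := rfl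

theorem complement_zero (Ω : Spinor R L S) : complement n Ω 0 ![] = Ω n := by
  rw [complement_apply, ExteriorAlgebra.ιMulti_zero_apply, map_one]
  rfl

/-- The reversed order in `complement` places the first argument next to `Ω`. The isomorphism thus
exchanges contraction with exterior multiplication, and together with its value in degree zero this
is all that is used about it. -/
theorem contract_complement (X : L) (Ω : Spinor R L S) :
    Cochain.contract X (complement n Ω) = complement n (extMul X Ω) := by
  funext k
  ext1 v
  rw [Cochain.contract_apply, complement_apply, complement_apply, ExteriorAlgebra.ιMulti_apply,
    ExteriorAlgebra.ιMulti_apply, List.ofFn_succ', List.concat_eq_append, List.prod_append,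
    map_mul]
  simp only [Function.comp_apply, Fin.rev_last, Matrix.cons_val_zero, List.prod_cons,
    List.prod_nil, mul_one, Fin.rev_castSucc, Matrix.cons_val_succ]
  rw [Module.End.mul_apply, wedgeMul, ExteriorAlgebra.lift_ι_apply]

/-- `complement` as a linear map. -/
def complementLin (n : ℕ) : Spinor R L S →ₗ[R] Cochain R L (Dual R L [⋀^Fin n]→ₗ[R] S) where
  toFun := complement n
  map_add' Ω η := by
    funext k; ext1 v
    simp only [complement_apply, map_add, Pi.add_apply, AlternatingMap.add_apply]
  map_smul' f Ω := by
    funext k; ext1 v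
    simp only [complement_apply, map_smul, Pi.smul_apply, AlternatingMap.smul_apply,
      RingHom.id_apply]

theorem complementLin_apply (Ω : Spinor R L S) : complementLin n Ω = complement n Ω := rfl

theorem complement_add (Ω η : Spinor R L S) :
    complement n (Ω + η) = complement n Ω + complement n η := map_add (complementLin n) Ω η

/-- Below the top degree a form is determined by its exterior products with a frame. These products
are the contractions on the other side, so one descends from degree `n`. -/
theorem eq_zero_of_complement (𝕜 : Type*) [Field 𝕜] [CharZero 𝕜] [Algebra 𝕜 R] [Module 𝕜 S]
    [IsScalarTower 𝕜 R S] (F : FrameOfRank R L n) {k : ℕ} (hk : k ≤ n) {Ω : Spinor R L S}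
    (h : complement n Ω k = 0) : Ω (n - k) = 0 := by
  induction k generalizing Ω with
  | zero =>
    rw [Nat.sub_zero, ← complement_zero (n := n) Ω, h, AlternatingMap.zero_apply]
  | succ k ih =>
    refine Cochain.eq_zero_of_wedge 𝕜 F.dual.sum_smul F.dual.trace (by omega) fun i => ?_
    rw [show n - (k + 1) + 1 = n - k by omega]
    refine ih (by omega) (Ω := extMul (F.vec i) Ω) ?_
    rw [← contract_complement]
    change AlternatingMap.curryLeft (complement n Ω (k + 1)) (F.vec i) = 0
    rw [h, AlternatingMap.curryLeft_zero, LinearMap.zero_apply]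

theorem complement_eq_zero (𝕜 : Type*) [Field 𝕜] [CharZero 𝕜] [Algebra 𝕜 R] [Module 𝕜 S]
    [IsScalarTower 𝕜 R S] (F : FrameOfRank R L n) {k : ℕ} {Ω : Spinor R L S}
    (h : Ω (n - k) = 0) : complement n Ω k = 0 := by
  by_cases hk : k ≤ n
  · induction k generalizing Ω with
    | zero =>
      have : complement n Ω 0 = (0 : Cochain R L (Dual R L [⋀^Fin n]→ₗ[R] S)) 0 :=
        Cochain.ext_zero (by rw [complement_zero]; exact h)
      exact this
    | succ k ih =>
      have : complement n Ω (k + 1) = (0 : Cochain R L (Dual R L [⋀^Fin n]→ₗ[R] S)) (k + 1) := by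
        refine Cochain.ext_succ fun X => ?_
        rw [contract_complement, map_zero]
        refine ih ?_ (by omega)
        have h2 : n - k = n - (k + 1) + 1 := by omega
        rw [h2, extMul_apply, Cochain.wedge_congr (η := 0) _ h, map_zero]
        rfl
      exact this
  · exact F.alternatingMap_eq_zero 𝕜 (by omega) _

theorem complement_injective (𝕜 : Type*) [Field 𝕜] [CharZero 𝕜] [Algebra 𝕜 R] [Module 𝕜 S]
    [IsScalarTower 𝕜 R S] (F : FrameOfRank R L n) {Ω η : Spinor R L S}
    (h : complement n Ω = complement n η) : Ω = η := by
  rw [← sub_eq_zero]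
  have h0 : complement n (Ω - η) = 0 := by
    rw [← complementLin_apply, map_sub, sub_eq_zero]; exact h
  funext j
  by_cases hj : j ≤ n
  · have := eq_zero_of_complement 𝕜 F (Nat.sub_le n j) (congrFun h0 (n - j))
    rwa [Nat.sub_sub_self hj] at this
  · exact F.dual.alternatingMap_eq_zero 𝕜 (by omega) _

theorem complement_congr (𝕜 : Type*) [Field 𝕜] [CharZero 𝕜] [Algebra 𝕜 R] [Module 𝕜 S]
    [IsScalarTower 𝕜 R S] (F : FrameOfRank R L n) {k : ℕ} {Ω η : Spinor R L S}
    (h : Ω (n - k) = η (n - k)) : complement n Ω k = complement n η k := by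
  rw [← sub_eq_zero]
  have := complement_eq_zero 𝕜 F (k := k) (Ω := Ω - η) (by rw [Pi.sub_apply, h, sub_self])
  rw [← complementLin_apply, map_sub] at this
  exact this

/-- Induction on `k`. Preimages `σ(X)` of the contractions `i_X Θ` can be chosen linearly in `X` by
means of a frame; a preimage of `Θ` must satisfy `X ∧ Ω = σ(X)` for all `X`, in the degree
concerned. The integrability condition for this is the antisymmetry of `X ∧ σ(Y)`. -/
theorem exists_complement_eq (𝕜 : Type*) [Field 𝕜] [CharZero 𝕜] [Algebra 𝕜 R] [Module 𝕜 S]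
    [IsScalarTower 𝕜 R S] (F : FrameOfRank R L n) {k : ℕ} (hk : k ≤ n)
    (Θ : Cochain R L (Dual R L [⋀^Fin n]→ₗ[R] S)) :
    ∃ Ω : Spinor R L S, complement n Ω k = Θ k := by
  induction k generalizing Θ with
  | zero =>
    refine ⟨Pi.single n (Θ 0 ![]), Cochain.ext_zero ?_⟩
    rw [complement_zero, Pi.single_eq_same]
  | succ k ih =>
    choose τ hτ using fun i => ih (by omega) (Cochain.contract (F.vec i) Θ)
    let σ : L →ₗ[R] Spinor R L S := ∑ i, (F.coord i).smulRight (τ i)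
    have hσ_apply (X : L) : σ X = ∑ i, F.coord i X • τ i := by simp [σ]
    have hσ (X : L) : complement n (σ X) k = Cochain.contract X Θ k := by
      rw [← complementLin_apply, hσ_apply, map_sum, Finset.sum_apply]
      simp only [map_smul, Pi.smul_apply, complementLin_apply, hτ]
      have := congrFun (Cochain.contract_sum (fun i => F.coord i X) F.vec Θ) k
      rw [F.sum_smul, Finset.sum_apply] at this
      exact this
    have hanti (X Y : L) : (extMul X (σ Y) + extMul Y (σ X)) (n - k + 1) = 0 := by
      rcases k with _ | k
      · exact F.dual.alternatingMap_eq_zero 𝕜 (by omega) _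
      · rw [show n - (k + 1) + 1 = n - k by omega]
        refine eq_zero_of_complement 𝕜 F (by omega) ?_
        have h (X Y : L) : complement n (extMul X (σ Y)) k =
            Cochain.contract X (Cochain.contract Y Θ) k := by
          rw [← contract_complement]
          exact congrArg (fun a => AlternatingMap.curryLeft a X) (hσ Y)
        rw [complement_add, Pi.add_apply, h, h, Cochain.contract_anticomm X Y, Pi.neg_apply,
          neg_add_cancel]
    have hk1 : ((k : 𝕜) + 1) ≠ 0 := Nat.cast_add_one_ne_zero k
    -- Multiplying the sum by `X` gives `σ(X) - ∑ i_{φᵢ} (X ∧ σ(xᵢ)) = σ(X) + ∑ i_{φᵢ} (xᵢ ∧ σ(X))`.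
    -- In degree `n - k` the last sum is `(n - (n - k)) σ(X) = k σ(X)`, whence the factor `k + 1`.
    refine ⟨((k : 𝕜) + 1)⁻¹ • ∑ i, intMul (F.coord i) (σ (F.vec i)), ?_⟩
    refine Cochain.ext_succ fun X => ?_
    rw [contract_complement, ← hσ]
    refine complement_congr 𝕜 F ?_
    rw [← algebraMap_smul R, map_smul, map_sum, algebraMap_smul, Pi.smul_apply,
      inv_smul_eq_iff₀ hk1]
    have h1 (i : F.ι) : extMul X (intMul (F.coord i) (σ (F.vec i))) =
        F.coord i X • σ (F.vec i) - intMul (F.coord i) (extMul X (σ (F.vec i))) := by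
      have e : Dual.eval R L X (F.coord i) = F.coord i X := rfl
      rw [intMul_apply, intMul_apply, extMul_apply, extMul_apply, Cochain.contract_wedge, e,
        sub_sub_cancel]
    have h2 (i : F.ι) : intMul (F.coord i) (extMul X (σ (F.vec i))) (n - k) =
        -intMul (F.coord i) (extMul (F.vec i) (σ X)) (n - k) := by
      rw [← add_eq_zero_iff_eq_neg, ← Pi.add_apply, ← map_add]
      change AlternatingMap.curryLeft
        ((extMul X (σ (F.vec i)) + extMul (F.vec i) (σ X)) (n - k + 1)) (F.coord i) = 0
      rw [hanti, AlternatingMap.curryLeft_zero, LinearMap.zero_apply]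
    have h3 : ∑ i, F.coord i X • σ (F.vec i) = σ X := by
      conv_rhs => rw [← F.sum_smul X]
      simp
    have h4 := Cochain.sum_contract_wedge F.dual.sum_smul (σ X) (n - k)
    rw [F.dual.trace] at h4
    have h6 := congrFun h3 (n - k)
    rw [Finset.sum_apply] at h6
    simp only [h1, Pi.sub_apply, Finset.sum_apply, h2, sub_neg_eq_add, Finset.sum_add_distrib, h6]
    have h5 : ∑ i, intMul (F.coord i) (extMul (F.vec i) (σ X)) (n - k) =
        (n : R) • σ X (n - k) - (n - k) • σ X (n - k) := by
      rw [← h4, Finset.sum_apply]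
      rfl
    rw [h5, Nat.cast_smul_eq_nsmul, ← Nat.cast_smul_eq_nsmul 𝕜, ← Nat.cast_smul_eq_nsmul 𝕜,
      Nat.cast_sub (by omega)]
    module

theorem complement_bijective (𝕜 : Type*) [Field 𝕜] [CharZero 𝕜] [Algebra 𝕜 R] [Module 𝕜 S]
    [IsScalarTower 𝕜 R S] (F : FrameOfRank R L n) :
    Function.Bijective (complementLin (R := R) (L := L) (S := S) n) := by
  refine ⟨fun Ω η h => complement_injective 𝕜 F h, fun Θ => ?_⟩
  choose Ω hΩ using fun k : {k // k ≤ n} => exists_complement_eq 𝕜 F k.2 Θ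
  -- Degree `k` of the target sees only degree `n - k` of a spinor, so preimages found one degree at
  -- a time can be assembled.
  refine ⟨fun j => Ω ⟨n - j, Nat.sub_le n j⟩ j, funext fun k => ?_⟩
  by_cases hk : k ≤ n
  · rw [← hΩ ⟨k, hk⟩]
    refine complement_congr 𝕜 F ?_
    have : (⟨n - (n - k), Nat.sub_le n _⟩ : {k // k ≤ n}) = ⟨k, hk⟩ :=
      Subtype.ext (Nat.sub_sub_self hk)
    rw [this]
  · rw [F.alternatingMap_eq_zero 𝕜 (not_le.1 hk) (Θ k)]
    exact F.alternatingMap_eq_zero 𝕜 (not_le.1 hk) _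

end Spinor

/-- The operator on spinors that corresponds to the differential of `A` with coefficients in a
module structure on `⋀ⁿ A ⊗ 𝒮`. -/
def LieAlgebroid.Rep.codifferential {ℒ : LieAlgebroid 𝕜 R L} (F : FrameOfRank R L n)
    (ρ : ℒ.Rep (Dual R L [⋀^Fin n]→ₗ[R] S)) : Spinor R L S →ₗ[𝕜] Spinor R L S :=
  let e := (LinearEquiv.ofBijective (Spinor.complementLin n)
    (Spinor.complement_bijective (S := S) 𝕜 F)).restrictScalars 𝕜
  e.symm.toLinearMap ∘ₗ ρ.differential ∘ₗ e.toLinearMap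

theorem LieAlgebroid.Rep.complement_codifferential {ℒ : LieAlgebroid 𝕜 R L}
    (F : FrameOfRank R L n) (ρ : ℒ.Rep (Dual R L [⋀^Fin n]→ₗ[R] S)) (Ω : Spinor R L S) :
    Spinor.complement n (ρ.codifferential F Ω) = ρ.differential (Spinor.complement n Ω) :=
  (LinearEquiv.ofBijective (Spinor.complementLin n)
    (Spinor.complement_bijective (S := S) 𝕜 F)).apply_symm_apply _

end Complement

/-! ### Operators on spinors and criteria for their vanishing -/

noncomputable section Operators

variable {𝕜 R L S : Type*} [Field 𝕜] [CommRing R] [Algebra 𝕜 R]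
  [AddCommGroup L] [Module R L]
  [AddCommGroup S] [Module R S] [Module 𝕜 S] [IsScalarTower 𝕜 R S] {n m : ℕ}

namespace Spinor

variable (𝕜 S) in
/-- Exterior multiplication, as a `𝕜`-linear operator. -/
def opE (X : L) : End 𝕜 (Spinor R L S) := (extMul X).restrictScalars 𝕜

variable (𝕜 S) in
/-- Interior multiplication, as a `𝕜`-linear operator. -/
def opI (ξ : Dual R L) : End 𝕜 (Spinor R L S) := (intMul ξ).restrictScalars 𝕜

variable (𝕜 L S) in
/-- Multiplication by a function, as a `𝕜`-linear operator. -/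
def opM (f : R) : End 𝕜 (Spinor R L S) :=
  (f • (LinearMap.id : Spinor R L S →ₗ[R] Spinor R L S)).restrictScalars 𝕜

theorem opE_apply (X : L) (Ω : Spinor R L S) : opE 𝕜 S X Ω = extMul X Ω := rfl
theorem opI_apply (ξ : Dual R L) (Ω : Spinor R L S) : opI 𝕜 S ξ Ω = intMul ξ Ω := rfl
theorem opM_apply (f : R) (Ω : Spinor R L S) : opM 𝕜 L S f Ω = f • Ω := rfl

theorem opE_anticomm (X Y : L) :
    opE (R := R) 𝕜 S X * opE 𝕜 S Y = -(opE 𝕜 S Y * opE 𝕜 S X) :=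
  LinearMap.ext fun Ω => Cochain.wedge_anticomm (Dual.eval R L X) (Dual.eval R L Y) Ω

theorem opI_anticomm (ξ η : Dual R L) :
    opI 𝕜 S ξ * opI 𝕜 S η = -(opI 𝕜 S η * opI 𝕜 S ξ) :=
  LinearMap.ext fun Ω => Cochain.contract_anticomm ξ η Ω

theorem opI_opE (ξ : Dual R L) (X : L) :
    opI 𝕜 S ξ * opE 𝕜 S X + opE 𝕜 S X * opI 𝕜 S ξ = opM 𝕜 L S (ξ X) :=
  LinearMap.ext fun Ω => by
    change Cochain.contract ξ (Cochain.wedge (Dual.eval R L X) Ω) +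
      Cochain.wedge (Dual.eval R L X) (Cochain.contract ξ Ω) = ξ X • Ω
    rw [Cochain.contract_wedge, sub_add_cancel]
    rfl

theorem opM_opE (f : R) (X : L) : opM 𝕜 L S f * opE 𝕜 S X = opE 𝕜 S X * opM 𝕜 L S f :=
  LinearMap.ext fun Ω => ((extMul X).map_smul f Ω).symm

theorem opM_opI (f : R) (ξ : Dual R L) :
    opM 𝕜 L S f * opI 𝕜 S ξ = opI 𝕜 S ξ * opM 𝕜 L S f :=
  LinearMap.ext fun Ω => ((intMul ξ).map_smul f Ω).symm

theorem opM_opM (f g : R) : opM 𝕜 L S f * opM 𝕜 L S g = opM 𝕜 L S g * opM 𝕜 L S f :=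
  LinearMap.ext fun Ω => smul_comm f g Ω

theorem opE_add (X Y : L) : opE (R := R) 𝕜 S (X + Y) = opE 𝕜 S X + opE 𝕜 S Y :=
  LinearMap.ext fun Ω => by simp [opE_apply]

theorem opI_add (ξ η : Dual R L) : opI 𝕜 S (ξ + η) = opI 𝕜 S ξ + opI 𝕜 S η :=
  LinearMap.ext fun Ω => by simp [opI_apply]

theorem opM_zero : opM (R := R) 𝕜 L S 0 = 0 := LinearMap.ext fun Ω => zero_smul R Ω
theorem opM_one : opM (R := R) 𝕜 L S 1 = 1 := LinearMap.ext fun Ω => one_smul R Ω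

theorem opM_add (f g : R) : opM 𝕜 L S (f + g) = opM 𝕜 L S f + opM 𝕜 L S g :=
  LinearMap.ext fun Ω => add_smul f g Ω

theorem opM_neg (f : R) : opM 𝕜 L S (-f) = -opM 𝕜 L S f :=
  LinearMap.ext fun Ω => neg_smul f Ω

theorem opI_sub (ξ η : Dual R L) : opI 𝕜 S (ξ - η) = opI 𝕜 S ξ - opI 𝕜 S η :=
  LinearMap.ext fun Ω => by simp [opI_apply]

theorem opE_sub (X Y : L) : opE (R := R) 𝕜 S (X - Y) = opE 𝕜 S X - opE 𝕜 S Y :=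
  LinearMap.ext fun Ω => by simp [opE_apply]

theorem opE_smul (f : R) (X : L) : opE 𝕜 S (f • X) = opM 𝕜 L S f * opE 𝕜 S X :=
  LinearMap.ext fun Ω => by simp [opE_apply, opM_apply]

theorem opI_smul (f : R) (ξ : Dual R L) : opI 𝕜 S (f • ξ) = opM 𝕜 L S f * opI 𝕜 S ξ :=
  LinearMap.ext fun Ω => by simp [opI_apply, opM_apply]

theorem opE_sum {ι : Type*} [Fintype ι] (X : ι → L) :
    opE (R := R) 𝕜 S (∑ i, X i) = ∑ i, opE 𝕜 S (X i) :=
  LinearMap.ext fun Ω => by simp [opE_apply]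

/-- An operator that commutes up to signs with interior multiplications and has no
degree-zero component vanishes. -/
theorem op_eq_zero_of_int {T : End 𝕜 (Spinor R L S)}
    (hT : ∀ ξ, opI 𝕜 S ξ * T = T * opI 𝕜 S ξ ∨ opI 𝕜 S ξ * T + T * opI 𝕜 S ξ = 0) (h0 : ∀ Ω, T Ω 0 = 0) : T = 0 := by
  refine LinearMap.ext fun Ω => funext fun k => ?_
  induction k generalizing Ω with
  | zero => exact h0 Ω
  | succ k ih =>
    refine Cochain.ext_succ (η := 0) fun ξ => ?_
    have h2 : T (opI 𝕜 S ξ Ω) k = 0 := ih (opI 𝕜 S ξ Ω)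
    rw [map_zero]
    change opI 𝕜 S ξ (T Ω) k = 0
    rcases hT ξ with h | h
    · exact (congrFun (LinearMap.congr_fun h Ω) k).trans h2
    · have h3 : opI 𝕜 S ξ (T Ω) k + T (opI 𝕜 S ξ Ω) k = 0 :=
        congrFun (LinearMap.congr_fun h Ω) k
      rwa [h2, add_zero] at h3

variable [CharZero 𝕜]

/-- An operator that commutes up to signs with exterior multiplications and has no
component of top degree vanishes. -/
theorem op_eq_zero_of_ext (F : FrameOfRank R L n) {T : End 𝕜 (Spinor R L S)}
    (hT : ∀ X, opE 𝕜 S X * T = T * opE 𝕜 S X ∨ opE 𝕜 S X * T + T * opE 𝕜 S X = 0) (h0 : ∀ Ω, T Ω n = 0) : T = 0 := by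
  have key (j : ℕ) (Ω : Spinor R L S) (hj : j ≤ n) : T Ω (n - j) = 0 := by
    induction j generalizing Ω with
    | zero => exact h0 Ω
    | succ j ih =>
      refine Cochain.eq_zero_of_wedge 𝕜 F.dual.sum_smul F.dual.trace (by omega) fun i => ?_
      have h2 := ih (opE 𝕜 S (F.vec i) Ω) (by omega)
      rw [show n - (j + 1) + 1 = n - j by omega]
      change opE 𝕜 S (F.vec i) (T Ω) (n - j) = 0
      rcases hT (F.vec i) with h | h
      · exact (congrFun (LinearMap.congr_fun h Ω) (n - j)).trans h2
      · have h3 : opE 𝕜 S (F.vec i) (T Ω) (n - j) + T (opE 𝕜 S (F.vec i) Ω) (n - j) = 0 :=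
          congrFun (LinearMap.congr_fun h Ω) (n - j)
        rwa [h2, add_zero] at h3
  refine LinearMap.ext fun Ω => funext fun k => ?_
  by_cases hk : k ≤ n
  · have := key (n - k) Ω (Nat.sub_le n k)
    rwa [Nat.sub_sub_self hk] at this
  · exact F.dual.alternatingMap_eq_zero 𝕜 (not_le.1 hk) _

theorem eq_sum_single (𝕜 : Type*) [Field 𝕜] [CharZero 𝕜] [Algebra 𝕜 R] [Module 𝕜 S]
    [IsScalarTower 𝕜 R S] (F : FrameOfRank R L n) (Ω : Spinor R L S) :
    Ω = ∑ k ∈ Finset.range (n + 1), Pi.single k (Ω k) := by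
  funext j
  rw [Finset.sum_apply]
  by_cases hj : j ≤ n
  · rw [Finset.sum_eq_single j (fun k _ hk => Pi.single_eq_of_ne (Ne.symm hk) _)
      (fun h => absurd (Finset.mem_range.2 (Nat.lt_succ_of_le hj)) h), Pi.single_eq_same]
  · rw [F.dual.alternatingMap_eq_zero 𝕜 (not_le.1 hj) (Ω j)]
    exact (F.dual.alternatingMap_eq_zero 𝕜 (not_le.1 hj) _).symm

theorem intMul_single_succ (ξ : Dual R L) (k : ℕ) (a : Dual R L [⋀^Fin (k + 1)]→ₗ[R] S) :
    intMul ξ (Pi.single (k + 1) a) = Pi.single k (AlternatingMap.curryLeft a ξ) := by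
  funext j
  change AlternatingMap.curryLeft ((Pi.single (k + 1) a : Spinor R L S) (j + 1)) ξ = _
  by_cases h : j = k
  · subst h; rw [Pi.single_eq_same, Pi.single_eq_same]
  · rw [Pi.single_eq_of_ne h, Pi.single_eq_of_ne (fun h' => h (Nat.succ_injective h')),
      AlternatingMap.curryLeft_zero, LinearMap.zero_apply]

theorem intMul_single_zero (ξ : Dual R L) (a : Dual R L [⋀^Fin 0]→ₗ[R] S) :
    intMul ξ (Pi.single 0 a : Spinor R L S) = 0 := by
  funext j
  change AlternatingMap.curryLeft ((Pi.single 0 a : Spinor R L S) (j + 1)) ξ = _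
  rw [Pi.single_eq_of_ne (Nat.succ_ne_zero j), AlternatingMap.curryLeft_zero]
  rfl

theorem sum_extMul_intMul (F : FrameOfRank R L n) (k : ℕ) (a : Dual R L [⋀^Fin k]→ₗ[R] S) :
    ∑ i, extMul (F.vec i) (intMul (F.coord i) (Pi.single k a)) =
      (k • Pi.single k a : Spinor R L S) := by
  funext j
  have h := Cochain.sum_wedge_contract F.dual.sum_smul (Pi.single k a : Spinor R L S) j
  refine h.trans ?_
  change _ = k • (Pi.single k a : Spinor R L S) j
  by_cases hj : j = k
  · rw [hj]
  · rw [Pi.single_eq_of_ne hj, smul_zero, smul_zero]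

/-- An operator that commutes up to signs with exterior multiplications and vanishes in
degree zero is zero. -/
theorem op_eq_zero_of_single (F : FrameOfRank R L n) {T : End 𝕜 (Spinor R L S)}
    (hT : ∀ X, opE 𝕜 S X * T = T * opE 𝕜 S X ∨ opE 𝕜 S X * T + T * opE 𝕜 S X = 0) (h0 : ∀ a, T (Pi.single 0 a) = 0) :
    T = 0 := by
  have key (k : ℕ) (a : Dual R L [⋀^Fin k]→ₗ[R] S) : T (Pi.single k a) = 0 := by
    induction k with
    | zero => exact h0 a
    | succ k ih =>
      -- Euler's formula writes `(k + 1) a` as `∑ xᵢ ∧ i_{φᵢ} a`; moving `T` past `xᵢ ∧` lowers the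
      -- degree of its argument.
      have h : ((k + 1 : ℕ) : 𝕜) • T (Pi.single (k + 1) a) = 0 := by
        rw [← map_smul, Nat.cast_smul_eq_nsmul, ← sum_extMul_intMul F, map_sum]
        refine Finset.sum_eq_zero fun i _ => ?_
        have h1 : opE 𝕜 S (F.vec i) (T (intMul (F.coord i) (Pi.single (k + 1) a))) = 0 := by
          rw [intMul_single_succ, ih, map_zero]
        rcases hT (F.vec i) with h | h
        · exact (LinearMap.congr_fun h
            (intMul (F.coord i) (Pi.single (k + 1) a))).symm.trans h1
        · have h3 : opE 𝕜 S (F.vec i) (T (intMul (F.coord i) (Pi.single (k + 1) a))) +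
              T (opE 𝕜 S (F.vec i) (intMul (F.coord i) (Pi.single (k + 1) a))) = 0 :=
            LinearMap.congr_fun h (intMul (F.coord i) (Pi.single (k + 1) a))
          rwa [h1, zero_add] at h3
      exact (smul_eq_zero.1 h).resolve_left (Nat.cast_ne_zero.2 (Nat.succ_ne_zero k))
  refine LinearMap.ext fun Ω => ?_
  rw [eq_sum_single 𝕜 F Ω, map_sum]
  exact Finset.sum_eq_zero fun k _ => key k _

/-- A function that annihilates `𝒮` annihilates the trace of the identity of `𝒮`, which is `1`. -/
theorem opM_injective (FS : FrameOfRank R S 1) {f : R} (h : opM 𝕜 L S f = 0) : f = 0 := by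
  have h1 (s : S) : f • s = 0 := by
    have := LinearMap.congr_fun h (Pi.single 0 (AlternatingMap.constOfIsEmpty R (Dual R L) (Fin 0) s))
    have := congrArg (fun a => a ![]) (congrFun this 0)
    simpa [opM_apply] using this
  have h2 : f * ∑ i, FS.coord i (FS.vec i) = 0 := by
    rw [Finset.mul_sum]
    refine Finset.sum_eq_zero fun i _ => ?_
    rw [← smul_eq_mul, ← map_smul, h1, map_zero]
  rwa [FS.trace, Nat.cast_one, mul_one] at h2

end Spinor

end Operators

/-! ### Spin derivations -/

noncomputable section SpinDerivations

variable {𝕜 R L S : Type*} [Field 𝕜] [CharZero 𝕜] [CommRing R] [Algebra 𝕜 R]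
  [AddCommGroup L] [Module R L] [Module 𝕜 L] [IsScalarTower 𝕜 R L]
  [AddCommGroup S] [Module R S] [Module 𝕜 S] [IsScalarTower 𝕜 R S] {n m : ℕ}
  {δ : Derivation 𝕜 R R}

theorem mul_mul_sub_eq_of_anticomm {A : Type*} [Ring A] {x y e p c : A} (h : x * y = -(y * x))
    (hp : y * e + e * y = p) : y * (e * x) - c = e * x * y - c - -p * x := by
  rw [← hp, mul_assoc e x y, h]
  noncomm_ring

namespace DerEnd
open Spinor

theorem altC_opI (T : DerEnd δ (Dual R L)) (D : DerEnd δ S) (ξ : Dual R L) :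
    T.altC D * opI 𝕜 S ξ - opI 𝕜 S ξ * T.altC D = opI 𝕜 S (T ξ) :=
  LinearMap.ext fun Ω => by
    change T.altC D (Cochain.contract ξ Ω) - Cochain.contract ξ (T.altC D Ω) =
      Cochain.contract (T ξ) Ω
    rw [contract_altC, sub_sub_cancel]

/-- The operator on `L` dual to an operator on the dual of `L`. -/
def transpose (F : FrameOfRank R L n) (T : DerEnd δ (Dual R L)) (X : L) : L :=
  F.ofBidual (T.hom (scalar δ) (Dual.eval R L X))

theorem apply_transpose (F : FrameOfRank R L n) (T : DerEnd δ (Dual R L)) (X : L)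
    (ξ : Dual R L) : ξ (T.transpose F X) = δ (ξ X) - T ξ X := by
  rw [transpose, F.apply_ofBidual]; rfl

theorem altC_opE (F : FrameOfRank R L n) (T : DerEnd δ (Dual R L)) (D : DerEnd δ S) (X : L) :
    T.altC D * opE 𝕜 S X - opE 𝕜 S X * T.altC D = opE 𝕜 S (T.transpose F X) :=
  LinearMap.ext fun Ω => by
    change T.altC D (Cochain.wedge (Dual.eval R L X) Ω) -
      Cochain.wedge (Dual.eval R L X) (T.altC D Ω) =
        Cochain.wedge (Dual.eval R L (T.transpose F X)) Ω
    rw [altC_wedge, add_sub_cancel_right, transpose, F.eval_ofBidual]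

theorem altC_opM (T : DerEnd δ (Dual R L)) (D : DerEnd δ S) (f : R) :
    T.altC D * opM 𝕜 L S f - opM 𝕜 L S f * T.altC D = opM 𝕜 L S (δ f) :=
  LinearMap.ext fun Ω => by
    change T.altC D (f • Ω) - f • T.altC D Ω = δ f • Ω
    rw [altC_leibniz, add_sub_cancel_right]

end DerEnd

/-- Operators on spinors that are induced, through the product rule, by an operator on the sections
of `A*` and by the corresponding operator on `𝒮 = (⋀ⁿ A* ⊗ ⋀ᵐ T*M)^½`. -/
def IsSpinDerivation (sq : S ⊗[R] S ≃ₗ[R] DetLine 𝕜 R L n m) (Θ : End 𝕜 (Spinor R L S)) : Prop :=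
  ∃ (δ : Derivation 𝕜 R R) (T : DerEnd δ (Dual R L)) (D : DerEnd δ S),
    IsSquareRoot sq (T.detLine n m) D ∧ Θ = T.altC D

namespace IsSpinDerivation
open Spinor

variable {sq : S ⊗[R] S ≃ₗ[R] DetLine 𝕜 R L n m} {Θ Θ' : End 𝕜 (Spinor R L S)}

theorem add (h : IsSpinDerivation sq Θ) (h' : IsSpinDerivation sq Θ') :
    IsSpinDerivation sq (Θ + Θ') := by
  obtain ⟨δ, T, D, hD, rfl⟩ := h
  obtain ⟨δ', T', D', hD', rfl⟩ := h'
  exact ⟨δ + δ', T.add T', D.add D', by rw [DerEnd.detLine_add]; exact hD.add hD',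
    LinearMap.ext fun Ω => (DerEnd.altC_add T D T' D' Ω).symm⟩

theorem smul (h : IsSpinDerivation sq Θ) (c : 𝕜) : IsSpinDerivation sq (c • Θ) := by
  obtain ⟨δ, T, D, hD, rfl⟩ := h
  exact ⟨c • δ, T.smul c, D.smul c, by rw [DerEnd.detLine_smul]; exact IsSquareRoot.smul hD c,
    LinearMap.ext fun Ω => (DerEnd.altC_smul c T D Ω).symm⟩

theorem neg (h : IsSpinDerivation sq Θ) : IsSpinDerivation sq (-Θ) := by
  rw [← neg_one_smul 𝕜]; exact h.smul _

theorem sub (h : IsSpinDerivation sq Θ) (h' : IsSpinDerivation sq Θ') :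
    IsSpinDerivation sq (Θ - Θ') := by
  rw [sub_eq_add_neg]; exact h.add h'.neg

theorem comm (h : IsSpinDerivation sq Θ) (h' : IsSpinDerivation sq Θ') :
    IsSpinDerivation sq (Θ * Θ' - Θ' * Θ) := by
  obtain ⟨δ, T, D, hD, rfl⟩ := h
  obtain ⟨δ', T', D', hD', rfl⟩ := h'
  exact ⟨⁅δ, δ'⁆, T.comm T', D.comm D', by rw [DerEnd.detLine_comm]; exact hD.comm hD',
    LinearMap.ext fun Ω => (DerEnd.altC_comm T D T' D' Ω).symm⟩

/-- The action of the element `X ⊗ ξ` of `𝔤𝔩(A) ⊂ 𝔰𝔬(A ⊕ A*)`. -/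
theorem opE_opI (F : FrameOfRank R L n)
    (hm : ∀ Ω : Derivation 𝕜 R R [⋀^Fin (m + 1)]→ₗ[R] R, Ω = 0)
    (sq : S ⊗[R] S ≃ₗ[R] DetLine 𝕜 R L n m) (X : L) (ξ : Dual R L) :
    IsSpinDerivation sq (opE 𝕜 S X * opI 𝕜 S ξ - (2⁻¹ : 𝕜) • opM 𝕜 L S (ξ X)) := by
  let T : DerEnd (0 : Derivation 𝕜 R R) (Dual R L) :=
    DerEnd.ofLinear ((-Dual.eval R L X).smulRight ξ)
  -- The rank-one operator `T η = -η(X) ξ` acts on `⋀ⁿ A* ⊗ ⋀ᵐ T*M` by its trace `-ξ(X)`, so its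
  -- square root on `𝒮` is half of that. This is the source of the correction `-½ ξ(X)` to `X ∧
  -- i_ξ`.
  let D : DerEnd (0 : Derivation 𝕜 R R) S :=
    DerEnd.ofLinear (((2⁻¹ : 𝕜) • -(ξ X)) • (LinearMap.id : S →ₗ[R] S))
  have hD (s : S) : D s = ((2⁻¹ : 𝕜) • -(ξ X)) • s := rfl
  have hT (η : Dual R L) : T η = -(η X) • ξ := rfl
  refine ⟨0, T, D, fun s t => ?_, LinearMap.ext fun Ω => ?_⟩
  · rw [DerEnd.detLine_of_eq_smul_add (f := 0) (T := DerEnd.ofLinear (𝕜 := 𝕜) (0 : Dual R L →ₗ[R] Dual R L))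
      (g := -Dual.eval R L X) (w := ξ) F hm (by simp) (fun η => by simp [hT])]
    rw [hD, hD, ← TensorProduct.smul_tmul', TensorProduct.tmul_smul, map_smul, ← add_smul,
      ← smul_add, ← two_smul 𝕜 (-(ξ X)), smul_smul, inv_mul_cancel₀ two_ne_zero, one_smul,
      zero_smul, zero_add]
    congr 1
    exact (zero_add _).symm
  · refine DerEnd.eq_altC T D ((opE 𝕜 S X * opI 𝕜 S ξ - (2⁻¹ : 𝕜) • opM 𝕜 L S (ξ X) : End 𝕜 (Spinor R L S)))
      (fun Ω => ?_) (fun η Ω => ?_) Ω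
    · change (0 - (2⁻¹ : 𝕜) • (ξ X • Ω 0)) ![] = ((2⁻¹ : 𝕜) • -(ξ X)) • Ω 0 ![]
      rw [zero_sub, smul_neg, neg_smul, smul_assoc]
      rfl
    · rw [hT]
      have h : opI 𝕜 S η * (opE 𝕜 S X * opI 𝕜 S ξ - (2⁻¹ : 𝕜) • opM 𝕜 L S (ξ X)) =
          (opE 𝕜 S X * opI 𝕜 S ξ - (2⁻¹ : 𝕜) • opM 𝕜 L S (ξ X)) * opI 𝕜 S η -
            opI 𝕜 S (-(η X) • ξ) := by
        rw [opI_smul, opM_neg, mul_sub, sub_mul, mul_smul_comm, smul_mul_assoc, ← opM_opI]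
        exact mul_mul_sub_eq_of_anticomm (opI_anticomm ξ η) (opI_opE η X)
      exact LinearMap.congr_fun h Ω

/-- Commuting with functions kills the symbol `δ`, commuting with exterior multiplications then
kills `T`, and the operator on `𝒮`, being the square root of the zero operator, has to vanish too.
For an arbitrary operator on `𝒮` over `δ` the conclusion would hold only up to a multiplication by a
function. -/
theorem eq_zero (FS : FrameOfRank R S 1) (h : IsSpinDerivation sq Θ)
    (hM : ∀ f, Θ * opM 𝕜 L S f = opM 𝕜 L S f * Θ) (hE : ∀ X, Θ * opE 𝕜 S X = opE 𝕜 S X * Θ) :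
    Θ = 0 := by
  obtain ⟨δ, T, D, hD, rfl⟩ := h
  have hδ : δ = 0 := by
    ext f
    refine opM_injective (𝕜 := 𝕜) (L := L) FS ?_
    rw [← DerEnd.altC_opM T D, hM, sub_self]
  subst hδ
  have hT (ξ : Dual R L) : T ξ = 0 := by
    ext X
    have h1 := DerEnd.altC_opI T D ξ
    refine opM_injective (𝕜 := 𝕜) (L := L) FS ?_
    rw [← opI_opE, ← h1]
    -- The Jacobi identity for `Θ`, `i_ξ` and `X ∧`: the anticommutator of `i_{Tξ} = [Θ, i_ξ]` with
    -- `X ∧`, which is `(T ξ)(X)`, is expressed through commutators that vanish by hypothesis.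
    have e1 : (T.altC D * opI 𝕜 S ξ - opI 𝕜 S ξ * T.altC D) * opE 𝕜 S X +
        opE 𝕜 S X * (T.altC D * opI 𝕜 S ξ - opI 𝕜 S ξ * T.altC D) =
        T.altC D * (opI 𝕜 S ξ * opE 𝕜 S X + opE 𝕜 S X * opI 𝕜 S ξ) -
          (opI 𝕜 S ξ * opE 𝕜 S X + opE 𝕜 S X * opI 𝕜 S ξ) * T.altC D -
          (T.altC D * opE 𝕜 S X - opE 𝕜 S X * T.altC D) * opI 𝕜 S ξ +
          opI 𝕜 S ξ * (opE 𝕜 S X * T.altC D - T.altC D * opE 𝕜 S X) := by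
      simp only [mul_add, add_mul, mul_sub, sub_mul, mul_assoc]
      abel
    rw [e1, opI_opE, hM, hE]
    simp
  have hDz (s : S) : D s = 0 := by
    refine IsSquareRoot.unique FS hD
      (D' := DerEnd.ofLinear (𝕜 := 𝕜) (0 : S →ₗ[R] S)) (T' := DerEnd.ofLinear (𝕜 := 𝕜) 0)
      (fun s t => by simp) (fun κ => ?_) s
    refine LinearMap.ext fun Ω => ?_
    rw [DerEnd.detLine_apply]
    have h1 : T.alt (DerEnd.scalar 0) n Ω = 0 := by
      ext v
      rw [DerEnd.alt_apply]
      simp [hT]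
    have h2 : (DerEnd.lieDer (0 : Derivation 𝕜 R R)).alt (DerEnd.scalar 0) m (κ Ω) = 0 := by
      ext v
      rw [DerEnd.alt_apply]
      simp
    rw [h1, h2]
    simp
  refine LinearMap.ext fun Ω => funext fun k => ?_
  ext v
  rw [DerEnd.altC_apply, DerEnd.alt_apply]
  simp [hT, hDz]

end IsSpinDerivation
end SpinDerivations

/-! ### The commutation relations of `d̄_*` and `∂̄` -/

noncomputable section DiracPairs

variable {𝕜 R L S : Type*} [Field 𝕜] [CharZero 𝕜] [CommRing R] [Algebra 𝕜 R]
  [AddCommGroup L] [Module R L] [Module 𝕜 L] [IsScalarTower 𝕜 R L]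
  [AddCommGroup S] [Module R S] [Module 𝕜 S] [IsScalarTower 𝕜 R S] {n m : ℕ}

namespace Spinor

/-- The product `w ⊗ s` of a multivector and a section of `𝒮`. -/
def tensorSection (s : S) : Spinor R L R →ₗ[R] Spinor R L S where
  toFun w k := (LinearMap.toSpanSingleton R S s).compAlternatingMap (w k)
  map_add' w w' := by funext k; ext v; simp
  map_smul' f w := by funext k; ext v; simp

theorem tensorSection_apply (s : S) (w : Spinor R L R) (k : ℕ) (v : Fin k → Dual R L) :
    tensorSection s w k v = w k v • s := rfl

theorem tensorSection_intMul (s : S) (ξ : Dual R L) (w : Spinor R L R) :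
    tensorSection s (intMul ξ w) = intMul ξ (tensorSection s w) := rfl

theorem tensorSection_extMul (s : S) (X : L) (w : Spinor R L R) :
    tensorSection s (extMul X w) = extMul X (tensorSection s w) := by
  rw [extMul_apply, extMul_apply]
  funext k
  induction k generalizing w with
  | zero =>
    rw [Cochain.wedge_zero_degree]
    refine Cochain.ext_zero (η := 0) ?_
    rw [tensorSection_apply, Cochain.wedge_zero_degree]
    simp
  | succ k ih =>
    refine Cochain.ext_succ fun ξ => ?_
    have h (w : Spinor R L R) : Cochain.contract ξ (tensorSection s w) =
        tensorSection s (Cochain.contract ξ w) := rfl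
    rw [h, Cochain.contract_wedge, Cochain.contract_wedge, map_sub, map_smul, Pi.sub_apply,
      Pi.sub_apply, ih, h]

theorem tensorSection_add (s t : S) (w : Spinor R L R) :
    tensorSection (s + t) w = tensorSection s w + tensorSection t w := by
  funext k; ext v; simp [tensorSection_apply]

theorem tensorSection_smul (f : R) (s : S) (w : Spinor R L R) :
    tensorSection (f • s) w = f • tensorSection s w := by
  funext k; ext v; simp [tensorSection_apply, smul_comm f]

theorem tensorSection_sum {ι : Type*} [Fintype ι] (s : ι → S) (w : Spinor R L R) :
    tensorSection (∑ i, s i) w = ∑ i, tensorSection (s i) w := by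
  let a : S →ₗ[R] Spinor R L S :=
    { toFun := fun s => tensorSection s w
      map_add' := fun s t => tensorSection_add s t w
      map_smul' := fun f s => tensorSection_smul f s w }
  exact map_sum a s Finset.univ

theorem altC_tensorSection {δ : Derivation 𝕜 R R} (T : DerEnd δ (Dual R L)) (D : DerEnd δ S)
    (s : S) (w : Spinor R L R) : T.altC D (tensorSection s w) =
      tensorSection s (T.altC (DerEnd.scalar δ) w) + tensorSection (D s) w := by
  funext k
  ext v
  simp only [DerEnd.altC_apply, DerEnd.alt_apply, tensorSection_apply, Pi.add_apply,
    AlternatingMap.add_apply, D.leibniz, DerEnd.scalar_apply, sub_smul, Finset.sum_smul]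
  abel

/-- Both sides agree in degree zero of the target and obey the same rule under contraction: on
spinors this is the commutator with `Y ∧`, where the transpose of the Lie derivative on `A*` is `[X,
·]`. -/
theorem complement_altC {ℒ : LieAlgebroid 𝕜 R L} {ρ : ℒ.Rep (Dual R L [⋀^Fin n]→ₗ[R] S)}
    (F : FrameOfRank R L n) {X : L} {D : DerEnd (ℒ.anchor X) S}
    (hv : ∀ v, ρ.act X v = (ℒ.coad X).alt D n v) (Ω : Spinor R L S) :
    complement n ((ℒ.coad X).altC D Ω) = ρ.lie X (complement n Ω) := by
  funext k
  induction k generalizing Ω with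
  | zero =>
    refine Cochain.ext_zero ?_
    rw [LieAlgebroid.Rep.lie, DerEnd.altC_zero, complement_zero, complement_zero, hv]
    rfl
  | succ k ih =>
    refine Cochain.ext_succ fun Y => ?_
    have h := LinearMap.congr_fun (DerEnd.altC_opE F (ℒ.coad X) D Y) Ω
    change (ℒ.coad X).altC D (extMul Y Ω) - extMul Y ((ℒ.coad X).altC D Ω) =
      extMul ((ℒ.coad X).transpose F Y) Ω at h
    have hb : (ℒ.coad X).transpose F Y = ℒ.bracket X Y := by
      refine sub_eq_zero.1 (F.eq_zero_of_forall fun ξ => ?_)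
      rw [map_sub, DerEnd.apply_transpose, ℒ.coad_apply]
      ring
    rw [hb, sub_eq_iff_eq_add, ← sub_eq_iff_eq_add'] at h
    rw [contract_complement, ← h, LieAlgebroid.Rep.contract_lie, Pi.sub_apply,
      contract_complement, ← ih, contract_complement]
    rw [← complementLin_apply, map_sub]
    rfl

end Spinor

open Spinor

/-- The properties of the pair of operators `d̄_*`, `∂̄` on spinors. -/
structure DiracPair (F : FrameOfRank R L n) (ℒ : LieAlgebroid 𝕜 R L)
    (ℒ' : LieAlgebroid 𝕜 R (Dual R L)) (sq : S ⊗[R] S ≃ₗ[R] DetLine 𝕜 R L n m)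
    (d del : End 𝕜 (Spinor R L S)) : Prop where
  d_sq : d * d = 0
  del_sq : del * del = 0
  d_zero : ∀ Ω, d Ω 0 = 0
  d_degree : ∀ Ω k, Ω k = 0 → d Ω (k + 1) = 0
  del_degree : ∀ Ω k, Ω (k + 1) = 0 → del Ω k = 0
  d_opM : ∀ f, d * opM 𝕜 L S f - opM 𝕜 L S f * d = opE 𝕜 S (F.ofBidual (ℒ'.dFun f))
  del_opM : ∀ f, del * opM 𝕜 L S f - opM 𝕜 L S f * del = opI 𝕜 S (ℒ.dFun f)
  d_opI_spin : ∀ ξ, IsSpinDerivation sq (d * opI 𝕜 S ξ + opI 𝕜 S ξ * d)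
  d_opI_opI : ∀ ξ η, (d * opI 𝕜 S ξ + opI 𝕜 S ξ * d) * opI 𝕜 S η -
    opI 𝕜 S η * (d * opI 𝕜 S ξ + opI 𝕜 S ξ * d) = opI 𝕜 S (ℒ'.bracket ξ η)
  d_opI_opE : ∀ ξ X, (d * opI 𝕜 S ξ + opI 𝕜 S ξ * d) * opE 𝕜 S X -
    opE 𝕜 S X * (d * opI 𝕜 S ξ + opI 𝕜 S ξ * d) = opE 𝕜 S ((ℒ'.ad ξ).transpose F X)
  del_opE_spin : ∀ X, IsSpinDerivation sq (del * opE 𝕜 S X + opE 𝕜 S X * del)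
  del_opE_opM : ∀ X f, (del * opE 𝕜 S X + opE 𝕜 S X * del) * opM 𝕜 L S f -
    opM 𝕜 L S f * (del * opE 𝕜 S X + opE 𝕜 S X * del) = opM 𝕜 L S (ℒ.anchor X f)
  del_opE_opE : ∀ X Y, (del * opE 𝕜 S X + opE 𝕜 S X * del) * opE 𝕜 S Y -
    opE 𝕜 S Y * (del * opE 𝕜 S X + opE 𝕜 S X * del) = opE 𝕜 S (ℒ.bracket X Y)
  del_opE_opI : ∀ X ξ, (del * opE 𝕜 S X + opE 𝕜 S X * del) * opI 𝕜 S ξ -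
    opI 𝕜 S ξ * (del * opE 𝕜 S X + opE 𝕜 S X * del) = opI 𝕜 S (ℒ.coad X ξ)
  d_tensorSection : ∃ a : F.ι → S → S, ∀ s w, d (tensorSection s w) =
    tensorSection s (ℒ'.trivialRep.differential w) +
      ∑ i, opE 𝕜 S (F.vec i) (tensorSection (a i s) w)
  del_tensorSection : ∀ X, ∃ a : S → S, ∀ s w,
    (del * opE 𝕜 S X + opE 𝕜 S X * del : End 𝕜 (Spinor R L S)) (tensorSection s w) =
      tensorSection s (ℒ.lieMulti X w) + tensorSection (a s) w

namespace LieAlgebroid.Rep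

variable {ℒ : LieAlgebroid 𝕜 R L} {ℒ' : LieAlgebroid 𝕜 R (Dual R L)}

theorem differential_opI (ρ : ℒ'.Rep S) (ξ : Dual R L) :
    ρ.differential * opI 𝕜 S ξ + opI 𝕜 S ξ * ρ.differential = (ℒ'.ad ξ).altC (ρ.act ξ) :=
  LinearMap.ext fun Ω => by
    change ρ.differential (Cochain.contract ξ Ω) + Cochain.contract ξ (ρ.differential Ω) =
      ρ.lie ξ Ω
    rw [contract_differential, add_sub_cancel]

/-- The sum over the frame represents `ξ ↦ ξ · s`, a section of `A ⊗ 𝒮`. It is the only term that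
sees the action on `𝒮`, and it will cancel in graded commutators with exterior multiplications. -/
theorem differential_tensorSection (F : FrameOfRank R L n) (ρ : ℒ'.Rep S) (s : S)
    (w : Spinor R L R) : ρ.differential (tensorSection s w) =
    tensorSection s (ℒ'.trivialRep.differential w) +
      ∑ i, extMul (F.vec i) (tensorSection (ρ.act (F.coord i) s) w) := by
  funext k
  induction k generalizing w with
  | zero =>
    have h (i : F.ι) : extMul (F.vec i) (tensorSection (ρ.act (F.coord i) s) w) 0 = 0 := rfl
    rw [differential_zero, Pi.add_apply, Finset.sum_apply]
    simp only [h, Finset.sum_const_zero, add_zero]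
    refine Cochain.ext_zero (Ω := 0) ?_
    rw [tensorSection_apply, differential_zero]
    simp
  | succ k ih =>
    refine Cochain.ext_succ fun ξ => ?_
    have h {s : S} (w : Spinor R L R) : Cochain.contract ξ (tensorSection s w) =
        tensorSection s (Cochain.contract ξ w) := rfl
    have hact : ∑ i, ξ (F.vec i) • ρ.act (F.coord i) s = ρ.act ξ s := by
      let a : Dual R L →ₗ[R] S :=
        { toFun := fun ξ => ρ.act ξ s
          map_add' := fun ξ η => ρ.act_add ξ η s
          map_smul' := fun f ξ => ρ.act_smul f ξ s }
      conv_rhs => rw [← F.sum_apply_smul_coord ξ]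
      exact (by simp : ∑ i, ξ (F.vec i) • a (F.coord i) = a (∑ i, ξ (F.vec i) • F.coord i))
    have hsum : Cochain.contract ξ
        (∑ i, extMul (F.vec i) (tensorSection (ρ.act (F.coord i) s) w)) =
        tensorSection (ρ.act ξ s) w -
          ∑ i, extMul (F.vec i) (tensorSection (ρ.act (F.coord i) s) (Cochain.contract ξ w)) := by
      rw [map_sum, ← hact, tensorSection_sum, ← Finset.sum_sub_distrib]
      refine Finset.sum_congr rfl fun i _ => ?_
      rw [extMul_apply, extMul_apply, Cochain.contract_wedge, h, tensorSection_smul]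
      rfl
    rw [contract_differential, h, map_add, h, contract_differential, hsum, lie, lie,
      altC_tensorSection, Pi.sub_apply, ih, map_sub]
    simp only [Pi.add_apply, Pi.sub_apply]
    change _ = tensorSection s ((ℒ'.ad ξ).altC (DerEnd.scalar _) w) k - _ + _
    abel

end LieAlgebroid.Rep

/-- Cartan's formula for `A*` identifies the anticommutator of `d̄_*` with `i_ξ` as a Lie
derivative. Cartan's formula for `A`, carried over by `complement`, does the same for `∂̄` and `X
∧`. By definition of the two module structures both Lie derivatives are spin derivations; the other
relations follow from the product rule. -/
theorem diracPair_differential (F : FrameOfRank R L n)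
    {ℒ : LieAlgebroid 𝕜 R L} {ℒ' : LieAlgebroid 𝕜 R (Dual R L)}
    {sq : S ⊗[R] S ≃ₗ[R] DetLine 𝕜 R L n m} {ρ' : ℒ'.Rep S}
    {ρ : ℒ.Rep (Dual R L [⋀^Fin n]→ₗ[R] S)} (hρ' : IsDualAction ℒ' sq ρ')
    (hρ : IsComplementAction ℒ sq ρ) {del : End 𝕜 (Spinor R L S)}
    (hdel : ∀ Ω, complement n (del Ω) = ρ.differential (complement n Ω)) :
    DiracPair F ℒ ℒ' sq ρ'.differential del := by
  choose D hD hDv using hρ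
  have hcd : ∀ X, del * opE 𝕜 S X + opE 𝕜 S X * del = (ℒ.coad X).altC (D X) := fun X =>
    LinearMap.ext fun Ω => by
      change del (extMul X Ω) + extMul X (del Ω) = (ℒ.coad X).altC (D X) Ω
      refine complement_injective 𝕜 F ?_
      rw [complement_altC F (hDv X), complement_add, hdel, ← contract_complement,
        ← contract_complement, hdel, LieAlgebroid.Rep.contract_differential, add_sub_cancel]
  have hdeg (Ω : Spinor R L S) (k : ℕ) (h : Ω (k + 1) = 0) : del Ω k = 0 := by
    rcases lt_trichotomy k n with hk | hk | hk
    · rw [← Nat.sub_sub_self hk.le]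
      refine eq_zero_of_complement 𝕜 F (Nat.sub_le n k) ?_
      obtain ⟨j, hj⟩ : ∃ j, n - k = j + 1 := ⟨n - k - 1, by omega⟩
      rw [hdel, hj]
      have h0 : complement n Ω j = (0 : Cochain R L (Dual R L [⋀^Fin n]→ₗ[R] S)) j :=
        complement_eq_zero 𝕜 F (by rw [show n - j = k + 1 by omega, h])
      rw [LieAlgebroid.Rep.differential_congr _ h0, map_zero]
      rfl
    · subst hk
      rw [← complement_zero (n := k) (del Ω), hdel]
      rfl
    · exact F.dual.alternatingMap_eq_zero 𝕜 hk _
  have hdelM (f : R) : del * opM 𝕜 L S f - opM 𝕜 L S f * del = opI 𝕜 S (ℒ.dFun f) := by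
    rw [← sub_eq_zero]
    -- The difference anticommutes with every `X ∧`, since `[L_X, f] = a(X) f = (d f)(X)`, and it
    -- has no component of degree `n`, because all operators involved lower the degree.
    refine op_eq_zero_of_ext F (fun X => Or.inr ?_) fun Ω => ?_
    · have h1 := DerEnd.altC_opM (ℒ.coad X) (D X) f
      rw [← hcd] at h1
      have h2 := opI_opE (𝕜 := 𝕜) (S := S) (ℒ.dFun f) X
      have h3 : opM 𝕜 L S (ℒ.dFun f X) = opM 𝕜 L S (ℒ.anchor X f) := rfl
      have h4 : opE 𝕜 S X * (del * opM 𝕜 L S f - opM 𝕜 L S f * del - opI 𝕜 S (ℒ.dFun f)) +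
          (del * opM 𝕜 L S f - opM 𝕜 L S f * del - opI 𝕜 S (ℒ.dFun f)) * opE 𝕜 S X =
        ((del * opE 𝕜 S X + opE 𝕜 S X * del) * opM 𝕜 L S f -
          opM 𝕜 L S f * (del * opE 𝕜 S X + opE 𝕜 S X * del)) -
          (opI 𝕜 S (ℒ.dFun f) * opE 𝕜 S X + opE 𝕜 S X * opI 𝕜 S (ℒ.dFun f)) +
          (opM 𝕜 L S f * opE 𝕜 S X - opE 𝕜 S X * opM 𝕜 L S f) * del +
          del * (opM 𝕜 L S f * opE 𝕜 S X - opE 𝕜 S X * opM 𝕜 L S f) := by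
        simp only [mul_add, add_mul, mul_sub, sub_mul, mul_assoc]
        abel
      rw [h4, h1, h2, h3, opM_opE]
      simp
    · change del (f • Ω) n - f • del Ω n - Cochain.contract (ℒ.dFun f) Ω n = 0
      have ht (Ω : Spinor R L S) : del Ω n = 0 :=
        hdeg Ω n (F.dual.alternatingMap_eq_zero 𝕜 (Nat.lt_succ_self n) _)
      rw [ht, ht]
      change 0 - f • 0 - AlternatingMap.curryLeft (Ω (n + 1)) (ℒ.dFun f) = 0
      rw [F.dual.alternatingMap_eq_zero 𝕜 (Nat.lt_succ_self n) (Ω (n + 1)),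
        AlternatingMap.curryLeft_zero]
      simp
  refine
    { d_sq := LinearMap.ext fun Ω => ρ'.differential_differential Ω
      del_sq := LinearMap.ext fun Ω => ?_
      d_zero := fun Ω => rfl
      d_degree := fun Ω k h => ?_
      del_degree := hdeg
      d_opM := fun f => LinearMap.ext fun Ω => ?_
      del_opM := hdelM
      d_opI_spin := fun ξ => ⟨_, _, _, hρ' ξ, ρ'.differential_opI ξ⟩
      d_opI_opI := fun ξ η => ?_
      d_opI_opE := fun ξ X => ?_
      del_opE_spin := fun X => ⟨_, _, _, hD X, hcd X⟩
      del_opE_opM := fun X f => ?_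
      del_opE_opE := fun X Y => ?_
      del_opE_opI := fun X ξ => ?_
      d_tensorSection := ⟨fun i s => ρ'.act (F.coord i) s,
        fun s w => ρ'.differential_tensorSection F s w⟩
      del_tensorSection := fun X => ⟨fun s => D X s, fun s w => ?_⟩ }
  · change del (del Ω) = 0
    refine complement_injective 𝕜 F ?_
    rw [hdel, hdel, LieAlgebroid.Rep.differential_differential]
    exact (map_zero (complementLin n)).symm
  · rw [ρ'.differential_congr (η := 0) h, map_zero]
    rfl
  · change ρ'.differential (f • Ω) - f • ρ'.differential Ω =
      Cochain.wedge (Dual.eval R L (F.ofBidual (ℒ'.dFun f))) Ω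
    rw [ρ'.differential_smul, F.eval_ofBidual, add_sub_cancel_right]
  · rw [ρ'.differential_opI, DerEnd.altC_opI]; rfl
  · rw [ρ'.differential_opI, DerEnd.altC_opE F]
  · rw [hcd, DerEnd.altC_opM]
  · rw [hcd, DerEnd.altC_opE F]
    congr 1
    refine sub_eq_zero.1 (F.eq_zero_of_forall fun ξ => ?_)
    rw [map_sub, DerEnd.apply_transpose, ℒ.coad_apply]
    ring
  · rw [hcd, DerEnd.altC_opI]
  · rw [hcd, altC_tensorSection]
    rfl

end DiracPairs

/-! ### Graded Jacobi identities in an associative ring -/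

section RingIdentities

variable {A : Type*} [Ring A]

/-- The Jacobi identity `[{d, e}, i] = [d, {i, e}] - [{d, i}, e]`. It transfers information from one
kind of Clifford element to the other: known relations of `d̄_*` with `i_ξ` yield those with `X ∧`,
and likewise for `∂̄`. -/
theorem anticomm_comm_eq_sub {d e i p r l : A} (h1 : i * e + e * i = p) (h2 : d * p - p * d = r)
    (h3 : (d * i + i * d) * e - e * (d * i + i * d) = l) :
    (d * e + e * d) * i - i * (d * e + e * d) = r - l := by
  subst h1 h2 h3; noncomm_ring

theorem comm_anticomm_of_comm {d e p r : A} (h1 : p * e = e * p) (h2 : d * p - p * d = r)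
    (h3 : r * e + e * r = 0) : (d * e + e * d) * p - p * (d * e + e * d) = 0 := by
  rw [← h3, ← h2]
  have : (d * e + e * d) * p - p * (d * e + e * d) -
    ((d * p - p * d) * e + e * (d * p - p * d)) = (e * p - p * e) * d - d * (p * e - e * p) := by
    noncomm_ring
  rw [h1, sub_self, zero_mul, mul_zero, sub_zero, sub_eq_zero] at this
  exact this

/-- If `x` and `y` anticommute, applying the derivation `[w, ·]` to `{x, y} = 0` makes `{[w, x], y}`
antisymmetric in `x` and `y`. -/
theorem anticomm_add_eq_zero {w x y a b p q : A} (hxy : x * y = -(y * x))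
    (hx : w * x - x * w = a) (hy : w * y - y * w = b) (hp : a * y + y * a = p)
    (hq : b * x + x * b = q) : p + q = 0 := by
  subst hx hy hp hq
  have : (w * x - x * w) * y + y * (w * x - x * w) + ((w * y - y * w) * x + x * (w * y - y * w)) =
    w * (x * y + y * x) - (x * y + y * x) * w := by noncomm_ring
  rw [this, hxy]; simp

theorem comm_comm_eq {v i e p c : A} (hp : i * e + e * i = p) (hv : v * p - p * v = 0)
    (hc : v * e - e * v = c) (hi : i * c + c * i = 0) :
    e * (v * i - i * v) + (v * i - i * v) * e = 0 := by
  have : e * (v * i - i * v) + (v * i - i * v) * e =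
    (v * (i * e + e * i) - (i * e + e * i) * v) - (i * (v * e - e * v) + (v * e - e * v) * i) := by
    noncomm_ring
  rw [this, hp, hc, hv, hi, sub_zero]

theorem laplacian_comm {d b p r q : A} (h1 : d * p - p * d = r) (h2 : b * p - p * b = q) :
    (d * b + b * d) * p - p * (d * b + b * d) = (d * q + q * d) + (b * r + r * b) := by
  subst h1 h2; noncomm_ring

/-- First `[{d, b}, e] = [d, {b, e}] + [b, {d, e}]`, then the Jacobi identity for each term with
`i`. Applied to `Q`, `X ∧` and `i_ξ` it writes `[[Q, X], ξ]` as a sum of operators each of which is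
a spin derivation. -/
theorem laplacian_comm_anticomm {d b e i w c : A}
    (hc : (b * e + e * b) * i - i * (b * e + e * b) = c)
    (hw : (d * e + e * d) * i - i * (d * e + e * d) = w) :
    ((d * b + b * d) * e - e * (d * b + b * d)) * i +
      i * ((d * b + b * d) * e - e * (d * b + b * d)) =
    ((d * i + i * d) * (b * e + e * b) - (b * e + e * b) * (d * i + i * d)) + (d * c + c * d) +
      (((b * i + i * b) * (d * e + e * d) - (d * e + e * d) * (b * i + i * b)) +
        (b * w + w * b)) := by
  subst hc hw; noncomm_ring

theorem anticomm_mul_comm {z i p : A} (h1 : z * p - p * z = 0) (h2 : p * i = i * p) :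
    (z * i + i * z) * p = p * (z * i + i * z) := by
  rw [sub_eq_zero] at h1
  rw [add_mul, mul_add, mul_assoc, ← h2, ← mul_assoc, h1, mul_assoc, mul_assoc, h1, ← mul_assoc i,
    ← h2, mul_assoc]

theorem anticomm_mul_comm' {z i e p : A} (hp : i * e + e * i = p) (h1 : z * p - p * z = 0)
    (h2 : z * e + e * z = 0) : (z * i + i * z) * e = e * (z * i + i * z) := by
  rw [← sub_eq_zero]
  have : (z * i + i * z) * e - e * (z * i + i * z) =
    (z * (i * e + e * i) - (i * e + e * i) * z) + (i * (z * e + e * z) - (z * e + e * z) * i) := by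
    noncomm_ring
  rw [this, hp, h1, h2]; simp

theorem add_mul_self_of_sq {d b : A} (hd : d * d = 0) (hb : b * b = 0) :
    (d + b) * (d + b) = d * b + b * d := by
  rw [add_mul, mul_add, mul_add, hd, hb, zero_add, add_zero]

theorem comm_mul_eq {v x y a b : A} (hx : v * x - x * v = a) (hy : v * y - y * v = b) :
    v * (x * y) - x * y * v = a * y + x * b := by
  subst hx hy; noncomm_ring

theorem comm_mul_eq' {i x y p q : A} (hx : i * x + x * i = p) (hy : i * y + y * i = q) :
    i * (x * y) - x * y * i = p * y - x * q := by
  subst hx hy; noncomm_ring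

/-- `[[d + b, e + i], e' + i']` has eight components. Two vanish, and the others are collected into
the exterior part and the interior part of the resulting Clifford element. -/
theorem derived_bracket {d b e e' i i' a1 a2 a3 a4 a5 a6 : A}
    (h1 : (d * e + e * d) * e' - e' * (d * e + e * d) = 0)
    (h2 : (d * e + e * d) * i' - i' * (d * e + e * d) = a1)
    (h3 : (d * i + i * d) * e' - e' * (d * i + i * d) = a2)
    (h4 : (d * i + i * d) * i' - i' * (d * i + i * d) = a3)
    (h5 : (b * e + e * b) * e' - e' * (b * e + e * b) = a4)
    (h6 : (b * e + e * b) * i' - i' * (b * e + e * b) = a5)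
    (h7 : (b * i + i * b) * e' - e' * (b * i + i * b) = a6)
    (h8 : (b * i + i * b) * i' - i' * (b * i + i * b) = 0) :
    ((d + b) * ((e + i) * (e' + i')) + (e + i) * ((d + b) * (e' + i'))) -
      (e' + i') * ((d + b) * (e + i) + (e + i) * (d + b)) =
    (a1 + a2 + a4) + (a3 + a5 + a6) := by
  rw [← h2, ← h3, ← h4, ← h5, ← h6, ← h7, ← sub_eq_zero]
  have : ((d + b) * ((e + i) * (e' + i')) + (e + i) * ((d + b) * (e' + i'))) -
      (e' + i') * ((d + b) * (e + i) + (e + i) * (d + b)) -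
    (((d * e + e * d) * i' - i' * (d * e + e * d) +
      ((d * i + i * d) * e' - e' * (d * i + i * d)) +
      ((b * e + e * b) * e' - e' * (b * e + e * b))) +
    ((d * i + i * d) * i' - i' * (d * i + i * d) +
      ((b * e + e * b) * i' - i' * (b * e + e * b)) +
      ((b * i + i * b) * e' - e' * (b * i + i * b)))) =
    ((d * e + e * d) * e' - e' * (d * e + e * d)) +
      ((b * i + i * b) * i' - i' * (b * i + i * b)) := by noncomm_ring
  rw [this, h1, h8, add_zero]

theorem commute_add_half_smul {𝕜 : Type*} [Field 𝕜] [CharZero 𝕜] [Algebra 𝕜 A] {w i b a : A}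
    (h1 : w * i - i * w = a) (h2 : i * b - b * i = (2 : 𝕜) • a) :
    i * (w + (2⁻¹ : 𝕜) • b) = (w + (2⁻¹ : 𝕜) • b) * i := by
  rw [← sub_eq_zero, mul_add, add_mul, add_sub_add_comm, ← neg_sub, h1, mul_smul_comm,
    smul_mul_assoc, ← smul_sub, h2, smul_smul, inv_mul_cancel₀ two_ne_zero, one_smul]
  exact neg_add_cancel _

end RingIdentities

/-! ### Exterior multiplication by `d_* X` -/

noncomputable section DiracPairs

variable {𝕜 R L S : Type*} [Field 𝕜] [CharZero 𝕜] [CommRing R] [Algebra 𝕜 R]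
  [AddCommGroup L] [Module R L] [Module 𝕜 L] [IsScalarTower 𝕜 R L]
  [AddCommGroup S] [Module R S] [Module 𝕜 S] [IsScalarTower 𝕜 R S] {n m : ℕ}

open Spinor

namespace DiracPair

variable {F : FrameOfRank R L n} {ℒ : LieAlgebroid 𝕜 R L} {ℒ' : LieAlgebroid 𝕜 R (Dual R L)}
  {sq : S ⊗[R] S ≃ₗ[R] DetLine 𝕜 R L n m} {d del : End 𝕜 (Spinor R L S)}

/-- The section on the right is `-i_ξ (d_* X)`, in a form available before the anticommutator of
`d̄_*` with `X ∧` is recognised as multiplication by a bivector. -/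
theorem d_opE_opI (h : DiracPair F ℒ ℒ' sq d del) (X : L) (ξ : Dual R L) :
    (d * opE 𝕜 S X + opE 𝕜 S X * d) * opI 𝕜 S ξ - opI 𝕜 S ξ * (d * opE 𝕜 S X + opE 𝕜 S X * d) =
      opE 𝕜 S (F.ofBidual (ℒ'.dFun (ξ X)) - (ℒ'.ad ξ).transpose F X) := by
  rw [opE_sub]
  exact anticomm_comm_eq_sub (opI_opE ξ X) (h.d_opM _) (h.d_opI_opE ξ X)

theorem del_opI_opE (h : DiracPair F ℒ ℒ' sq d del) (ξ : Dual R L) (X : L) :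
    (del * opI 𝕜 S ξ + opI 𝕜 S ξ * del) * opE 𝕜 S X -
      opE 𝕜 S X * (del * opI 𝕜 S ξ + opI 𝕜 S ξ * del) =
      opI 𝕜 S (ℒ.dFun (ξ X) - ℒ.coad X ξ) := by
  rw [opI_sub]
  exact anticomm_comm_eq_sub ((add_comm _ _).trans (opI_opE ξ X)) (h.del_opM _)
    (h.del_opE_opI X ξ)

theorem del_opI_opM (h : DiracPair F ℒ ℒ' sq d del) (ξ : Dual R L) (f : R) :
    (del * opI 𝕜 S ξ + opI 𝕜 S ξ * del) * opM 𝕜 L S f -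
      opM 𝕜 L S f * (del * opI 𝕜 S ξ + opI 𝕜 S ξ * del) = 0 :=
  comm_anticomm_of_comm (opM_opI f ξ) (h.del_opM f) (by rw [opI_anticomm]; exact neg_add_cancel _)

theorem del_top (h : DiracPair F ℒ ℒ' sq d del) (Ω : Spinor R L S) : del Ω n = 0 :=
  h.del_degree Ω n (F.dual.alternatingMap_eq_zero 𝕜 (Nat.lt_succ_self n) _)

theorem _root_.Spinor.opI_top (F : FrameOfRank R L n) (ξ : Dual R L) (Ω : Spinor R L S) :
    opI 𝕜 S ξ Ω n = 0 := by
  change AlternatingMap.curryLeft (Ω (n + 1)) ξ = 0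
  rw [F.dual.alternatingMap_eq_zero 𝕜 (Nat.lt_succ_self n) (Ω (n + 1)),
    AlternatingMap.curryLeft_zero, LinearMap.zero_apply]

/-- Dual to the commutation of `d_* X ∧` with `Y ∧`, but no explicit formula is needed: the operator
anticommutes with exterior multiplications and vanishes in degree `n`. -/
theorem del_opI_opI (h : DiracPair F ℒ ℒ' sq d del) (ξ η : Dual R L) :
    (del * opI 𝕜 S ξ + opI 𝕜 S ξ * del) * opI 𝕜 S η -
      opI 𝕜 S η * (del * opI 𝕜 S ξ + opI 𝕜 S ξ * del) = 0 := by
  refine op_eq_zero_of_ext F (fun X => Or.inr ?_) fun Ω => ?_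
  · exact comm_comm_eq (opI_opE η X) (h.del_opI_opM ξ _) (h.del_opI_opE ξ X)
      (by rw [opI_anticomm]; exact neg_add_cancel _)
  · change del (opI 𝕜 S ξ (opI 𝕜 S η Ω)) n + opI 𝕜 S ξ (del (opI 𝕜 S η Ω)) n -
      opI 𝕜 S η (del (opI 𝕜 S ξ Ω) + opI 𝕜 S ξ (del Ω)) n = 0
    rw [h.del_top, opI_top F, opI_top F]
    simp

theorem apply_antisymm (h : DiracPair F ℒ ℒ' sq d del) (FS : FrameOfRank R S 1) (X : L)
    (ξ η : Dual R L) : ξ (F.ofBidual (ℒ'.dFun (η X)) - (ℒ'.ad η).transpose F X) =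
      -η (F.ofBidual (ℒ'.dFun (ξ X)) - (ℒ'.ad ξ).transpose F X) := by
  rw [eq_neg_iff_add_eq_zero]
  refine opM_injective (𝕜 := 𝕜) (L := L) FS ?_
  rw [opM_add]
  exact anticomm_add_eq_zero (opI_anticomm η ξ) (h.d_opE_opI X η) (h.d_opE_opI X ξ)
    ((add_comm _ _).trans (opI_opE _ _)) ((add_comm _ _).trans (opI_opE _ _))

theorem apply_antisymm' (h : DiracPair F ℒ ℒ' sq d del) (FS : FrameOfRank R S 1) (ξ : Dual R L)
    (X Y : L) : (ℒ.dFun (ξ X) - ℒ.coad X ξ) Y + (ℒ.dFun (ξ Y) - ℒ.coad Y ξ) X = 0 := by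
  refine opM_injective (𝕜 := 𝕜) (L := L) FS ?_
  rw [opM_add]
  exact anticomm_add_eq_zero (opE_anticomm X Y) (h.del_opI_opE ξ X) (h.del_opI_opE ξ Y)
    (opI_opE _ _) (opI_opE _ _)

/-- Exterior multiplication by the bivector `d_* X`. -/
theorem d_opE (h : DiracPair F ℒ ℒ' sq d del) (FS : FrameOfRank R S 1) (X : L) :
    d * opE 𝕜 S X + opE 𝕜 S X * d = -((2⁻¹ : 𝕜) • ∑ i, opE 𝕜 S (F.vec i) *
      opE 𝕜 S (F.ofBidual (ℒ'.dFun (F.coord i X)) - (ℒ'.ad (F.coord i)).transpose F X)) := by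
  set w : Dual R L → L := fun ξ => F.ofBidual (ℒ'.dFun (ξ X)) - (ℒ'.ad ξ).transpose F X with hw
  have hanti (ξ η : Dual R L) : ξ (w η) = -η (w ξ) := h.apply_antisymm FS X ξ η
  have h1 (ξ : Dual R L) : ∑ i, ξ (F.vec i) • w (F.coord i) = w ξ := by
    refine sub_eq_zero.1 (F.eq_zero_of_forall fun η => ?_)
    simp only [map_sub, map_sum, map_smul, smul_eq_mul, hanti η]
    have := congrArg ξ (F.sum_smul (w η))
    simp only [map_sum, map_smul, smul_eq_mul] at this
    simp only [mul_neg, Finset.sum_neg_distrib, ← this, mul_comm]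
    ring
  have h2 (ξ : Dual R L) : ∑ i, ξ (w (F.coord i)) • F.vec i = -w ξ := by
    simp only [hanti ξ, neg_smul, Finset.sum_neg_distrib, F.sum_smul]
  rw [← sub_eq_zero, sub_neg_eq_add]
  -- Contraction meets each of the two factors of the bivector once, and by the antisymmetry of `w`
  -- both give `w ξ`; hence the factor `½` in the formula.
  have hI (ξ : Dual R L) : opI 𝕜 S ξ * (∑ i, opE 𝕜 S (F.vec i) * opE 𝕜 S (w (F.coord i))) -
      (∑ i, opE 𝕜 S (F.vec i) * opE 𝕜 S (w (F.coord i))) * opI 𝕜 S ξ = (2 : 𝕜) • opE 𝕜 S (w ξ) := by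
    rw [Finset.mul_sum, Finset.sum_mul, ← Finset.sum_sub_distrib]
    have (i : F.ι) : opI 𝕜 S ξ * (opE 𝕜 S (F.vec i) * opE 𝕜 S (w (F.coord i))) -
        opE 𝕜 S (F.vec i) * opE 𝕜 S (w (F.coord i)) * opI 𝕜 S ξ =
        opE 𝕜 S (ξ (F.vec i) • w (F.coord i)) - opE 𝕜 S (ξ (w (F.coord i)) • F.vec i) := by
      rw [opE_smul, opE_smul, comm_mul_eq' (opI_opE ξ _) (opI_opE ξ _), opM_opE _ (F.vec i)]
    rw [Finset.sum_congr rfl fun i _ => this i, Finset.sum_sub_distrib, ← opE_sum, ← opE_sum, h1,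
      h2, ← opE_sub, sub_neg_eq_add, opE_add, two_smul]
  -- The two sides have the same commutators with contractions, and neither has a component of
  -- degree zero.
  refine op_eq_zero_of_int (fun ξ => Or.inl ?_) fun Ω => ?_
  · exact commute_add_half_smul (h.d_opE_opI X ξ) (hI ξ)
  · change d (opE 𝕜 S X Ω) 0 + opE 𝕜 S X (d Ω) 0 +
      ((2⁻¹ : 𝕜) • ∑ i, opE 𝕜 S (F.vec i) * opE 𝕜 S (w (F.coord i)) :
        End 𝕜 (Spinor R L S)) Ω 0 = 0
    have h0 (i : F.ι) : (opE 𝕜 S (F.vec i) * opE 𝕜 S (w (F.coord i)) :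
        End 𝕜 (Spinor R L S)) Ω 0 = 0 := rfl
    rw [h.d_zero, LinearMap.smul_apply, LinearMap.sum_apply, Pi.smul_apply, Finset.sum_apply]
    simp only [h0, Finset.sum_const_zero, smul_zero, zero_add, add_zero]
    rfl

end DiracPair
end DiracPairs

/-! ### Commutators with sums of products -/

section RingIdentities

theorem commute_mul_of_anticomm {A : Type*} [Ring A] {x y e : A} (hx : x * e = -(e * x))
    (hy : y * e = -(e * y)) : Commute (x * y) e := by
  change x * y * e = e * (x * y)
  rw [mul_assoc, hy, mul_neg, ← mul_assoc, hx, neg_mul, neg_neg, mul_assoc]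

theorem commute_neg_smul_sum {𝕜 A ι : Type*} [Field 𝕜] [Ring A] [Algebra 𝕜 A] {c : 𝕜} {s : Finset ι}
    {x : ι → A} {e : A} (h : ∀ i ∈ s, Commute (x i) e) : Commute (-(c • ∑ i ∈ s, x i)) e :=
  ((Commute.sum_left s _ _ h).smul_left c).neg_left

theorem comm_neg_smul_sum {𝕜 A ι : Type*} [Field 𝕜] [Ring A] [Algebra 𝕜 A] {c : 𝕜} {s : Finset ι}
    {x y : ι → A} {v : A} (h : ∀ i ∈ s, v * x i - x i * v = y i) :
    v * (-(c • ∑ i ∈ s, x i)) - (-(c • ∑ i ∈ s, x i)) * v = -(c • ∑ i ∈ s, y i) := by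
  rw [← Finset.sum_congr rfl h, Finset.sum_sub_distrib, mul_neg, neg_mul, mul_smul_comm,
    smul_mul_assoc, Finset.mul_sum, Finset.sum_mul, smul_sub]
  abel

/-- Normal ordering `i e = p - e i`. Because the scalars `p` and `p'` are opposite, they split into
the halves required by the action of `𝔤𝔩(A)` on half-densities, and no scalar is left over. -/
theorem anticomm_halves {𝕜 A : Type*} [Field 𝕜] [CharZero 𝕜] [Ring A] [Algebra 𝕜 A]
    {i e i' e' p p' : A} (h : i * e + e * i = p) (hp : p + p' = 0) :
    i * e + e' * i' = (e' * i' - (2⁻¹ : 𝕜) • p') - (e * i - (2⁻¹ : 𝕜) • p) := by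
  rw [← eq_neg_iff_add_eq_zero] at hp
  have h2 : p' = -p := by rw [hp, neg_neg]
  have h3 : (2⁻¹ : 𝕜) • p + (2⁻¹ : 𝕜) • p = p := by
    rw [← add_smul, ← two_mul, mul_inv_cancel₀ two_ne_zero, one_smul]
  rw [h2, smul_neg, sub_neg_eq_add, eq_sub_of_add_eq h]
  conv_lhs => rw [← h3]
  abel

end RingIdentities

/-! ### Dirac generating operators and the square of `Ð` -/

noncomputable section DiracPairs

variable {𝕜 R L S : Type*} [Field 𝕜] [CharZero 𝕜] [CommRing R] [Algebra 𝕜 R]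
  [AddCommGroup L] [Module R L] [Module 𝕜 L] [IsScalarTower 𝕜 R L]
  [AddCommGroup S] [Module R S] [Module 𝕜 S] [IsScalarTower 𝕜 R S] {n m : ℕ}

open Spinor

theorem IsSpinDerivation.sum {sq : S ⊗[R] S ≃ₗ[R] DetLine 𝕜 R L n m} (F : FrameOfRank R L n)
    (hm : ∀ Ω : Derivation 𝕜 R R [⋀^Fin (m + 1)]→ₗ[R] R, Ω = 0) {ι : Type*} (s : Finset ι)
    {Θ : ι → End 𝕜 (Spinor R L S)} (h : ∀ i ∈ s, IsSpinDerivation sq (Θ i)) :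
    IsSpinDerivation sq (∑ i ∈ s, Θ i) := by
  refine Finset.sum_induction _ (IsSpinDerivation sq) (fun _ _ h h' => h.add h') ?_ h
  have h0 := IsSpinDerivation.opE_opI F hm sq 0 0
  rw [← sub_self]
  exact h0.sub h0

theorem Spinor.spinModule_ι (X : L) (ξ : Dual R L) (Ω : Spinor R L S) :
    spinModule 𝕜 R L S (CliffordAlgebra.ι (pairingForm 𝕜 R L) (X, ξ)) Ω =
      (opE 𝕜 S X + opI 𝕜 S ξ : End 𝕜 (Spinor R L S)) Ω := by
  rw [spinModule, CliffordAlgebra.lift_ι_apply]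
  rfl

namespace DiracPair

variable {F : FrameOfRank R L n} {ℒ : LieAlgebroid 𝕜 R L} {ℒ' : LieAlgebroid 𝕜 R (Dual R L)}
  {sq : S ⊗[R] S ≃ₗ[R] DetLine 𝕜 R L n m} {d del : End 𝕜 (Spinor R L S)}

theorem d_opE_commute (h : DiracPair F ℒ ℒ' sq d del) (FS : FrameOfRank R S 1) (X : L)
    {T : End 𝕜 (Spinor R L S)} (hT : ∀ Y Z, Commute (opE 𝕜 S Y * opE 𝕜 S Z) T) :
    Commute (d * opE 𝕜 S X + opE 𝕜 S X * d) T := by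
  rw [h.d_opE FS]
  exact commute_neg_smul_sum fun i _ => hT _ _

theorem d_opE_opE (h : DiracPair F ℒ ℒ' sq d del) (FS : FrameOfRank R S 1) (X Y : L) :
    (d * opE 𝕜 S X + opE 𝕜 S X * d) * opE 𝕜 S Y - opE 𝕜 S Y * (d * opE 𝕜 S X + opE 𝕜 S X * d) =
      0 :=
  sub_eq_zero.2 (h.d_opE_commute FS X fun _ _ =>
    commute_mul_of_anticomm (opE_anticomm _ _) (opE_anticomm _ _)).eq

theorem add_mul_self (h : DiracPair F ℒ ℒ' sq d del) :
    (d + del) * (d + del) = d * del + del * d :=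
  add_mul_self_of_sq h.d_sq h.del_sq

/-- All conditions but the last are automatic: `Ð` changes degrees by one, and each component of
`[Ð, f]` and `[[Ð, e₁], e₂]` is an exterior or interior multiplication. The last condition concerns
`Ð² = d̄_* ∂̄ + ∂̄ d̄_*`. -/
theorem isDiracGeneratingOperator_iff (h : DiracPair F ℒ ℒ' sq d del) (FS : FrameOfRank R S 1) :
    IsDiracGeneratingOperator (pairingForm 𝕜 R L) (spinModule 𝕜 R L S) (parity R L S) (d + del) ↔
      ∃ f, d * del + del * d = opM 𝕜 L S f := by
  refine ⟨fun hD => ?_, fun ⟨f, hf⟩ => ⟨fun i Ω hΩ k hk => ?_, fun f => ?_, ?_, f, fun Ω => ?_⟩⟩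
  · obtain ⟨f, hf⟩ := hD.sq_function
    exact ⟨f, by rw [← h.add_mul_self]; exact LinearMap.ext hf⟩
  · have h1 : d Ω k = 0 := by
      cases k with
      | zero => exact h.d_zero Ω
      | succ k =>
        refine h.d_degree Ω k (hΩ k fun hki => hk ?_)
        rw [Nat.cast_succ, hki]
    have h2 : del Ω k = 0 := by
      refine h.del_degree Ω k (hΩ (k + 1) fun hki => hk ?_)
      rw [← hki, Nat.cast_succ, add_assoc, CharTwo.add_self_eq_zero, add_zero]
    rw [LinearMap.add_apply, Pi.add_apply, h1, h2, add_zero]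
  · refine ⟨(F.ofBidual (ℒ'.dFun f), ℒ.dFun f), fun Ω => ?_⟩
    rw [spinModule_ι, ← h.d_opM, ← h.del_opM]
    change d (f • Ω) + del (f • Ω) - f • (d Ω + del Ω) =
      d (f • Ω) - f • d Ω + (del (f • Ω) - f • del Ω)
    rw [smul_add]
    abel
  · rintro ⟨X, ξ⟩ ⟨Y, η⟩
    have key := derived_bracket (h.d_opE_opE FS X Y) (h.d_opE_opI X η) (h.d_opI_opE ξ Y)
      (h.d_opI_opI ξ η) (h.del_opE_opE X Y) (h.del_opE_opI X η) (h.del_opI_opE ξ Y)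
      (h.del_opI_opI ξ η)
    rw [← opE_add, ← opE_add, ← opI_add, ← opI_add] at key
    refine ⟨(F.ofBidual (ℒ'.dFun (η X)) - (ℒ'.ad η).transpose F X + (ℒ'.ad ξ).transpose F Y +
      ℒ.bracket X Y, ℒ'.bracket ξ η + ℒ.coad X η + (ℒ.dFun (ξ Y) - ℒ.coad Y ξ)), fun Ω => ?_⟩
    simp only [spinModule_ι]
    exact LinearMap.congr_fun key Ω
  · rw [← opM_apply (𝕜 := 𝕜), ← hf, ← h.add_mul_self]
    rfl

theorem laplacian_opM (h : DiracPair F ℒ ℒ' sq d del) (f : R) :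
    (d * del + del * d) * opM 𝕜 L S f - opM 𝕜 L S f * (d * del + del * d) =
      (d * opI 𝕜 S (ℒ.dFun f) + opI 𝕜 S (ℒ.dFun f) * d) +
        (del * opE 𝕜 S (F.ofBidual (ℒ'.dFun f)) + opE 𝕜 S (F.ofBidual (ℒ'.dFun f)) * del) :=
  laplacian_comm (h.d_opM f) (h.del_opM f)

/-- The only term of `[[Q, X], ξ]` that is not evidently a spin derivation. Here `d_* X ∧` is
quadratic in exterior multiplications, and the other operator turns each of these into a
contraction. The result is a sum of elements of `𝔤𝔩(A)`, whose scalar parts cancel because `d ξ` is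
antisymmetric. -/
theorem del_opI_d_opE_spin (h : DiracPair F ℒ ℒ' sq d del) (FS : FrameOfRank R S 1)
    (hm : ∀ Ω : Derivation 𝕜 R R [⋀^Fin (m + 1)]→ₗ[R] R, Ω = 0) (ξ : Dual R L) (X : L) :
    IsSpinDerivation sq ((del * opI 𝕜 S ξ + opI 𝕜 S ξ * del) *
      (d * opE 𝕜 S X + opE 𝕜 S X * d) - (d * opE 𝕜 S X + opE 𝕜 S X * d) *
        (del * opI 𝕜 S ξ + opI 𝕜 S ξ * del)) := by
  rw [h.d_opE FS, comm_neg_smul_sum (fun i _ => comm_mul_eq (h.del_opI_opE ξ _)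
    (h.del_opI_opE ξ _))]
  refine IsSpinDerivation.neg (IsSpinDerivation.smul (IsSpinDerivation.sum F hm _ fun i _ => ?_) _)
  rw [anticomm_halves (𝕜 := 𝕜) (opI_opE _ _) (by
    rw [← opM_add, h.apply_antisymm' FS ξ (F.vec i), opM_zero])]
  exact (IsSpinDerivation.opE_opI F hm sq _ _).sub (IsSpinDerivation.opE_opI F hm sq _ _)

/-- If the graded commutators of `Ð²` with two exterior multiplications vanish, `Ð²` is the
multiplication by a function. -/
theorem exists_eq_opM (h : DiracPair F ℒ ℒ' sq d del) (FS : FrameOfRank R S 1)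
    (hm : ∀ Ω : Derivation 𝕜 R R [⋀^Fin (m + 1)]→ₗ[R] R, Ω = 0)
    (h1 : ∀ f X, ((d * del + del * d) * opM 𝕜 L S f - opM 𝕜 L S f * (d * del + del * d)) *
      opE 𝕜 S X = opE 𝕜 S X *
        ((d * del + del * d) * opM 𝕜 L S f - opM 𝕜 L S f * (d * del + del * d)))
    (h2 : ∀ f g, ((d * del + del * d) * opM 𝕜 L S f - opM 𝕜 L S f * (d * del + del * d)) *
      opM 𝕜 L S g = opM 𝕜 L S g *
        ((d * del + del * d) * opM 𝕜 L S f - opM 𝕜 L S f * (d * del + del * d)))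
    (h3 : ∀ X f, ((d * del + del * d) * opE 𝕜 S X - opE 𝕜 S X * (d * del + del * d)) *
      opM 𝕜 L S f - opM 𝕜 L S f *
        ((d * del + del * d) * opE 𝕜 S X - opE 𝕜 S X * (d * del + del * d)) = 0)
    (h4 : ∀ X Y, ((d * del + del * d) * opE 𝕜 S X - opE 𝕜 S X * (d * del + del * d)) *
      opE 𝕜 S Y + opE 𝕜 S Y *
        ((d * del + del * d) * opE 𝕜 S X - opE 𝕜 S X * (d * del + del * d)) = 0) :
    ∃ f, d * del + del * d = opM 𝕜 L S f := by
  -- `[Q, f]` is the sum of the Lie derivative of `A*` along `d f` and that of `A` along `d_* f`,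
  -- hence a spin derivation.
  have hQM (f : R) : (d * del + del * d) * opM 𝕜 L S f - opM 𝕜 L S f * (d * del + del * d) = 0 := by
    refine IsSpinDerivation.eq_zero (sq := sq) FS ?_ (h2 f) (h1 f)
    rw [h.laplacian_opM]
    exact (h.d_opI_spin _).add (h.del_opE_spin _)
  have hQI (X : L) (ξ : Dual R L) :
      ((d * del + del * d) * opE 𝕜 S X - opE 𝕜 S X * (d * del + del * d)) * opI 𝕜 S ξ +
        opI 𝕜 S ξ * ((d * del + del * d) * opE 𝕜 S X - opE 𝕜 S X * (d * del + del * d)) = 0 := by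
    refine IsSpinDerivation.eq_zero (sq := sq) FS ?_
      (fun f => anticomm_mul_comm (h3 X f) (opM_opI f ξ))
      (fun Y => anticomm_mul_comm' (opI_opE ξ Y) (h3 X _) (h4 X Y))
    rw [laplacian_comm_anticomm (h.del_opE_opI X ξ) (h.d_opE_opI X ξ)]
    exact (((h.d_opI_spin ξ).comm (h.del_opE_spin X)).add (h.d_opI_spin _)).add
      ((h.del_opI_d_opE_spin FS hm ξ X).add (h.del_opE_spin _))
  have hQE (X : L) : (d * del + del * d) * opE 𝕜 S X - opE 𝕜 S X * (d * del + del * d) = 0 := by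
    -- By the previous step `[Q, X]` anticommutes with contractions. It raises the degree by one, so
    -- it has no component of degree zero.
    refine op_eq_zero_of_int (fun ξ => Or.inr ((add_comm _ _).trans (hQI X ξ))) fun Ω => ?_
    have h0 : del (d (opE 𝕜 S X Ω)) 0 = 0 :=
      h.del_degree _ _ (h.d_degree _ _ rfl)
    change d (del (opE 𝕜 S X Ω)) 0 + del (d (opE 𝕜 S X Ω)) 0 - opE 𝕜 S X _ 0 = 0
    rw [h.d_zero, h0, zero_add, zero_sub, neg_eq_zero]
    rfl
  let c (s : S) : Spinor R L S := Pi.single 0 (AlternatingMap.constOfIsEmpty R (Dual R L) (Fin 0) s)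
  have hcs (f : R) (s : S) : c (f • s) = f • c s := by
    funext k
    cases k with
    | zero => simp [c]; rfl
    | succ k => simp [c]
  have hca (s t : S) : c (s + t) = c s + c t := by
    funext k
    cases k with
    | zero => simp [c]; rfl
    | succ k => simp [c]
  have hQs (f : R) (Ω : Spinor R L S) : (d * del + del * d) (f • Ω) = f • (d * del + del * d) Ω :=
    sub_eq_zero.1 (LinearMap.congr_fun (hQM f) Ω)
  -- `Q` now commutes with functions and exterior multiplications, so only its action on `𝒮` in
  -- degree zero matters. This action is linear over functions on a module of rank one, and it
  -- supplies the function.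
  let q : S →ₗ[R] S :=
    { toFun := fun s => (d * del + del * d) (c s) 0 ![]
      map_add' := fun s t => by rw [hca, map_add]; rfl
      map_smul' := fun f s => by rw [hcs, hQs]; rfl }
  obtain ⟨f, hf⟩ := FS.exists_eq_smul 𝕜 q
  refine ⟨f, sub_eq_zero.1 (op_eq_zero_of_single F (fun X => Or.inl ?_) fun a => ?_)⟩
  · rw [mul_sub, sub_mul, opM_opE, sub_eq_zero.1 (hQE X)]
  · have ha : (Pi.single 0 a : Spinor R L S) = c (a ![]) := by
      simp only [c]
      congr 1
      exact AlternatingMap.ext fun v => congrArg a (Subsingleton.elim v ![])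
    funext k
    cases k with
    | zero =>
      refine Cochain.ext_zero (η := 0) ?_
      rw [ha]
      have := hf (a ![])
      change (d * del + del * d) (c (a ![])) 0 ![] - f • c (a ![]) 0 ![] = 0
      rw [sub_eq_zero]
      exact this
    | succ k =>
      -- `Q` preserves degrees: `∂̄` kills degree zero, and `∂̄ d̄_*` leads from degree zero through
      -- degree one back to degree zero.
      have h0 : del (Pi.single 0 a : Spinor R L S) = 0 := funext fun j =>
        h.del_degree _ _ (Pi.single_eq_of_ne (Nat.succ_ne_zero j) _)
      have h1 : del (d (Pi.single 0 a : Spinor R L S)) (k + 1) = 0 :=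
        h.del_degree _ _ (h.d_degree _ _ (Pi.single_eq_of_ne (Nat.succ_ne_zero k) _))
      have h2 : (opM 𝕜 L S f (Pi.single 0 a) : Spinor R L S) (k + 1) = 0 := by
        rw [opM_apply, Pi.smul_apply, Pi.single_eq_of_ne (Nat.succ_ne_zero k), smul_zero]
      change d (del (Pi.single 0 a : Spinor R L S)) (k + 1) +
        del (d (Pi.single 0 a : Spinor R L S)) (k + 1) -
        opM 𝕜 L S f (Pi.single 0 a : Spinor R L S) (k + 1) = 0
      rw [h0, h1, h2, map_zero]
      simp

end DiracPair
end DiracPairs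

/-! ### Graded commutators with explicit signs -/

section RingIdentities

variable {A : Type*} [Ring A]

theorem mul_mul_of_eq {a b c : A} (h : a * b = c) (x : A) : a * (b * x) = c * x := by
  rw [← mul_assoc, h]

theorem eq_neg_one_pow_mul_comm {x y : A} {j : ℕ} (h : x = (-1) ^ j * y) : y = (-1) ^ j * x := by
  rw [h, ← mul_assoc, ← pow_add, Even.neg_one_pow ⟨j, rfl⟩, one_mul]

theorem mul_anticomm_of_pow {W e f : A} {k : ℕ} (hW : W * f = (-1) ^ k * (f * W))
    (he : e * f = -(f * e)) : e * W * f = (-1) ^ (k + 1) * (f * (e * W)) := by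
  rw [mul_assoc, hW, ((Commute.neg_one_right e).pow_right k).left_comm, ← mul_assoc e f W, he,
    pow_succ, mul_assoc, neg_one_mul, neg_mul, mul_assoc]

theorem mul_mul_of_pow {W e P : A} {j k : ℕ} (he : W * e = (-1) ^ k * (e * W))
    (hP : W * P = (-1) ^ j * (P * W)) : W * (e * P) = (-1) ^ (j + k) * (e * P * W) := by
  rw [← mul_assoc, he, mul_assoc, mul_assoc, hP, ((Commute.neg_one_right e).pow_right j).left_comm,
    add_comm, pow_add, mul_assoc, mul_assoc]

theorem commute_mul_of_pow {W e f : A} {k : ℕ} (he : W * e = (-1) ^ k * (e * W))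
    (hf : W * f = (-1) ^ k * (f * W)) : Commute (e * f) W := by
  refine Commute.symm ?_
  change W * (e * f) = e * f * W
  rw [mul_mul_of_pow he hf, Even.neg_one_pow ⟨k, rfl⟩, one_mul]

theorem mul_mul_of_commute_of_pow {W p P : A} {j : ℕ} (hp : W * p = p * W)
    (hP : W * P = (-1) ^ j * (P * W)) : W * (p * P) = (-1) ^ j * (p * P * W) := by
  rw [← mul_assoc, hp, mul_assoc, hP, ((Commute.neg_one_right p).pow_right j).left_comm, mul_assoc]

theorem neg_one_pow_one_mul (x : A) : (-1) ^ 1 * x = -x := by rw [pow_one, neg_one_mul]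

theorem neg_one_pow_eq_of_even {k l : ℕ} (h : Even (k + l)) : (-1 : A) ^ k = (-1) ^ l :=
  neg_one_pow_congr (Nat.even_add.1 h)

theorem neg_one_pow_mul_eq_zero {j : ℕ} {x : A} (h : (-1) ^ j * x = 0) : x = 0 := by
  rcases neg_one_pow_eq_or A j with hj | hj <;> simpa [hj] using h

/-- The graded Jacobi identity for `d`, `W`, `e`, where `W` and `e` commute in the graded sense. As
parities enter only through `(-1) ^ k`, the proof distinguishes its two values; the other sign
identities are treated in the same way. -/
theorem gradedComm_anticomm {d W e : A} {k : ℕ} (hW : W * e = (-1) ^ k * (e * W))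
    (hc : (d * e + e * d) * W = W * (d * e + e * d)) :
    (d * W - (-1) ^ k * (W * d)) * e = (-1) ^ (k + 1) * (e * (d * W - (-1) ^ k * (W * d))) := by
  rw [← sub_eq_zero] at hc ⊢
  rcases neg_one_pow_eq_or A k with hk | hk <;>
    simp only [pow_succ, hk, one_mul, mul_one, neg_mul, mul_neg, neg_neg, sub_neg_eq_add] at hW ⊢ <;>
    [rw [← hc]; rw [← neg_eq_zero, ← hc]] <;>
    simp only [mul_add, add_mul, mul_sub, sub_mul, mul_assoc, hW, mul_mul_of_eq hW, neg_mul,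
      mul_neg] <;> abel

theorem gradedComm_commute {d W p r : A} {k : ℕ} (hW : W * p = p * W) (hr : d * p - p * d = r)
    (hWr : W * r = (-1) ^ k * (r * W)) :
    (d * W - (-1) ^ k * (W * d)) * p = p * (d * W - (-1) ^ k * (W * d)) := by
  rw [sub_eq_iff_eq_add] at hr
  rcases neg_one_pow_eq_or A k with hk | hk <;>
    simp only [hk, one_mul, neg_mul, sub_neg_eq_add] at hWr ⊢ <;>
    simp only [mul_add, add_mul, mul_sub, sub_mul, mul_assoc, hW, hr, hWr, mul_mul_of_eq hW,
      mul_mul_of_eq hr] <;> abel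

theorem comm_anticomm_pow {T W e e' : A} {k : ℕ} (hW : W * e = (-1) ^ k * (e * W))
    (he : T * e - e * T = e') (hW' : W * e' = (-1) ^ k * (e' * W)) :
    (T * W - W * T) * e = (-1) ^ k * (e * (T * W - W * T)) := by
  rw [sub_eq_iff_eq_add] at he
  rcases neg_one_pow_eq_or A k with hk | hk <;>
    simp only [hk, one_mul, neg_mul] at hW hW' ⊢ <;>
    simp only [mul_add, add_mul, mul_sub, sub_mul, mul_assoc, hW, he, hW', mul_mul_of_eq hW,
      mul_mul_of_eq he, neg_mul, mul_neg] <;> abel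

/-- The derived bracket of `b` satisfies in its first argument the recursion that defines the
Schouten bracket of `e ∧ P` with `W`. -/
theorem schoutenList_step {b e P W : A} {k l : ℕ} (hWe : W * e = (-1) ^ l * (e * W))
    (hWP : W * P = (-1) ^ (k * l) * (P * W))
    (hP : ((b * e + e * b) * W - W * (b * e + e * b)) * P =
      (-1) ^ (k * l) * (P * ((b * e + e * b) * W - W * (b * e + e * b)))) :
    e * ((-1) ^ (k + 1) * ((b * P - (-1) ^ k * (P * b)) * W -
      (-1) ^ ((k + 1) * l) * (W * (b * P - (-1) ^ k * (P * b))))) +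
      (-1) ^ k * (P * ((b * e + e * b) * W - W * (b * e + e * b))) =
    (-1) ^ (k + 1 + 1) * ((b * (e * P) - (-1) ^ (k + 1) * (e * P * b)) * W -
      (-1) ^ ((k + 1 + 1) * l) * (W * (b * (e * P) - (-1) ^ (k + 1) * (e * P * b)))) := by
  rw [eq_neg_one_pow_mul_comm hP]
  rcases neg_one_pow_eq_or A k with hk | hk <;> rcases neg_one_pow_eq_or A l with hl | hl <;>
    simp only [pow_mul, pow_succ, hk, hl, one_mul, mul_one, neg_mul, mul_neg, neg_neg, one_pow,
      sub_neg_eq_add] at hWe hWP ⊢ <;>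
    simp only [mul_add, add_mul, mul_sub, sub_mul, mul_assoc, hWP, mul_mul_of_eq hWe,
      mul_mul_of_eq hWP, neg_mul, mul_neg] <;> abel

/-- The companion of `schoutenList_step` for a function coefficient: `[b, p] = i` produces the
contraction with the differential of the function. -/
theorem schouten_step {b p i P W : A} {k l : ℕ} (hWp : W * p = p * W)
    (hi : b * p - p * b = i) (hWP : W * P = (-1) ^ (k * l) * (P * W))
    (hP : (i * W - (-1) ^ l * (W * i)) * P =
      (-1) ^ (k * (l + 1)) * (P * (i * W - (-1) ^ l * (W * i)))) :
    p * ((-1) ^ (k + 1) * ((b * P - (-1) ^ k * (P * b)) * W -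
      (-1) ^ ((k + 1) * l) * (W * (b * P - (-1) ^ k * (P * b))))) -
      P * (i * W - (-1) ^ l * (W * i)) =
    (-1) ^ (k + 1) * ((b * (p * P) - (-1) ^ k * (p * P * b)) * W -
      (-1) ^ ((k + 1) * l) * (W * (b * (p * P) - (-1) ^ k * (p * P * b)))) := by
  rw [eq_neg_one_pow_mul_comm hP]
  rw [sub_eq_iff_eq_add] at hi
  rcases neg_one_pow_eq_or A k with hk | hk <;> rcases neg_one_pow_eq_or A l with hl | hl <;>
    simp only [pow_mul, pow_succ, hk, hl, one_mul, mul_one, neg_mul, mul_neg, neg_neg, one_pow,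
      sub_neg_eq_add] at hWP ⊢ <;>
    simp only [mul_add, add_mul, mul_sub, sub_mul, mul_assoc, hWP, mul_mul_of_eq hWp,
      mul_mul_of_eq hi, mul_mul_of_eq hWP, neg_mul, mul_neg] <;> abel

/-- The failure of `[d, ·]` to be a derivation of the derived bracket of `b`. -/
theorem derived_bracket_derivation {d b U V : A} {k l : ℕ}
    (h : (d * U - (-1) ^ k * (U * d)) * V = (-1) ^ ((k + 1) * l) * (V * (d * U - (-1) ^ k * (U * d)))) :
    (d * ((-1) ^ (k + 1) * ((b * U - (-1) ^ k * (U * b)) * V -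
        (-1) ^ ((k + 1) * l) * (V * (b * U - (-1) ^ k * (U * b))))) -
      (-1) ^ (k + l + 1) * (((-1) ^ (k + 1) * ((b * U - (-1) ^ k * (U * b)) * V -
        (-1) ^ ((k + 1) * l) * (V * (b * U - (-1) ^ k * (U * b))))) * d)) -
    (-((-1) ^ (k * (l + 1)) * ((-1) ^ (l + 1) * ((b * V - (-1) ^ l * (V * b)) *
          (d * U - (-1) ^ k * (U * d)) -
        (-1) ^ ((l + 1) * (k + 1)) * ((d * U - (-1) ^ k * (U * d)) *
          (b * V - (-1) ^ l * (V * b)))))) +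
      (-1) ^ (k + 1) * ((-1) ^ (k + 1) * ((b * U - (-1) ^ k * (U * b)) *
          (d * V - (-1) ^ l * (V * d)) -
        (-1) ^ ((k + 1) * (l + 1)) * ((d * V - (-1) ^ l * (V * d)) *
          (b * U - (-1) ^ k * (U * b)))))) =
    (-1) ^ (k + 1) * (((d * b + b * d) * U - U * (d * b + b * d)) * V -
      (-1) ^ (k * l) * (V * ((d * b + b * d) * U - U * (d * b + b * d)))) := by
  rw [← sub_eq_zero] at h
  -- The Jacobi identity leaves, besides the bracket with `{d, b}`, a commutator of `b` with `[[d,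
  -- U], V]`, and the latter is zero by hypothesis. Subtracting it makes the claim a polynomial
  -- identity for each choice of signs.
  have h0 : (-1) ^ (k + 1) * (b * ((d * U - (-1) ^ k * (U * d)) * V -
      (-1) ^ ((k + 1) * l) * (V * (d * U - (-1) ^ k * (U * d)))) -
      (-1) ^ (k + l + 1) * (((d * U - (-1) ^ k * (U * d)) * V -
      (-1) ^ ((k + 1) * l) * (V * (d * U - (-1) ^ k * (U * d)))) * b)) = 0 := by
    rw [h]; simp
  refine Eq.trans ?_ (sub_zero _)
  rw [← h0]
  clear h h0
  rcases neg_one_pow_eq_or A k with hk | hk <;> rcases neg_one_pow_eq_or A l with hl | hl <;>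
    simp only [pow_mul, pow_succ, pow_add, hk, hl, one_mul, mul_one, neg_mul, mul_neg, neg_neg, one_pow,
      sub_neg_eq_add] <;>
    simp only [mul_add, add_mul, mul_sub, sub_mul, mul_assoc] <;> abel

end RingIdentities

/-! ### Multivectors as operators, and the Lie bialgebroid condition -/

noncomputable section Multivectors

variable {𝕜 R L S : Type*} [Field 𝕜] [CharZero 𝕜] [CommRing R] [Algebra 𝕜 R]
  [AddCommGroup L] [Module R L] [Module 𝕜 L] [IsScalarTower 𝕜 R L]
  [AddCommGroup S] [Module R S] [Module 𝕜 S] [IsScalarTower 𝕜 R S] {n m : ℕ}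

namespace Spinor

theorem opM_mul (f g : R) : opM 𝕜 L S (f * g) = opM 𝕜 L S f * opM 𝕜 L S g :=
  LinearMap.ext fun Ω => mul_smul f g Ω

theorem opM_neg_one_pow (j : ℕ) : opM (R := R) 𝕜 L S ((-1) ^ j) = (-1) ^ j := by
  induction j with
  | zero => rw [pow_zero, pow_zero, opM_one]
  | succ j ih => rw [pow_succ, pow_succ, opM_mul, ih, opM_neg, opM_one]

variable (R L) in
/-- The constant function `1`, as a multivector. -/
def unit : Spinor R L R := Pi.single 0 (AlternatingMap.constOfIsEmpty R (Dual R L) (Fin 0) 1)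

theorem lieMulti_unit (ℒ : LieAlgebroid 𝕜 R L) (X : L) : ℒ.lieMulti X (unit R L) = 0 := by
  funext k
  change (ℒ.coad X).alt (DerEnd.scalar (ℒ.anchor X)) k (unit R L k) = 0
  cases k with
  | zero =>
    ext v
    rw [DerEnd.alt_apply]
    simp [unit]
  | succ k =>
    rw [unit, Pi.single_eq_of_ne (Nat.succ_ne_zero k)]
    exact map_zero ((ℒ.coad X).alt (DerEnd.scalar (ℒ.anchor X)) (k + 1)).toLinearMap

theorem differential_unit (ℒ' : LieAlgebroid 𝕜 R (Dual R L)) :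
    ℒ'.trivialRep.differential (unit R L) = 0 := by
  funext k
  cases k with
  | zero => rfl
  | succ k =>
    cases k with
    | zero =>
      ext v
      rw [LieAlgebroid.Rep.differential_succ]
      change ℒ'.anchor (v 0) 1 = 0
      exact Derivation.map_one_eq_zero _
    | succ k =>
      have h0 : unit R L (k + 1) = (0 : Spinor R L R) (k + 1) :=
        Pi.single_eq_of_ne (Nat.succ_ne_zero k) _
      rw [LieAlgebroid.Rep.differential_congr _ h0, map_zero]

theorem tensorSection_unit (s : S) : tensorSection s (unit R L) =
    Pi.single 0 (AlternatingMap.constOfIsEmpty R (Dual R L) (Fin 0) s) := by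
  funext k
  ext v
  rw [tensorSection_apply]
  cases k with
  | zero => simp [unit]
  | succ k => simp [unit]

theorem tensorSection_injective (FS : FrameOfRank R S 1) {w w' : Spinor R L R}
    (h : ∀ s : S, tensorSection s w = tensorSection s w') : w = w' := by
  funext k
  ext v
  have h1 (s : S) : w k v • s = w' k v • s := by rw [← tensorSection_apply, h, tensorSection_apply]
  have h2 := Finset.sum_congr rfl fun i (_ : i ∈ Finset.univ) =>
    congrArg (FS.coord i) (h1 (FS.vec i))
  simp only [map_smul, smul_eq_mul, ← Finset.mul_sum, FS.trace, Nat.cast_one, mul_one] at h2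
  exact h2

variable (𝕜 S) in
/-- Exterior multiplication by a product of sections of `A`, as a `𝕜`-linear operator. -/
def opList (Xs : List L) : End 𝕜 (Spinor R L S) := (Xs.map (opE 𝕜 S)).prod

theorem opList_cons (X : L) (Xs : List L) :
    opList (R := R) 𝕜 S (X :: Xs) = opE 𝕜 S X * opList 𝕜 S Xs := by
  rw [opList, List.map_cons, List.prod_cons, opList]

theorem listMul_cons (X : L) (Xs : List L) (w : Spinor R L S) :
    listMul (X :: Xs) w = extMul X (listMul Xs w) := by
  rw [listMul, List.map_cons, List.prod_cons]
  rfl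

/-- `W` is the exterior multiplication of spinors by the multivector `w` of parity `k`. -/
structure IsMultiplication (W : End 𝕜 (Spinor R L S)) (w : Spinor R L R) (k : ℕ) : Prop where
  mul_opE : ∀ X, W * opE 𝕜 S X = (-1) ^ k * (opE 𝕜 S X * W)
  mul_opM : ∀ f, W * opM 𝕜 L S f = opM 𝕜 L S f * W
  apply_tensorSection : ∀ s, W (tensorSection s (unit R L)) = tensorSection s w

namespace IsMultiplication

variable {W W' : End 𝕜 (Spinor R L S)} {w w' : Spinor R L R} {k l : ℕ}

theorem of_even (h : IsMultiplication W w k) (hkl : Even (k + l)) : IsMultiplication W w l :=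
  ⟨fun X => (h.mul_opE X).trans (congrArg (· * _) (neg_one_pow_eq_of_even hkl)), h.mul_opM,
    h.apply_tensorSection⟩

theorem add (h : IsMultiplication W w k) (h' : IsMultiplication W' w' k) :
    IsMultiplication (W + W') (w + w') k :=
  ⟨fun X => by rw [add_mul, h.mul_opE, h'.mul_opE, mul_add, mul_add],
    fun f => by rw [add_mul, h.mul_opM, h'.mul_opM, mul_add],
    fun s => by rw [LinearMap.add_apply, h.apply_tensorSection, h'.apply_tensorSection, map_add]⟩

theorem smul (f : R) (h : IsMultiplication W w k) :
    IsMultiplication (opM 𝕜 L S f * W) (f • w) k :=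
  ⟨fun X => by
    rw [mul_assoc, h.mul_opE, ← opM_neg_one_pow, ← mul_assoc, ← mul_assoc, opM_opM, mul_assoc,
      mul_assoc, ← mul_assoc _ (opE 𝕜 S X) W, opM_opE, mul_assoc],
    fun g => by rw [mul_assoc, h.mul_opM, ← mul_assoc, opM_opM, mul_assoc],
    fun s => by
      rw [Module.End.mul_apply, h.apply_tensorSection, map_smul]; rfl⟩

theorem neg_one_pow_mul (j : ℕ) (h : IsMultiplication W w k) :
    IsMultiplication ((-1) ^ j * W) ((-1 : R) ^ j • w) k := by
  rw [← opM_neg_one_pow]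
  exact h.smul _

theorem neg (h : IsMultiplication W w k) : IsMultiplication (-W) (-w) k := by
  have h1 : (-1) ^ 1 * W = -W := neg_one_pow_one_mul W
  have h2 : (-1 : R) ^ 1 • w = -w := by rw [pow_one, neg_one_smul]
  rw [← h1, ← h2]
  exact h.neg_one_pow_mul 1

theorem sub (h : IsMultiplication W w k) (h' : IsMultiplication W' w' k) :
    IsMultiplication (W - W') (w - w') k := by
  rw [sub_eq_add_neg, sub_eq_add_neg]
  exact h.add h'.neg

theorem opE_mul (X : L) (h : IsMultiplication W w k) :
    IsMultiplication (opE 𝕜 S X * W) (extMul X w) (k + 1) :=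
  ⟨fun Y => mul_anticomm_of_pow (h.mul_opE Y) (opE_anticomm X Y),
    fun f => by rw [mul_assoc, h.mul_opM, ← mul_assoc, ← opM_opE, mul_assoc],
    fun s => by
      rw [Module.End.mul_apply, h.apply_tensorSection, tensorSection_extMul]; rfl⟩

theorem opList_mul (Xs : List L) (h : IsMultiplication W w k) :
    IsMultiplication (opList 𝕜 S Xs * W) (listMul Xs w) (Xs.length + k) := by
  induction Xs with
  | nil => rw [List.length_nil, zero_add, opList, List.map_nil, List.prod_nil, one_mul]; exact h
  | cons X Xs ih =>
    rw [opList_cons, listMul_cons, mul_assoc, List.length_cons, add_right_comm]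
    exact ih.opE_mul X

variable (𝕜 S) in
theorem one : IsMultiplication (1 : End 𝕜 (Spinor R L S)) (unit R L) 0 :=
  ⟨fun X => by rw [pow_zero, one_mul, one_mul, mul_one], fun f => by rw [one_mul, mul_one],
    fun _ => rfl⟩

variable (𝕜 S) in
theorem decomposable (f : R) (Xs : List L) : IsMultiplication (opM 𝕜 L S f * opList 𝕜 S Xs)
    (decomposable f Xs) Xs.length := by
  have := ((one 𝕜 S).opList_mul Xs).smul f
  rwa [mul_one, add_zero] at this

theorem mul_opList (Xs : List L) (h : IsMultiplication W w k) :
    W * opList 𝕜 S Xs = (-1) ^ (Xs.length * k) * (opList 𝕜 S Xs * W) := by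
  induction Xs with
  | nil => simp [opList]
  | cons X Xs ih =>
    rw [opList_cons, List.length_cons, Nat.succ_mul]
    exact mul_mul_of_pow (h.mul_opE X) ih

/-- Together with `multivector_eq` this makes the dictionary faithful in both directions: an
identity of multivectors is equivalent to the identity of their exterior multiplications. Spinors
are generated from degree zero by exterior multiplications, past which `W` moves up to sign. -/
theorem eq_zero (F : FrameOfRank R L n) (h : IsMultiplication W 0 k) : W = 0 := by
  refine op_eq_zero_of_single F (fun X => ?_) fun a => ?_
  · have := h.mul_opE X
    rcases neg_one_pow_eq_or (End 𝕜 (Spinor R L S)) k with hk | hk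
    · left; rw [this, hk, one_mul]
    · right; rw [this, hk, neg_one_mul]; exact add_neg_cancel _
  · have ha : Pi.single 0 a = tensorSection (a ![]) (unit R L) := by
      rw [tensorSection_unit]
      congr 1
      exact AlternatingMap.ext fun v => congrArg a (Subsingleton.elim v ![])
    rw [ha, h.apply_tensorSection, map_zero]

theorem multivector_eq (FS : FrameOfRank R S 1) (h : IsMultiplication W w k)
    (h' : IsMultiplication W w' l) : w = w' :=
  tensorSection_injective FS fun s => by rw [← h.apply_tensorSection, h'.apply_tensorSection]

theorem mul_comm_opE_mul_opE (h : IsMultiplication W w k) (Y Z : L) :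
    Commute (opE 𝕜 S Y * opE 𝕜 S Z) W :=
  commute_mul_of_pow (h.mul_opE Y) (h.mul_opE Z)

theorem opI_gradedComm (ξ : Dual R L) (h : IsMultiplication W w k) :
    IsMultiplication (opI 𝕜 S ξ * W - (-1) ^ k * (W * opI 𝕜 S ξ)) (intMul ξ w) (k + 1) :=
  ⟨fun X => gradedComm_anticomm (h.mul_opE X) (by rw [opI_opE, h.mul_opM]),
    fun f => gradedComm_commute (h.mul_opM f) (r := 0) (by rw [opM_opI, sub_self])
      (by rw [mul_zero, zero_mul, mul_zero]),
    fun s => by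
      have h0 : opI 𝕜 S ξ (tensorSection s (unit R L)) = 0 := by
        rw [tensorSection_unit]; exact intMul_single_zero _ _
      rw [LinearMap.sub_apply, Module.End.mul_apply, Module.End.mul_apply, Module.End.mul_apply,
        h0, map_zero, map_zero, sub_zero, h.apply_tensorSection, tensorSection_intMul]
      rfl⟩

end IsMultiplication
end Spinor
open Spinor
namespace DiracPair

variable {F : FrameOfRank R L n} {ℒ : LieAlgebroid 𝕜 R L} {ℒ' : LieAlgebroid 𝕜 R (Dual R L)}
  {sq : S ⊗[R] S ≃ₗ[R] DetLine 𝕜 R L n m} {d del : End 𝕜 (Spinor R L S)}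
  {W : End 𝕜 (Spinor R L S)} {w : Spinor R L R} {k : ℕ}

/-- Applied to `s ⊗ 1`, both `d̄_* W` and `W d̄_*` contain the action of `A*` on `𝒮`, in terms `xᵢ ∧
(φᵢ · s)`. As `W` commutes with `xᵢ ∧` up to the sign of the graded commutator, these cancel and
`d_* w` remains. -/
theorem differential_isMultiplication (h : DiracPair F ℒ ℒ' sq d del) (FS : FrameOfRank R S 1)
    (hW : IsMultiplication W w k) :
    IsMultiplication (d * W - (-1) ^ k * (W * d)) (ℒ'.trivialRep.differential w) (k + 1) :=
  ⟨fun X => gradedComm_anticomm (hW.mul_opE X)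
      (h.d_opE_commute FS X fun Y Z => hW.mul_comm_opE_mul_opE Y Z).eq,
    fun f => gradedComm_commute (hW.mul_opM f) (h.d_opM f) (hW.mul_opE _),
    fun s => by
      obtain ⟨a, ha⟩ := h.d_tensorSection
      have h1 (i : F.ι) (t : S) : ((-1) ^ k * W : End 𝕜 (Spinor R L S)) (opE 𝕜 S (F.vec i)
          (tensorSection t (unit R L))) = opE 𝕜 S (F.vec i) (tensorSection t w) := by
        have h2 : (-1) ^ k * W * opE 𝕜 S (F.vec i) = opE 𝕜 S (F.vec i) * W := by
          rw [mul_assoc, ← eq_neg_one_pow_mul_comm (hW.mul_opE _)]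
        rw [← hW.apply_tensorSection]
        exact LinearMap.congr_fun h2 (tensorSection t (unit R L))
      rw [← mul_assoc, LinearMap.sub_apply, Module.End.mul_apply, Module.End.mul_apply,
        hW.apply_tensorSection, ha, ha, differential_unit, map_zero, zero_add, map_sum]
      simp only [h1, add_sub_cancel_right]⟩

theorem lieMulti_isMultiplication (h : DiracPair F ℒ ℒ' sq d del) (X : L)
    (hW : IsMultiplication W w k) :
    IsMultiplication ((del * opE 𝕜 S X + opE 𝕜 S X * del) * W -
      W * (del * opE 𝕜 S X + opE 𝕜 S X * del)) (ℒ.lieMulti X w) k :=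
  ⟨fun Y => comm_anticomm_pow (hW.mul_opE Y) (h.del_opE_opE X Y) (hW.mul_opE _),
    fun f => by
      have := comm_anticomm_pow (k := 0) (W := W) (e := opM 𝕜 L S f)
        (by rw [pow_zero, one_mul]; exact hW.mul_opM f) (h.del_opE_opM X f)
        (by rw [pow_zero, one_mul]; exact hW.mul_opM _)
      rwa [pow_zero, one_mul] at this,
    fun s => by
      obtain ⟨a, ha⟩ := h.del_tensorSection X
      rw [LinearMap.sub_apply, Module.End.mul_apply, Module.End.mul_apply,
        hW.apply_tensorSection, ha, ha, lieMulti_unit, map_zero, zero_add,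
        hW.apply_tensorSection, add_sub_cancel_right]⟩

/-- The Schouten bracket is the derived bracket of `∂̄`: for sections `[{∂̄, X}, ·]` is the Lie
derivative, and both brackets extend to products by the same Leibniz rule. The parity `k + l + 1` is
that of the degree `k + l - 1`, without subtraction. -/
theorem schoutenList_isMultiplication (h : DiracPair F ℒ ℒ' sq d del) (Xs : List L)
    (hW : IsMultiplication W w k) :
    IsMultiplication ((-1) ^ (Xs.length + 1) *
      ((del * opList 𝕜 S Xs - (-1) ^ Xs.length * (opList 𝕜 S Xs * del)) * W -
        (-1) ^ ((Xs.length + 1) * k) *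
          (W * (del * opList 𝕜 S Xs - (-1) ^ Xs.length * (opList 𝕜 S Xs * del)))))
      (ℒ.schoutenList Xs w) (Xs.length + k + 1) := by
  induction Xs with
  | nil =>
    have h0 : del * opList (R := R) (L := L) 𝕜 S [] -
        (-1) ^ ([] : List L).length * (opList 𝕜 S [] * del) = 0 := by
      rw [List.length_nil, pow_zero, one_mul, opList, List.map_nil, List.prod_nil, mul_one,
        one_mul, sub_self]
    rw [h0, zero_mul, mul_zero, mul_zero, sub_self, mul_zero]
    exact ⟨fun X => by rw [zero_mul, mul_zero, mul_zero], fun f => by rw [zero_mul, mul_zero],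
      fun s => (map_zero (tensorSection s)).symm⟩
  | cons X Xs ih =>
    have hL := h.lieMulti_isMultiplication X hW
    rw [opList_cons, List.length_cons, ← schoutenList_step (hW.mul_opE X) (hW.mul_opList Xs)
      (hL.mul_opList Xs)]
    have h2 := (hL.opList_mul Xs).neg_one_pow_mul Xs.length
    have h1 := ih.opE_mul X
    refine (h1.of_even ?_).add (h2.of_even ?_)
    · exact ⟨Xs.length + k + 1 + 1, by ring⟩
    · exact ⟨Xs.length + k + 1, by ring⟩

theorem schouten_isMultiplication (h : DiracPair F ℒ ℒ' sq d del) (f : R) (Xs : List L)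
    (hW : IsMultiplication W w k) :
    IsMultiplication ((-1) ^ (Xs.length + 1) *
      ((del * (opM 𝕜 L S f * opList 𝕜 S Xs) -
        (-1) ^ Xs.length * (opM 𝕜 L S f * opList 𝕜 S Xs * del)) * W -
        (-1) ^ ((Xs.length + 1) * k) *
          (W * (del * (opM 𝕜 L S f * opList 𝕜 S Xs) -
            (-1) ^ Xs.length * (opM 𝕜 L S f * opList 𝕜 S Xs * del)))))
      (ℒ.schouten f Xs w) (Xs.length + k + 1) := by
  have hI := hW.opI_gradedComm (ℒ.dFun f)
  rw [← schouten_step (hW.mul_opM f) (h.del_opM f) (hW.mul_opList Xs) (hI.mul_opList Xs)]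
  exact ((h.schoutenList_isMultiplication Xs hW).smul f).sub (hI.opList_mul Xs)

/-- For fixed arguments, the defect of the derivation property is a multivector whose exterior
multiplication is `± [[Q, U], V]`, so one vanishes exactly when the other does. -/
theorem isLieBialgebroid_iff_forall (h : DiracPair F ℒ ℒ' sq d del) (FS : FrameOfRank R S 1) :
    LieAlgebroid.IsLieBialgebroid ℒ ℒ' ↔ ∀ (f g : R) (Xs Ys : List L),
      ((d * del + del * d) * (opM 𝕜 L S f * opList 𝕜 S Xs) -
        opM 𝕜 L S f * opList 𝕜 S Xs * (d * del + del * d)) * (opM 𝕜 L S g * opList 𝕜 S Ys) =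
      (-1) ^ (Xs.length * Ys.length) * (opM 𝕜 L S g * opList 𝕜 S Ys *
        ((d * del + del * d) * (opM 𝕜 L S f * opList 𝕜 S Xs) -
          opM 𝕜 L S f * opList 𝕜 S Xs * (d * del + del * d))) := by
  unfold LieAlgebroid.IsLieBialgebroid
  refine forall_congr' fun f => forall_congr' fun g => forall_congr' fun Xs =>
    forall_congr' fun Ys => ?_
  have hU := IsMultiplication.decomposable 𝕜 S f Xs
  have hV := IsMultiplication.decomposable 𝕜 S g Ys
  set U := opM 𝕜 L S f * opList 𝕜 S Xs with hUdef
  set V := opM 𝕜 L S g * opList 𝕜 S Ys with hVdef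
  set k := Xs.length with hk
  set l := Ys.length with hl
  have hdU := h.differential_isMultiplication FS hU
  have hdV := h.differential_isMultiplication FS hV
  have h1 := h.differential_isMultiplication FS (h.schouten_isMultiplication f Xs hV)
  have h2 := ((h.schouten_isMultiplication g Ys hdU).neg_one_pow_mul (k * (l + 1))).neg
  have h3 := (h.schouten_isMultiplication f Xs hdV).neg_one_pow_mul (k + 1)
  rw [← hUdef, ← hk] at h1 h3
  rw [← hVdef, ← hl] at h2
  have h4 := (h1.of_even (l := k + l) ⟨k + l + 1, by ring⟩).sub
    ((h2.of_even (l := k + l) ⟨k + l + 1, by ring⟩).add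
      (h3.of_even (l := k + l) ⟨k + l + 1, by ring⟩))
  -- `d_* u` and `v` both act by exterior multiplication, hence commute in the graded sense; this is
  -- the hypothesis of `derived_bracket_derivation`.
  have hcomm : (d * U - (-1) ^ k * (U * d)) * V =
      (-1) ^ ((k + 1) * l) * (V * (d * U - (-1) ^ k * (U * d))) := by
    have := hdU.mul_opList Ys
    rw [← hl, mul_comm l] at this
    exact mul_mul_of_commute_of_pow (hdU.mul_opM g) this
  rw [derived_bracket_derivation hcomm] at h4
  rw [← sub_eq_zero, ← sub_eq_zero (b := _ * (V * _))]
  constructor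
  · intro h0
    rw [h0] at h4
    exact neg_one_pow_mul_eq_zero (h4.eq_zero F)
  · intro h0
    rw [h0, mul_zero] at h4
    refine h4.multivector_eq FS (l := 0) ?_
    exact ⟨fun X => by rw [zero_mul, mul_zero, mul_zero], fun f => by rw [zero_mul, mul_zero],
      fun s => (map_zero (tensorSection s)).symm⟩

theorem isLieBialgebroid_iff (h : DiracPair F ℒ ℒ' sq d del) (FS : FrameOfRank R S 1)
    (hm : ∀ Ω : Derivation 𝕜 R R [⋀^Fin (m + 1)]→ₗ[R] R, Ω = 0) :
    LieAlgebroid.IsLieBialgebroid ℒ ℒ' ↔ ∃ f, d * del + del * d = opM 𝕜 L S f := by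
  rw [h.isLieBialgebroid_iff_forall FS]
  constructor
  · intro hB
    -- Functions and single sections suffice as test multivectors.
    refine h.exists_eq_opM FS hm (fun f X => ?_) (fun f g => ?_) (fun X f => ?_) (fun X Y => ?_)
    · simpa [opList, opM_one] using hB f 1 [] [X]
    · simpa [opList, opM_one] using hB f g [] []
    · rw [sub_eq_zero]; simpa [opList, opM_one] using hB 1 f [X] []
    · rw [← eq_neg_iff_add_eq_zero]
      have := hB 1 1 [X] [Y]
      simp only [opList, opM_one, List.map_cons, List.map_nil, List.prod_cons, List.prod_nil,
        mul_one, one_mul, List.length_cons, List.length_nil, zero_add] at this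
      exact this.trans (neg_one_pow_one_mul _)
  · rintro ⟨q, hq⟩ f g Xs Ys
    have hU := (IsMultiplication.decomposable 𝕜 S f Xs).mul_opM q
    rw [hq, hU, sub_self, zero_mul, mul_zero, mul_zero]

end DiracPair
end Multivectors

/-! ### The theorem over an abstract ring of functions -/

noncomputable section CanonicalDirac

open Spinor

theorem exists_isCanonicalDirac {𝕜 R L S : Type*} [Field 𝕜] [CharZero 𝕜] [CommRing R] [Algebra 𝕜 R]
    [AddCommGroup L] [Module R L] [Module 𝕜 L] [IsScalarTower 𝕜 R L]
    [AddCommGroup S] [Module R S] [Module 𝕜 S] [IsScalarTower 𝕜 R S] {n m : ℕ}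
    (F : FrameOfRank R L n) (FS : FrameOfRank R S 1)
    (hm : ∀ Ω : Derivation 𝕜 R R [⋀^Fin (m + 1)]→ₗ[R] R, Ω = 0)
    (ℒ : LieAlgebroid 𝕜 R L) (ℒ' : LieAlgebroid 𝕜 R (Dual R L))
    (sq : S ⊗[R] S ≃ₗ[R] DetLine 𝕜 R L n m) :
    ∃ Ð : Spinor R L S →ₗ[𝕜] Spinor R L S, IsCanonicalDirac ℒ ℒ' sq Ð ∧
      (∀ Ð', IsCanonicalDirac ℒ ℒ' sq Ð' → Ð' = Ð) ∧
      (LieAlgebroid.IsLieBialgebroid ℒ ℒ' ↔ IsDiracGeneratingOperator (pairingForm 𝕜 R L)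
        (spinModule 𝕜 R L S) (parity R L S) Ð) := by
  obtain ⟨ρ', hρ'⟩ := ℒ'.exists_dualAction F FS hm sq
  obtain ⟨ρ, hρ⟩ := ℒ.exists_complementAction F FS hm sq
  have hdel := ρ.complement_codifferential F
  refine ⟨ρ'.differential + ρ.codifferential F, ⟨ρ', ρ, _, hρ', hρ, hdel, rfl⟩, ?_, ?_⟩
  · rintro _ ⟨σ', σ, del, hσ', hσ, hdel', rfl⟩
    rw [hσ'.unique FS hρ']
    rw [hσ.unique FS hρ] at hdel'
    congr 1
    exact LinearMap.ext fun Ω => complement_injective 𝕜 F (by rw [hdel, hdel'])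
  · have h := diracPair_differential F hρ' hρ hdel
    exact (h.isLieBialgebroid_iff FS hm).trans (h.isDiracGeneratingOperator_iff FS).symm

end CanonicalDirac

/-! ### General position -/

/-- The sequence in which each term is chosen as a function of the previous ones. -/
noncomputable def greedySequence {V : Type*} [Zero V] (G : ℕ → (ℕ → V) → V) : ℕ → V
  | k => G k fun j => if j < k then greedySequence G j else 0

/-- If the sets of forbidden values are not everything, there are coefficients for which no
nontrivial partial linear combination vanishes. -/
theorem exists_sum_smul_ne_zero {𝕜 V T : Type*} [Field 𝕜] [AddCommGroup V] [Module 𝕜 V]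
    (σ : ℕ → T → 𝕜)
    (h : ∀ (k : ℕ) (c : ℕ → V), ∃ v, ∀ t, σ k t ≠ 0 →
      v ≠ -∑ j ∈ Finset.range k, (σ j t / σ k t) • c j) :
    ∃ c : ℕ → V, ∀ (k : ℕ) (t : T), (∃ j < k, σ j t ≠ 0) →
      ∑ j ∈ Finset.range k, σ j t • c j ≠ 0 := by
  choose G hG using h
  refine ⟨greedySequence G, fun k => ?_⟩
  have hc (k : ℕ) (t : T) (ht : σ k t ≠ 0) : greedySequence G k ≠
      -∑ j ∈ Finset.range k, (σ j t / σ k t) • greedySequence G j := by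
    have := hG k (fun j => if j < k then greedySequence G j else 0) t ht
    have heq : greedySequence G k = G k fun j => if j < k then greedySequence G j else 0 := by
      rw [greedySequence]
    rw [← heq, Finset.sum_congr rfl fun j hj => by
      rw [if_pos (Finset.mem_range.1 hj)]] at this
    exact this
  induction k with
  | zero => rintro t ⟨j, hj, -⟩; exact absurd hj (Nat.not_lt_zero j)
  | succ k ih =>
    rintro t ⟨j, hj, hjt⟩
    rw [Finset.sum_range_succ]
    by_cases hk : σ k t = 0
    · rw [hk, zero_smul, add_zero]
      refine ih t ⟨j, lt_of_le_of_ne (Nat.lt_succ_iff.1 hj) ?_, hjt⟩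
      rintro rfl
      exact hjt hk
    · intro h0
      refine hc k t hk ?_
      rw [add_comm, add_eq_zero_iff_eq_neg] at h0
      rw [← inv_smul_smul₀ hk (greedySequence G k), h0, smul_neg, Finset.smul_sum]
      simp only [smul_smul, div_eq_inv_mul]

/-- A countable union of locally Lipschitz images of sets in a space of smaller dimension is not
everything. -/
theorem exists_notMem_iUnion_image {ι X Y : Type*} [Countable ι] [NormedAddCommGroup X]
    [NormedSpace ℝ X] [FiniteDimensional ℝ X] [NormedAddCommGroup Y] [NormedSpace ℝ Y]
    [FiniteDimensional ℝ Y] (hXY : finrank ℝ X < finrank ℝ Y) (f : ι → X → Y) (s : ι → Set X)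
    (hf : ∀ i, ∀ x ∈ s i, ContDiffAt ℝ 1 (f i) x) : ∃ v, ∀ i, v ∉ f i '' s i := by
  -- Continuously differentiable maps are locally Lipschitz and do not raise the Hausdorff
  -- dimension, and the dimension of a countable union is the supremum of the dimensions.
  have h : dimH (⋃ i, f i '' s i) < finrank ℝ Y := by
    rw [dimH_iUnion]
    refine lt_of_le_of_lt (iSup_le fun i => ?_) (Nat.cast_lt.2 hXY)
    refine (dimH_image_le_of_locally_lipschitzOn fun x hx => ?_).trans
      ((dimH_mono (Set.subset_univ _)).trans_eq (Real.dimH_univ_eq_finrank X))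
    obtain ⟨C, t, ht, hC⟩ := (hf i x hx).exists_lipschitzOnWith
    exact ⟨C, t, mem_nhdsWithin_of_mem_nhds ht, hC⟩
  obtain ⟨v, hv⟩ := (dense_compl_of_dimH_lt_finrank h).nonempty
  exact ⟨v, fun i hi => hv (Set.mem_iUnion.2 ⟨i, hi⟩)⟩

/-! ### Finitely many sections that generate a vector bundle -/

section Charts

variable {m : ℕ} {M : Type*} [TopologicalSpace M] [ChartedSpace (EuclideanSpace ℝ (Fin m)) M]
  [IsManifold (𝓡 m) ∞ M]

theorem ContMDiffAt.contDiffAt_comp_extChartAt_symm {G : Type*} [NormedAddCommGroup G]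
    [NormedSpace ℝ G] {f : M → G} {x₀ : M} {y : EuclideanSpace ℝ (Fin m)}
    (hy : y ∈ (extChartAt (𝓡 m) x₀).target)
    (hf : ContMDiffAt (𝓡 m) 𝓘(ℝ, G) ∞ f ((extChartAt (𝓡 m) x₀).symm y)) :
    ContDiffAt ℝ ∞ (f ∘ (extChartAt (𝓡 m) x₀).symm) y := by
  have h : ContMDiffAt 𝓘(ℝ, EuclideanSpace ℝ (Fin m)) (𝓡 m) ∞ (extChartAt (𝓡 m) x₀).symm y :=
    (contMDiffOn_extChartAt_symm x₀).contMDiffAt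
      ((isOpen_extChartAt_target x₀).mem_nhds hy)
  exact (hf.comp y h).contDiffAt

end Charts

section SpanningSections

variable (m : ℕ) (M : Type*) (𝕜 : Type*) [RCLike 𝕜] [TopologicalSpace M]
  [ChartedSpace (EuclideanSpace ℝ (Fin m)) M] [IsManifold (𝓡 m) ∞ M]
  (F : Type*) [NormedAddCommGroup F] [NormedSpace ℝ F] [NormedSpace 𝕜 F]
  (A : M → Type*) [∀ x, AddCommGroup (A x)] [∀ x, Module ℝ (A x)] [∀ x, Module 𝕜 (A x)]
  [∀ x, TopologicalSpace (A x)] [TopologicalSpace (Bundle.TotalSpace F A)]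
  [FiberBundle F A] [VectorBundle ℝ F A] [VectorBundle 𝕜 F A] [ContMDiffVectorBundle ∞ F A (𝓡 m)]

/-- A locally finite countable family of smooth sections that generates every fibre. -/
theorem exists_locallyFinite_smoothSections [T2Space M] [SecondCountableTopology M]
    [FiniteDimensional 𝕜 F] (p : ℕ → M)
    (hp : ⋃ j, (trivializationAt F A (p j)).baseSet = Set.univ) :
    ∃ σ : ℕ → ∀ x, A x,
      (∀ q, ContMDiff (𝓡 m) ((𝓡 m).prod 𝓘(ℝ, F)) ∞ fun x => Bundle.TotalSpace.mk' F x (σ q x)) ∧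
      (LocallyFinite fun q => {x | σ q x ≠ 0}) ∧
      ∀ x, ∃ j, x ∈ (trivializationAt F A (p j)).baseSet ∧ ∃ r : ℝ, r ≠ 0 ∧
        ∀ a : Fin (finrank 𝕜 F), ∃ q, σ q x =
          r • (trivializationAt F A (p j)).symm x (finBasis 𝕜 F a) := by
  have := ChartedSpace.locallyCompactSpace (EuclideanSpace ℝ (Fin m)) M
  obtain ⟨ρ, hρ⟩ := SmoothPartitionOfUnity.exists_isSubordinate (𝓡 m) isClosed_univ
    (fun j => (trivializationAt F A (p j)).baseSet)
    (fun j => (trivializationAt F A (p j)).open_baseSet) hp.ge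
  set n := finrank 𝕜 F
  -- An index of the family codes a pair of a trivialization and a basis vector. The value zero
  -- beyond the rank means that only finitely many indices per trivialization contribute, as local
  -- finiteness requires.
  let β : ℕ → F := fun a => if h : a < n then finBasis 𝕜 F ⟨a, h⟩ else 0
  let σ : ℕ → ∀ x, A x := fun q x =>
    ρ q.unpair.1 x • (trivializationAt F A (p q.unpair.1)).symm x (β q.unpair.2)
  have hσ (q : ℕ) (x : M) : σ q x =
    ρ q.unpair.1 x • (trivializationAt F A (p q.unpair.1)).symm x (β q.unpair.2) := rfl
  refine ⟨σ, fun q => ?_, fun x => ?_, fun x => ?_⟩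
  · refine ContMDiffOn.smul_section_of_tsupport (ρ q.unpair.1).contMDiff.contMDiffOn
      (trivializationAt F A (p q.unpair.1)).open_baseSet (hρ q.unpair.1) ?_
    rw [Bundle.Trivialization.contMDiffOn_section_baseSet_iff]
    refine (contMDiffOn_const (c := β q.unpair.2)).congr fun x hx => ?_
    rw [Bundle.Trivialization.apply_mk_symm _ hx]
  · obtain ⟨t, ht, hfin⟩ := ρ.locallyFinite x
    refine ⟨t, ht, ((hfin.prod (Set.finite_lt_nat n)).image
      fun a => Nat.pair a.1 a.2).subset ?_⟩
    rintro q ⟨y, hy, hyt⟩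
    refine ⟨(q.unpair.1, q.unpair.2), ⟨⟨y, fun h => hy ?_, hyt⟩, ?_⟩, Nat.pair_unpair q⟩
    · rw [hσ, h, zero_smul]
    · by_contra h
      refine hy ?_
      have h0 : β q.unpair.2 = 0 := dif_neg h
      rw [hσ, h0]
      by_cases hρy : ρ q.unpair.1 y = 0
      · rw [hρy, zero_smul]
      · rw [← Bundle.Trivialization.symmₗ_apply (R := ℝ) (trivializationAt F A (p q.unpair.1))
          (hρ q.unpair.1 (subset_tsupport _ hρy)), map_zero, smul_zero]
  · obtain ⟨j, hj⟩ := ρ.exists_pos_of_mem (Set.mem_univ x)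
    refine ⟨j, hρ j (subset_tsupport _ hj.ne'), ρ j x, hj.ne', fun a => ⟨Nat.pair j a, ?_⟩⟩
    have h0 : β (a : ℕ) = finBasis 𝕜 F a := dif_pos a.2
    rw [hσ, Nat.unpair_pair, h0]

/-- A smooth vector bundle over a second countable manifold is generated by finitely many smooth
sections. -/
theorem exists_spanning_smoothSections [T2Space M] [SecondCountableTopology M]
    [FiniteDimensional 𝕜 F] [IsScalarTower ℝ 𝕜 F] :
    ∃ (N : ℕ) (s : Fin N → smoothSections m M 𝕜 F A),
      ∀ x, Submodule.span 𝕜 (Set.range fun i => (s i).1 x) = ⊤ := by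
  rcases isEmpty_or_nonempty M with hM | hM
  · exact ⟨0, Fin.elim0, fun x => isEmptyElim x⟩
  have : FiniteDimensional ℝ F := FiniteDimensional.trans ℝ 𝕜 F
  obtain ⟨P, hP, hPU⟩ := TopologicalSpace.countable_cover_nhds fun x : M => Filter.inter_mem
    ((trivializationAt F A x).open_baseSet.mem_nhds (FiberBundle.mem_baseSet_trivializationAt' x))
    (extChartAt_source_mem_nhds (I := 𝓡 m) x)
  have hne : P.Nonempty := by
    rw [Set.nonempty_iff_ne_empty]
    rintro rfl
    simp at hPU
    exact (Set.empty_ne_univ hPU).elim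
  obtain ⟨p, rfl⟩ := hP.exists_eq_range hne
  rw [Set.biUnion_range] at hPU
  obtain ⟨σ, hσ, hfin, hgen⟩ := exists_locallyFinite_smoothSections m M 𝕜 F A p
    (Set.eq_univ_of_univ_subset (hPU.ge.trans (Set.iUnion_mono fun j => Set.inter_subset_left)))
  -- The generating sections will be `∑ c_q σ_q` with `c_q` in `𝕜 ^ N`. They generate all fibres if
  -- `∑ η(σ_q(x)) c_q ≠ 0` for every point `x` and every nonzero functional `η` on the fibre. The
  -- pairs `(x, η)` form a family of real dimension `N - 1`, so generic vectors of `𝕜 ^ N` avoid it.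
  set N := m + finrank ℝ (F →L[ℝ] 𝕜) + 1 with hN
  let τ : ℕ → {t : ℕ × M × (F →L[ℝ] 𝕜) // t.2.1 ∈ (trivializationAt F A (p t.1)).baseSet ∩
      (extChartAt (𝓡 m) (p t.1)).source} → 𝕜 :=
    fun k t => t.1.2.2 (trivializationAt F A (p t.1.1) ⟨t.1.2.1, σ k t.1.2.1⟩).2
  obtain ⟨c, hc⟩ := exists_sum_smul_ne_zero (V := Fin N → 𝕜) τ fun k c => by
    let g : ℕ → ℕ → EuclideanSpace ℝ (Fin m) → F := fun j l =>
      (fun x => (trivializationAt F A (p l) ⟨x, σ j x⟩).2) ∘ (extChartAt (𝓡 m) (p l)).symm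
    obtain ⟨v, hv⟩ := exists_notMem_iUnion_image (X := EuclideanSpace ℝ (Fin m) × (F →L[ℝ] 𝕜))
      (Y := Fin N → 𝕜) (by
        rw [finrank_prod, finrank_euclideanSpace_fin]
        have h1 : finrank ℝ (Fin N → 𝕜) = N * finrank ℝ 𝕜 := by
          rw [finrank_pi_fintype]; simp
        have h2 : 0 < finrank ℝ 𝕜 := finrank_pos
        rw [h1]
        exact Nat.lt_of_succ_le (Nat.le_mul_of_pos_right N h2))
      -- The forbidden values of the next coefficient, parametrised in a chart and a trivialization:
      -- those for which the partial sum up to `k` vanishes although `η(σ_k(x)) ≠ 0`.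
      (fun l z => -∑ j ∈ Finset.range k, (z.2 (g j l z.1) / z.2 (g k l z.1)) • c j)
      (fun l => {z | z.1 ∈ (extChartAt (𝓡 m) (p l)).target ∧
        (extChartAt (𝓡 m) (p l)).symm z.1 ∈ (trivializationAt F A (p l)).baseSet ∧
        z.2 (g k l z.1) ≠ 0}) (by
        rintro l ⟨y, η⟩ ⟨hy, hyb, hyk⟩
        have hg (j : ℕ) : ContDiffAt ℝ 1 (fun z : EuclideanSpace ℝ (Fin m) × (F →L[ℝ] 𝕜) =>
            z.2 (g j l z.1)) (y, η) := by
          have h1 : ContDiffAt ℝ ∞ (g j l) y :=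
            ContMDiffAt.contDiffAt_comp_extChartAt_symm hy
              ((Bundle.Trivialization.contMDiffAt_section_iff _ hyb).1 (hσ j _))
          have h2 : ContDiffAt ℝ 1 (g j l) y := h1.of_le (by exact_mod_cast le_top)
          exact contDiffAt_snd.clm_apply
            (ContDiffAt.comp (y, η) (g := g j l) h2 contDiffAt_fst)
        have hdiv (j : ℕ) : ContDiffAt ℝ 1 (fun z : EuclideanSpace ℝ (Fin m) × (F →L[ℝ] 𝕜) =>
            z.2 (g j l z.1) / z.2 (g k l z.1)) (y, η) := by
          simp only [div_eq_mul_inv]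
          exact ContDiffAt.mul (hg j) (ContDiffAt.inv (hg k) hyk)
        exact (ContDiffAt.sum fun j _ => (hdiv j).smul contDiffAt_const).neg)
    refine ⟨v, ?_⟩
    rintro ⟨⟨l, x, η⟩, hxb, hxs⟩ hk rfl
    have hx : (extChartAt (𝓡 m) (p l)).symm (extChartAt (𝓡 m) (p l) x) = x :=
      (extChartAt (𝓡 m) (p l)).left_inv hxs
    have hgx (j : ℕ) : g j l (extChartAt (𝓡 m) (p l) x) =
        (trivializationAt F A (p l) ⟨x, σ j x⟩).2 :=
      congrArg (fun z => (trivializationAt F A (p l) ⟨z, σ j z⟩).2) hx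
    refine hv l ⟨(extChartAt (𝓡 m) (p l) x, η), ⟨(extChartAt (𝓡 m) (p l)).map_source hxs, ?_, ?_⟩,
      ?_⟩
    · rw [hx]; exact hxb
    · rw [hgx]; exact hk
    · simp only [hgx]; rfl
  have hcσ (i : Fin N) (q : ℕ) : ContMDiff (𝓡 m) ((𝓡 m).prod 𝓘(ℝ, F)) ∞
      fun x => Bundle.TotalSpace.mk' F x (c q i • σ q x) :=
    ((smoothSections m M 𝕜 F A).smul_mem (algebraMap 𝕜 (smoothFunctions m M 𝕜) (c q i)) (hσ q) :)
  have hfin' (i : Fin N) : LocallyFinite fun q => {x | c q i • σ q x ≠ 0} :=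
    hfin.subset fun q x hx h0 => hx (by
      rw [h0, smul_zero])
  refine ⟨N, fun i => ⟨fun x => ∑ᶠ q, c q i • σ q x,
    ContMDiff.finsum_section_of_locallyFinite (hfin' i) (hcσ i)⟩, fun x => ?_⟩
  by_contra hspan
  obtain ⟨f, hf, hker⟩ := Submodule.exists_le_ker_of_lt_top _ (lt_top_iff_ne_top.2 hspan)
  obtain ⟨l, hl⟩ := Set.mem_iUnion.1 (hPU.ge (Set.mem_univ x))
  set e := trivializationAt F A (p l) with he
  let ε : A x ≃ₗ[𝕜] F := e.linearEquivAt 𝕜 x hl.1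
  let η : F →L[ℝ] 𝕜 :=
    (LinearMap.toContinuousLinearMap (f ∘ₗ ε.symm.toLinearMap)).restrictScalars ℝ
  have hη (v : A x) : η (e ⟨x, v⟩).2 = f v := congrArg f (ε.symm_apply_apply v)
  obtain ⟨j, hj, r, hr, hgen⟩ := hgen x
  -- A functional that vanishes on all members of the locally finite family at `x` vanishes on a
  -- basis of the fibre.
  have hq : ∃ q, f (σ q x) ≠ 0 := by
    by_contra! hq
    refine hf (LinearMap.ext fun v => ?_)
    let ε' : A x ≃ₗ[𝕜] F := (trivializationAt F A (p j)).linearEquivAt 𝕜 x hj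
    have h1 : f ∘ₗ ε'.symm.toLinearMap = 0 := by
      refine (finBasis 𝕜 F).ext fun a => ?_
      obtain ⟨q, hqa⟩ := hgen a
      have h2 := hq q
      rw [hqa, ← hη] at h2
      have h3 : (e ⟨x, r • (trivializationAt F A (p j)).symm x (finBasis 𝕜 F a)⟩).2 =
          r • (e ⟨x, (trivializationAt F A (p j)).symm x (finBasis 𝕜 F a)⟩).2 :=
        (e.linear ℝ hl.1).map_smul r _
      rw [h3, map_smul, hη, smul_eq_zero, or_iff_right hr] at h2
      exact h2
    have := LinearMap.congr_fun h1 (ε' v)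
    simpa using this
  obtain ⟨q, hq⟩ := hq
  obtain ⟨K, hK⟩ : ∃ K, ∀ q, σ q x ≠ 0 → q < K := by
    obtain ⟨K, hK⟩ := (hfin.point_finite x).bddAbove
    exact ⟨K + 1, fun q hq => Nat.lt_succ_of_le (hK hq)⟩
  -- Beyond `K` all members of the family vanish at `x`, so the locally finite sums are the partial
  -- sums excluded by the choice of `c`.
  refine hc K ⟨(l, x, η), hl⟩ ⟨q, hK q fun h0 => hq (by rw [h0, map_zero]), ?_⟩ ?_
  · exact fun h0 => hq ((hη _).symm.trans h0)
  · funext i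
    have hs : ∑ᶠ q, c q i • σ q x = ∑ q ∈ Finset.range K, c q i • σ q x := by
      refine finsum_eq_sum_of_support_subset _ fun q hq => ?_
      exact Finset.mem_coe.2 (Finset.mem_range.2 (hK q fun h0 => hq (by
        change c q i • σ q x = 0
        rw [h0, smul_zero])))
    have h0 := hker (Submodule.subset_span ⟨i, rfl⟩)
    rw [LinearMap.mem_ker] at h0
    simp only [hs, map_sum, map_smul, smul_eq_mul] at h0
    rw [Finset.sum_apply, Pi.zero_apply, ← h0]
    refine Finset.sum_congr rfl fun q _ => ?_
    rw [Pi.smul_apply, smul_eq_mul, mul_comm]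
    exact congrArg (c q i * ·) (hη _)

end SpanningSections

/-! ### Moore–Penrose coordinates -/

section PseudoInverse

variable {𝕜 : Type*} [RCLike 𝕜] {n N : ℕ}

open scoped ComplexOrder Matrix in
-- Surjectivity of `B` makes multiplication of row vectors by `B` injective, so that `B Bᴴ` is
-- positive definite.
theorem Matrix.isUnit_det_mul_conjTranspose_self (B : Matrix (Fin n) (Fin N) 𝕜)
    (h : Function.Surjective B.mulVec) : IsUnit (B * Bᴴ).det := by
  refine (Matrix.isUnit_iff_isUnit_det _).1 (Matrix.PosDef.mul_conjTranspose_self B ?_).isUnit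
  intro v w hvw
  have h0 (u : Fin n → 𝕜) (hu : u ᵥ* B = 0) : u = 0 := by
    refine dotProduct_eq_zero_iff.1 fun z => ?_
    obtain ⟨y, rfl⟩ := h z
    rw [Matrix.dotProduct_mulVec, hu, zero_dotProduct]
  refine sub_eq_zero.1 (h0 _ ?_)
  rw [Matrix.sub_vecMul, sub_eq_zero]
  exact hvw

namespace Module.Basis

variable {V : Type*} [AddCommGroup V] [Module 𝕜 V]

open scoped Matrix

/-- The matrix of the coordinates of a family of vectors. -/
noncomputable def familyMatrix (b : Basis (Fin n) 𝕜 V) (s : Fin N → V) :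
    Matrix (Fin n) (Fin N) 𝕜 :=
  Matrix.of fun a i => b.repr (s i) a

/-- The Moore–Penrose coordinates of a vector with respect to a generating family. -/
noncomputable def pinvCoord (b : Basis (Fin n) 𝕜 V) (s : Fin N → V) : V →ₗ[𝕜] (Fin N → 𝕜) :=
  Matrix.toLin' ((b.familyMatrix s)ᴴ * (b.familyMatrix s * (b.familyMatrix s)ᴴ)⁻¹) ∘ₗ
    b.equivFun.toLinearMap

theorem equivFun_sum (b : Basis (Fin n) 𝕜 V) (s : Fin N → V) (c : Fin N → 𝕜) :
    b.equivFun (∑ i, c i • s i) = b.familyMatrix s *ᵥ c := by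
  ext a
  simp [familyMatrix, Matrix.mulVec, dotProduct, mul_comm]

theorem surjective_mulVec_familyMatrix (b : Basis (Fin n) 𝕜 V) {s : Fin N → V}
    (hs : Submodule.span 𝕜 (Set.range s) = ⊤) :
    Function.Surjective (b.familyMatrix s).mulVec := by
  intro z
  obtain ⟨c, hc⟩ := (Submodule.mem_span_range_iff_exists_fun 𝕜).1
    (hs.ge (Submodule.mem_top : b.equivFun.symm z ∈ ⊤))
  exact ⟨c, by rw [← equivFun_sum, hc, LinearEquiv.apply_symm_apply]⟩

theorem isUnit_det_familyMatrix (b : Basis (Fin n) 𝕜 V) {s : Fin N → V}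
    (hs : Submodule.span 𝕜 (Set.range s) = ⊤) :
    IsUnit (b.familyMatrix s * (b.familyMatrix s)ᴴ).det :=
  Matrix.isUnit_det_mul_conjTranspose_self _ (b.surjective_mulVec_familyMatrix hs)

theorem sum_pinvCoord_smul (b : Basis (Fin n) 𝕜 V) {s : Fin N → V}
    (hs : Submodule.span 𝕜 (Set.range s) = ⊤) (v : V) : ∑ i, b.pinvCoord s v i • s i = v := by
  refine b.equivFun.injective ?_
  rw [equivFun_sum, pinvCoord, LinearMap.comp_apply, Matrix.toLin'_apply, Matrix.mulVec_mulVec,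
    ← Matrix.mul_assoc, Matrix.mul_nonsing_inv _ (b.isUnit_det_familyMatrix hs), Matrix.one_mulVec]
  rfl

/-- Cyclicity of the trace turns `Bᴴ (B Bᴴ)⁻¹ B` into the identity matrix of size `n`. -/
theorem sum_pinvCoord_apply (b : Basis (Fin n) 𝕜 V) {s : Fin N → V}
    (hs : Submodule.span 𝕜 (Set.range s) = ⊤) : ∑ i, b.pinvCoord s (s i) i = n := by
  have h : ∑ i, b.pinvCoord s (s i) i = ((b.familyMatrix s)ᴴ *
      (b.familyMatrix s * (b.familyMatrix s)ᴴ)⁻¹ * b.familyMatrix s).trace := rfl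
  rw [h, Matrix.trace_mul_comm, ← Matrix.mul_assoc,
    Matrix.mul_nonsing_inv _ (b.isUnit_det_familyMatrix hs), Matrix.trace_one, Fintype.card_fin]

/-- A change of basis `T` replaces `B` by `T B`, and `T` cancels in `(T B)ᴴ (T B Bᴴ Tᴴ)⁻¹ T`. The
coordinates depend only on the generating family, so they are globally defined and may be computed
in any trivialization. -/
theorem pinvCoord_eq (b b' : Basis (Fin n) 𝕜 V) (s : Fin N → V) :
    b.pinvCoord s = b'.pinvCoord s := by
  ext v i
  set T := b.toMatrix b' with hT
  have := b.invertibleToMatrix b'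
  have hTu : IsUnit T := isUnit_of_invertible _
  have hTd : IsUnit T.det := (Matrix.isUnit_iff_isUnit_det _).1 hTu
  have hv (w : V) : b.equivFun w = T *ᵥ b'.equivFun w := (b'.toMatrix_mulVec_repr b w).symm
  have hS : b.familyMatrix s = T * b'.familyMatrix s := by
    ext a i
    exact congrFun (hv (s i)) a
  have key : (b.familyMatrix s)ᴴ * (b.familyMatrix s * (b.familyMatrix s)ᴴ)⁻¹ * T =
      (b'.familyMatrix s)ᴴ * (b'.familyMatrix s * (b'.familyMatrix s)ᴴ)⁻¹ := by
    have hTc : IsUnit Tᴴ.det := by rw [Matrix.det_conjTranspose]; exact hTd.star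
    have h1 : b.familyMatrix s * (b.familyMatrix s)ᴴ =
        T * (b'.familyMatrix s * (b'.familyMatrix s)ᴴ * Tᴴ) := by
      rw [hS, Matrix.conjTranspose_mul]; simp only [Matrix.mul_assoc]
    rw [h1, Matrix.mul_inv_rev, Matrix.mul_inv_rev, Matrix.mul_assoc, Matrix.mul_assoc,
      Matrix.nonsing_inv_mul _ hTd, Matrix.mul_one, ← Matrix.mul_assoc, hS,
      Matrix.conjTranspose_mul, Matrix.mul_assoc _ Tᴴ, Matrix.mul_nonsing_inv _ hTc, Matrix.mul_one]
  simp only [pinvCoord, LinearMap.comp_apply, LinearEquiv.coe_coe, Matrix.toLin'_apply]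
  rw [hv, Matrix.mulVec_mulVec, key]

end Module.Basis

section Smoothness

variable {X : Type*} [NormedAddCommGroup X] [NormedSpace ℝ X]

theorem ContDiffAt.matrix_det {B : X → Matrix (Fin n) (Fin n) 𝕜} {x : X}
    (h : ∀ a b, ContDiffAt ℝ ∞ (fun y => B y a b) x) : ContDiffAt ℝ ∞ (fun y => (B y).det) x := by
  simp only [Matrix.det_apply]
  refine ContDiffAt.sum fun τ _ => ContDiffAt.const_smul _ ?_
  exact contDiffAt_prod fun a _ => h _ _

theorem ContDiffAt.matrix_inv {B : X → Matrix (Fin n) (Fin n) 𝕜} {x : X}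
    (h : ∀ a b, ContDiffAt ℝ ∞ (fun y => B y a b) x) (hx : IsUnit (B x).det) (a b : Fin n) :
    ContDiffAt ℝ ∞ (fun y => (B y)⁻¹ a b) x := by
  simp only [Matrix.inv_def, Matrix.smul_apply, Ring.inverse_eq_inv', smul_eq_mul,
    Matrix.adjugate_apply]
  refine (ContDiffAt.inv (ContDiffAt.matrix_det h) hx.ne_zero).mul (ContDiffAt.matrix_det ?_)
  intro c d
  simp only [Matrix.updateRow_apply]
  split_ifs
  · exact contDiffAt_const
  · exact h c d

open scoped Matrix in
theorem ContDiffAt.pinv {B : X → Matrix (Fin n) (Fin N) 𝕜} {v : X → Fin n → 𝕜} {x : X}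
    (h : ∀ a i, ContDiffAt ℝ ∞ (fun y => B y a i) x) (hv : ∀ a, ContDiffAt ℝ ∞ (fun y => v y a) x)
    (hx : IsUnit (B x * (B x)ᴴ).det) (i : Fin N) :
    ContDiffAt ℝ ∞ (fun y => (((B y)ᴴ * (B y * (B y)ᴴ)⁻¹) *ᵥ v y) i) x := by
  have hstar (a i) : ContDiffAt ℝ ∞ (fun y => star (B y a i)) x :=
    (RCLike.conjCLE (K := 𝕜)).contDiff.contDiffAt.comp x (h a i)
  have hinv := ContDiffAt.matrix_inv (B := fun y => B y * (B y)ᴴ) (x := x) (fun a b => by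
    simp only [Matrix.mul_apply, Matrix.conjTranspose_apply]
    exact ContDiffAt.sum fun j _ => (h a j).mul (hstar b j)) hx
  simp only [Matrix.mulVec, dotProduct, Matrix.mul_apply (M := (B _)ᴴ), Matrix.conjTranspose_apply]
  exact ContDiffAt.sum fun a _ => (ContDiffAt.sum fun b _ => (hstar b i).mul (hinv b a)).mul (hv a)

open scoped Matrix in
theorem contDiffAt_pinv {z : (Fin n → Fin N → 𝕜) × (Fin n → 𝕜)}
    (hz : IsUnit (Matrix.of z.1 * (Matrix.of z.1)ᴴ).det) (i : Fin N) :
    ContDiffAt ℝ ∞ (fun z : (Fin n → Fin N → 𝕜) × (Fin n → 𝕜) =>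
      (((Matrix.of z.1)ᴴ * (Matrix.of z.1 * (Matrix.of z.1)ᴴ)⁻¹) *ᵥ z.2) i) z := by
  refine ContDiffAt.pinv (B := fun z : (Fin n → Fin N → 𝕜) × (Fin n → 𝕜) => Matrix.of z.1)
    (v := fun z => z.2) (fun a j => ?_) (fun a => ?_) hz i
  · have h : ContDiff ℝ ∞ fun z : (Fin n → Fin N → 𝕜) × (Fin n → 𝕜) => z.1 a j := by fun_prop
    exact h.contDiffAt
  · have h : ContDiff ℝ ∞ fun z : (Fin n → Fin N → 𝕜) × (Fin n → 𝕜) => z.2 a := by fun_prop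
    exact h.contDiffAt

end Smoothness

end PseudoInverse

/-! ### Sections of a vector bundle as a projective module -/

section FrameOfSections

variable (m : ℕ) (M : Type*) (𝕜 : Type*) [RCLike 𝕜] [TopologicalSpace M]
  [ChartedSpace (EuclideanSpace ℝ (Fin m)) M]
  (F : Type*) [NormedAddCommGroup F] [NormedSpace ℝ F] [NormedSpace 𝕜 F] [FiniteDimensional 𝕜 F]
  [IsScalarTower ℝ 𝕜 F]
  (A : M → Type*) [∀ x, AddCommGroup (A x)] [∀ x, Module ℝ (A x)] [∀ x, Module 𝕜 (A x)]
  [∀ x, TopologicalSpace (A x)] [TopologicalSpace (Bundle.TotalSpace F A)]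
  [FiberBundle F A] [VectorBundle ℝ F A] [VectorBundle 𝕜 F A]

/-- The basis of a fibre given by a local trivialization. -/
noncomputable def trivializationBasis (x₀ : M) {x : M}
    (hx : x ∈ (trivializationAt F A x₀).baseSet) : Basis (Fin (finrank 𝕜 F)) 𝕜 (A x) :=
  (finBasis 𝕜 F).map ((trivializationAt F A x₀).linearEquivAt 𝕜 x hx).symm

variable [IsManifold (𝓡 m) ∞ M] [ContMDiffVectorBundle ∞ F A (𝓡 m)]

theorem contMDiff_pinvCoord {N : ℕ} (s : Fin N → smoothSections m M 𝕜 F A)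
    (hs : ∀ x, Submodule.span 𝕜 (Set.range fun i => (s i).1 x) = ⊤) (i : Fin N)
    (v : smoothSections m M 𝕜 F A) :
    ContMDiff (𝓡 m) 𝓘(ℝ, 𝕜) ∞ fun x =>
      (trivializationBasis M 𝕜 F A x (FiberBundle.mem_baseSet_trivializationAt' x)).pinvCoord
        (fun j => (s j).1 x) (v.1 x) i := by
  intro x₀
  set e := trivializationAt F A x₀ with he
  have hx₀ : x₀ ∈ e.baseSet := FiberBundle.mem_baseSet_trivializationAt' x₀
  have : FiniteDimensional ℝ F := FiniteDimensional.trans ℝ 𝕜 F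
  let κ (a : Fin (finrank 𝕜 F)) : F →L[ℝ] 𝕜 :=
    (LinearMap.toContinuousLinearMap ((finBasis 𝕜 F).coord a)).restrictScalars ℝ
  have hloc (u : smoothSections m M 𝕜 F A) (a : Fin (finrank 𝕜 F)) :
      ContMDiffAt (𝓡 m) 𝓘(ℝ, 𝕜) ∞ (fun x => κ a (e ⟨x, u.1 x⟩).2) x₀ :=
    (κ a).contMDiff.contMDiffAt.comp x₀
      ((Bundle.Trivialization.contMDiffAt_section_iff _ hx₀).1 (u.2 x₀))
  let Φ : (Fin (finrank 𝕜 F) → Fin N → 𝕜) × (Fin (finrank 𝕜 F) → 𝕜) → 𝕜 := fun z =>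
    (((Matrix.of z.1).conjTranspose * (Matrix.of z.1 * (Matrix.of z.1).conjTranspose)⁻¹).mulVec
      z.2) i
  let G : M → (Fin (finrank 𝕜 F) → Fin N → 𝕜) × (Fin (finrank 𝕜 F) → 𝕜) := fun x =>
    (fun a j => κ a (e ⟨x, (s j).1 x⟩).2, fun a => κ a (e ⟨x, v.1 x⟩).2)
  have hG : ContMDiffAt (𝓡 m)
      𝓘(ℝ, (Fin (finrank 𝕜 F) → Fin N → 𝕜) × (Fin (finrank 𝕜 F) → 𝕜)) ∞ G x₀ :=
    (contMDiffAt_pi_space.2 fun a => contMDiffAt_pi_space.2 fun j => hloc (s j) a).prodMk_space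
      (contMDiffAt_pi_space.2 fun a => hloc v a)
  have hfam : Matrix.of (G x₀).1 =
      (trivializationBasis M 𝕜 F A x₀ hx₀).familyMatrix (fun i => (s i).1 x₀) := by
    ext a j
    rfl
  have hΦ : ContDiffAt ℝ ∞ Φ (G x₀) := by
    refine contDiffAt_pinv ?_ i
    rw [hfam]
    exact (trivializationBasis M 𝕜 F A x₀ hx₀).isUnit_det_familyMatrix (hs x₀)
  refine (hΦ.contMDiffAt.comp x₀ hG).congr_of_eventuallyEq ?_
  filter_upwards [e.open_baseSet.mem_nhds hx₀] with x hx
  -- The definition uses at each `x` the trivialization attached to `x`, a choice without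
  -- continuity. Near `x₀` it is replaced by the one fixed trivialization, in which the formula is
  -- smooth.
  rw [Basis.pinvCoord_eq _ (trivializationBasis M 𝕜 F A x₀ hx)]
  rfl

/-- Evaluation of sections at a point. -/
def SmoothSections.evalHom (x : M) : SmoothSections m M 𝕜 F A →+ A x where
  toFun v := v.1 x
  map_zero' := rfl
  map_add' _ _ := rfl

/-- Evaluation of functions at a point. -/
def SmoothFunctions.evalHom (x : M) : SmoothFunctions m M 𝕜 →+* 𝕜 where
  toFun f := f.1 x
  map_zero' := rfl
  map_add' _ _ := rfl
  map_one' := rfl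
  map_mul' _ _ := rfl

/-- The smooth sections of a vector bundle of rank `n` form a finitely generated projective module
of rank `n`. -/
theorem SmoothSections.exists_frameOfRank [T2Space M] [SecondCountableTopology M] :
    Nonempty (FrameOfRank (SmoothFunctions m M 𝕜) (SmoothSections m M 𝕜 F A) (finrank 𝕜 F)) := by
  obtain ⟨N, s, hs⟩ := exists_spanning_smoothSections m M 𝕜 F A
  let c (x : M) : A x →ₗ[𝕜] (Fin N → 𝕜) :=
    (trivializationBasis M 𝕜 F A x (FiberBundle.mem_baseSet_trivializationAt' x)).pinvCoord
      (fun j => (s j).1 x)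
  let φ (i : Fin N) (v : SmoothSections m M 𝕜 F A) : SmoothFunctions m M 𝕜 :=
    ⟨fun x => c x (v.1 x) i, contMDiff_pinvCoord m M 𝕜 F A s hs i v⟩
  refine ⟨⟨Fin N, inferInstance, s, fun i => ⟨⟨φ i, fun v w => ?_⟩, fun f v => ?_⟩, fun v => ?_, ?_⟩⟩
  · refine Subtype.ext (funext fun x => ?_)
    exact congrFun (map_add (c x) (v.1 x) (w.1 x)) i
  · refine Subtype.ext (funext fun x => ?_)
    exact congrFun (map_smul (c x) (f.1 x) (v.1 x)) i
  · refine Subtype.ext (funext fun x => ?_)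
    exact (map_sum (SmoothSections.evalHom m M 𝕜 F A x) _ _).trans
      (Basis.sum_pinvCoord_smul _ (hs x) (v.1 x))
  · refine Subtype.ext (funext fun x => ?_)
    exact (map_sum (SmoothFunctions.evalHom m M 𝕜 x) _ _).trans
      ((Basis.sum_pinvCoord_apply _ (hs x)).trans (map_natCast (SmoothFunctions.evalHom m M 𝕜 x) _).symm)

end FrameOfSections

/-! ### Hadamard's lemma -/

section Hadamard

variable {E G : Type*} [NormedAddCommGroup E] [NormedSpace ℝ E] [NormedAddCommGroup G]
  [NormedSpace ℝ G]

open MeasureTheory in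
/-- Smooth dependence of an integral over the unit interval on parameters. -/
theorem ContDiff.integral_Icc_zero_one {f : E → ℝ → G} (hf : ContDiff ℝ ∞ fun z : E × ℝ => f z.1 z.2) :
    ContDiff ℝ ∞ fun x => ∫ t in Set.Icc (0 : ℝ) 1, f x t := by
  -- The integral is the convolution, at `0`, of the indicator function of the interval with `t ↦
  -- χ(t) f(x, -t)`. The cutoff `χ` gives compact support and equals `1` on `[-1, 1]`, so it does
  -- not change the integral.
  let χ : ContDiffBump (0 : ℝ) := ⟨1, 2, one_pos, one_lt_two⟩
  have h := contDiffOn_convolution_right_with_param_comp (μ := volume) (n := ⊤)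
    (ContinuousLinearMap.lsmul ℝ ℝ : ℝ →L[ℝ] G →L[ℝ] G) (s := (Set.univ : Set E))
    (v := fun _ => (0 : ℝ)) contDiffOn_const (f := Set.indicator (Set.Icc (0 : ℝ) 1) 1)
    (g := fun x t => χ t • f x (-t)) (k := Metric.closedBall (0 : ℝ) 2) isOpen_univ
    (isCompact_closedBall _ _) (fun x t _ ht => by
      rw [χ.zero_of_le_dist (le_of_lt (not_le.1 ht)), zero_smul])
    ((integrable_indicator_iff measurableSet_Icc).2
      (integrableOn_const (by simp))).locallyIntegrable
    (by
      refine ContDiff.contDiffOn ?_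
      exact (χ.contDiff.comp contDiff_snd).smul
        (hf.comp (contDiff_fst.prodMk contDiff_snd.neg)))
  rw [contDiffOn_univ] at h
  convert h using 2 with x
  rw [convolution_def, ← integral_indicator measurableSet_Icc]
  refine integral_congr_ae (Filter.Eventually.of_forall fun t => ?_)
  by_cases ht : t ∈ Set.Icc (0 : ℝ) 1
  · have h1 : χ (-t) = 1 := χ.one_of_mem_closedBall (by
      simpa [Real.norm_eq_abs, abs_of_nonneg ht.1] using ht.2)
    simp [ht, h1]
  · simp [ht]

open MeasureTheory in
/-- Hadamard's lemma. -/
theorem ContDiff.exists_eq_add_apply_sub [CompleteSpace G] {f : E → G} (hf : ContDiff ℝ ∞ f) (q : E) :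
    ∃ g : E → E →L[ℝ] G, ContDiff ℝ ∞ g ∧ g q = fderiv ℝ f q ∧ ∀ x, f x = f q + g x (x - q) := by
  have hline : ContDiff ℝ ∞ fun z : E × ℝ => q + z.2 • (z.1 - q) :=
    contDiff_const.add (contDiff_snd.smul (contDiff_fst.sub contDiff_const))
  have hd : ContDiff ℝ ∞ (fderiv ℝ f) := hf.fderiv_right (m := ∞) (by simp)
  refine ⟨fun x => ∫ t in Set.Icc (0 : ℝ) 1, fderiv ℝ f (q + t • (x - q)),
    ContDiff.integral_Icc_zero_one (f := fun x t => fderiv ℝ f (q + t • (x - q)))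
      (hd.comp hline), by simp, fun x => ?_⟩
  have hc : Continuous fun t : ℝ => fderiv ℝ f (q + t • (x - q)) :=
    hd.continuous.comp (by fun_prop)
  -- The coefficient `g` is the average of the derivative along the segment from `q` to `x`.
  have hFTC := intervalIntegral.integral_eq_sub_of_hasDerivAt (a := 0) (b := 1)
    (f := fun t : ℝ => f (q + t • (x - q))) (f' := fun t => fderiv ℝ f (q + t • (x - q)) (x - q))
    (fun t _ => by
      have h1 : HasDerivAt (fun t : ℝ => q + t • (x - q)) (x - q) t := by
        simpa using ((hasDerivAt_id t).smul_const (x - q)).const_add q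
      exact ((hf.differentiable (by simp)) _).hasFDerivAt.comp_hasDerivAt t h1)
    ((hc.clm_apply continuous_const).intervalIntegrable _ _)
  rw [ContinuousLinearMap.integral_apply (hc.integrableOn_Icc), integral_Icc_eq_integral_Ioc,
    ← intervalIntegral.integral_of_le zero_le_one, hFTC]
  simp

end Hadamard

/-! ### Alternating forms on vector fields -/

section Alternating

variable {R N E : Type*} [CommRing R] [AddCommGroup N] [Module R N] [AddCommGroup E] [Module R E]

/-- An alternating form of degree `k` vanishes on linear combinations of fewer than `k` vectors. -/
theorem AlternatingMap.apply_sum_smul_eq_zero {k m : ℕ} (hk : m < k) (Ω : N [⋀^Fin k]→ₗ[R] E)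
    (c : Fin k → Fin m → R) (w : Fin m → N) : Ω (fun a => ∑ i, c a i • w i) = 0 := by
  classical
  have h := Ω.toMultilinearMap.map_sum (α := fun _ => Fin m) (fun a i => c a i • w i)
  refine h.trans (Finset.sum_eq_zero fun r _ => ?_)
  rw [MultilinearMap.map_smul_univ]
  obtain ⟨a, b, hab, hr⟩ := Fintype.exists_ne_map_eq_of_card_lt r (by simpa using hk)
  have h0 : Ω (fun a => w (r a)) = 0 := Ω.map_eq_zero_of_eq _ (by simp only [hr]) hab
  exact (congrArg _ h0).trans (smul_zero _)

end Alternating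

section VectorFields

open Filter Topology

variable {m : ℕ} {M : Type*} {𝕜 : Type*} [RCLike 𝕜] [TopologicalSpace M]
  [ChartedSpace (EuclideanSpace ℝ (Fin m)) M] [IsManifold (𝓡 m) ∞ M] [T2Space M]

namespace SmoothFunctions

/-- A function defined on a chart, multiplied by a bump function. -/
noncomputable def bumpSmul {p : M} (ψ : SmoothBumpFunction (𝓡 m) p) (g : M → 𝕜)
    (hg : ContMDiffOn (𝓡 m) 𝓘(ℝ, 𝕜) ∞ g (chartAt (EuclideanSpace ℝ (Fin m)) p).source) :
    SmoothFunctions m M 𝕜 :=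
  ⟨fun x => ψ x • g x, ψ.contMDiff_smul hg⟩

/-- Derivations are local: with a bump function `θ` at `q` supported where `f` vanishes, `θ f = 0`,
and the Leibniz rule at `q` leaves `θ(q) (D f)(q) = (D f)(q)`. -/
theorem derivation_apply_eq_zero (D : Derivation 𝕜 (SmoothFunctions m M 𝕜) (SmoothFunctions m M 𝕜))
    {f : SmoothFunctions m M 𝕜} {q : M} (hf : f.1 =ᶠ[𝓝 q] 0) : (D f).1 q = 0 := by
  obtain ⟨θ, -, hθ⟩ := (SmoothBumpFunction.nhds_basis_tsupport (I := 𝓡 m) q).mem_iff.1 hf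
  have h0 : bumpSmul θ (fun _ => (1 : 𝕜)) contMDiffOn_const * f = 0 := by
    refine Subtype.ext (funext fun x => ?_)
    change θ x • (1 : 𝕜) * f.1 x = 0
    by_cases hx : θ x = 0
    · rw [hx, zero_smul, zero_mul]
    · have : f.1 x = 0 := hθ (subset_tsupport _ hx)
      rw [this, mul_zero]
  have h1 := congrArg (SmoothFunctions.evalHom m M 𝕜 q) (congrArg D h0)
  rw [D.leibniz, map_zero, map_zero, smul_eq_mul, smul_eq_mul, map_add, map_mul, map_mul] at h1
  have h2 : evalHom m M 𝕜 q f = 0 := hf.self_of_nhds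
  have h3 : evalHom m M 𝕜 q (bumpSmul θ (fun _ => (1 : 𝕜)) contMDiffOn_const) = 1 := by
    change θ q • (1 : 𝕜) = 1
    rw [θ.eq_one, one_smul]
  rw [h2, h3, one_mul, zero_mul, add_zero] at h1
  exact h1

theorem derivation_apply_congr (D : Derivation 𝕜 (SmoothFunctions m M 𝕜) (SmoothFunctions m M 𝕜))
    {f g : SmoothFunctions m M 𝕜} {q : M} (hfg : f.1 =ᶠ[𝓝 q] g.1) : (D f).1 q = (D g).1 q := by
  have h := derivation_apply_eq_zero D (f := f - g) (q := q) (by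
    filter_upwards [hfg] with x hx
    change f.1 x - g.1 x = 0
    rw [hx, sub_self])
  rw [map_sub] at h
  exact sub_eq_zero.1 h

theorem contMDiffOn_chart_coord (p : M) (i : Fin m) :
    ContMDiffOn (𝓡 m) 𝓘(ℝ, 𝕜) ∞ (fun x => ((extChartAt (𝓡 m) p x i : ℝ) : 𝕜))
      (chartAt (EuclideanSpace ℝ (Fin m)) p).source := by
  have h : ContDiff ℝ ∞ fun y : EuclideanSpace ℝ (Fin m) => ((y i : ℝ) : 𝕜) :=
    (RCLike.ofRealCLM (K := 𝕜)).contDiff.comp (by fun_prop)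
  exact h.contMDiff.comp_contMDiffOn contMDiffOn_extChartAt

/-- A coordinate function of a chart, multiplied by a bump function. -/
noncomputable def coordFun {p : M} (ψ : SmoothBumpFunction (𝓡 m) p) (i : Fin m) :
    SmoothFunctions m M 𝕜 :=
  bumpSmul ψ _ (contMDiffOn_chart_coord p i)

theorem contDiffAt_comp_chart_symm (f : SmoothFunctions m M 𝕜) (p : M) {x : M}
    (hx : x ∈ (chartAt (EuclideanSpace ℝ (Fin m)) p).source) :
    ContDiffAt ℝ ∞ (f.1 ∘ (extChartAt (𝓡 m) p).symm) (extChartAt (𝓡 m) p x) :=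
  ContMDiffAt.contDiffAt_comp_extChartAt_symm
    ((extChartAt (𝓡 m) p).map_source (by rwa [extChartAt_source])) (f.2 _)

/-- A partial derivative in a chart. -/
noncomputable def chartDeriv (p : M) (i : Fin m) (f : SmoothFunctions m M 𝕜) (x : M) : 𝕜 :=
  fderiv ℝ (f.1 ∘ (extChartAt (𝓡 m) p).symm) (extChartAt (𝓡 m) p x)
    (EuclideanSpace.basisFun (Fin m) ℝ i)

theorem contMDiffOn_chartDeriv (p : M) (i : Fin m) (f : SmoothFunctions m M 𝕜) :
    ContMDiffOn (𝓡 m) 𝓘(ℝ, 𝕜) ∞ (chartDeriv p i f)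
      (chartAt (EuclideanSpace ℝ (Fin m)) p).source := by
  intro x hx
  have h : ContDiffAt ℝ ∞ (fun y => fderiv ℝ (f.1 ∘ (extChartAt (𝓡 m) p).symm) y
      (EuclideanSpace.basisFun (Fin m) ℝ i)) (extChartAt (𝓡 m) p x) :=
    ((contDiffAt_comp_chart_symm f p hx).fderiv_right (m := ∞) (by simp)).clm_apply contDiffAt_const
  exact (h.contMDiffAt.comp x (contMDiffAt_extChartAt' hx)).contMDiffWithinAt

/-- A coordinate vector field, multiplied by a bump function. -/
noncomputable def partialDerivation {p : M} (ψ : SmoothBumpFunction (𝓡 m) p) (i : Fin m) :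
    Derivation 𝕜 (SmoothFunctions m M 𝕜) (SmoothFunctions m M 𝕜) :=
  Derivation.mk'
    { toFun := fun f => bumpSmul ψ _ (contMDiffOn_chartDeriv p i f)
      map_add' := fun f g => by
        refine Subtype.ext (funext fun x => ?_)
        change ψ x • chartDeriv p i (f + g) x = ψ x • chartDeriv p i f x + ψ x • chartDeriv p i g x
        by_cases hx : x ∈ (chartAt (EuclideanSpace ℝ (Fin m)) p).source
        · rw [← smul_add]
          refine congrArg _ ?_
          have h := fderiv_add ((contDiffAt_comp_chart_symm f p hx).differentiableAt (by simp))
            ((contDiffAt_comp_chart_symm g p hx).differentiableAt (by simp))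
          exact congrArg (fun T => T (EuclideanSpace.basisFun (Fin m) ℝ i)) h
        · have h0 : ψ x = 0 := by
            by_contra h
            exact hx (ψ.support_subset_source h)
          simp only [h0, zero_smul, add_zero]
      map_smul' := fun c f => by
        refine Subtype.ext (funext fun x => ?_)
        change ψ x • chartDeriv p i (c • f) x = c * (ψ x • chartDeriv p i f x)
        by_cases hx : x ∈ (chartAt (EuclideanSpace ℝ (Fin m)) p).source
        · rw [mul_smul_comm]
          refine congrArg _ ?_
          have h := fderiv_const_mul ((contDiffAt_comp_chart_symm f p hx).differentiableAt (by simp)) c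
          exact congrArg (fun T => T (EuclideanSpace.basisFun (Fin m) ℝ i)) h
        · have h0 : ψ x = 0 := by
            by_contra h
            exact hx (ψ.support_subset_source h)
          simp only [h0, zero_smul, mul_zero] }
    (fun f g => by
        refine Subtype.ext (funext fun x => ?_)
        change ψ x • chartDeriv p i (f * g) x = f.1 x * (ψ x • chartDeriv p i g x) +
          g.1 x * (ψ x • chartDeriv p i f x)
        by_cases hx : x ∈ (chartAt (EuclideanSpace ℝ (Fin m)) p).source
        · rw [mul_smul_comm, mul_smul_comm, ← smul_add]
          refine congrArg _ ?_
          have h := fderiv_mul ((contDiffAt_comp_chart_symm f p hx).differentiableAt (by simp))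
            ((contDiffAt_comp_chart_symm g p hx).differentiableAt (by simp))
          refine (congrArg (fun T => T (EuclideanSpace.basisFun (Fin m) ℝ i)) h).trans ?_
          have hxe : (extChartAt (𝓡 m) p).symm (extChartAt (𝓡 m) p x) = x :=
            (extChartAt (𝓡 m) p).left_inv (by rwa [extChartAt_source])
          simp only [Function.comp_apply, hxe]
          rfl
        · have h0 : ψ x = 0 := by
            by_contra h
            exact hx (ψ.support_subset_source h)
          simp only [h0, zero_smul, mul_zero, add_zero])

end SmoothFunctions

end VectorFields

section VectorFieldForms

open Filter Topology

variable {m : ℕ} {M : Type*} {𝕜 : Type*} [RCLike 𝕜] [TopologicalSpace M]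
  [ChartedSpace (EuclideanSpace ℝ (Fin m)) M] [IsManifold (𝓡 m) ∞ M] [T2Space M]

namespace SmoothFunctions

/-- Hadamard's lemma on a manifold: near `q`, a smooth function is a first order polynomial in the
coordinates of a chart, with coefficients that take the values of the partial derivatives at `q`. -/
theorem exists_eventuallyEq_sum {p q : M} (ψ : SmoothBumpFunction (𝓡 m) p)
    (hq : q ∈ (chartAt (EuclideanSpace ℝ (Fin m)) p).source) (hψ : ψ =ᶠ[𝓝 q] 1)
    (f : SmoothFunctions m M 𝕜) :
    ∃ G : Fin m → SmoothFunctions m M 𝕜, (∀ i, (G i).1 q = chartDeriv p i f q) ∧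
      f.1 =ᶠ[𝓝 q] fun x => f.1 q + ∑ i, ((coordFun ψ i).1 x - (coordFun ψ i).1 q) * (G i).1 x := by
  set e := extChartAt (𝓡 m) p with he
  have hqe : q ∈ e.source := by rwa [he, extChartAt_source]
  obtain ⟨r, hr, hball⟩ := Metric.nhds_basis_closedBall.mem_iff.1
    ((isOpen_extChartAt_target (I := 𝓡 m) p).mem_nhds (e.map_source hqe))
  let χ : ContDiffBump (e q) := ⟨r / 2, r, half_pos hr, half_lt_self hr⟩
  -- Hadamard's lemma needs a function on the whole space, so the coordinate expression of `f` is
  -- cut off inside the image of the chart without changing it near `q`.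
  let F : EuclideanSpace ℝ (Fin m) → 𝕜 := fun y => χ y • (f.1 ∘ e.symm) y
  have hF : ContDiff ℝ ∞ F := contDiff_iff_contDiffAt.2 fun y => by
    by_cases hy : y ∈ e.target
    · exact χ.contDiff.contDiffAt.smul (ContMDiffAt.contDiffAt_comp_extChartAt_symm hy (f.2 _))
    · have hy' : y ∉ tsupport χ := fun h => hy (hball (by rwa [χ.tsupport_eq] at h))
      refine (contDiffAt_const (c := (0 : 𝕜))).congr_of_eventuallyEq ?_
      filter_upwards [notMem_tsupport_iff_eventuallyEq.1 hy'] with z hz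
      change χ z • (f.1 ∘ e.symm) z = 0
      rw [hz]
      exact zero_smul _ _
  have hFq : F =ᶠ[𝓝 (e q)] f.1 ∘ e.symm := by
    filter_upwards [χ.eventuallyEq_one] with y hy
    change χ y • (f.1 ∘ e.symm) y = _
    rw [hy]
    exact one_smul _ _
  obtain ⟨g, hg, hgq, hgf⟩ := hF.exists_eq_add_apply_sub (e q)
  have hgi (i : Fin m) : ContMDiffOn (𝓡 m) 𝓘(ℝ, 𝕜) ∞
      (fun x => g (e x) (EuclideanSpace.basisFun (Fin m) ℝ i))
      (chartAt (EuclideanSpace ℝ (Fin m)) p).source :=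
    (hg.clm_apply contDiff_const).contMDiff.comp_contMDiffOn contMDiffOn_extChartAt
  have hψq : ψ q = 1 := hψ.self_of_nhds
  refine ⟨fun i => bumpSmul ψ _ (hgi i), fun i => ?_, ?_⟩
  · change ψ q • g (e q) _ = _
    rw [hψq, one_smul, hgq, hFq.fderiv_eq]
    rfl
  · have hcont : ContinuousAt e q := continuousAt_extChartAt' hqe
    filter_upwards [hψ, hcont.eventually hFq, (isOpen_extChartAt_source (I := 𝓡 m) p).mem_nhds hqe]
      with x hx hxF hxs
    have hinv {z : M} (hz : z ∈ e.source) : (f.1 ∘ e.symm) (e z) = f.1 z :=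
      congrArg f.1 (e.left_inv hz)
    rw [← hinv hxs, ← hxF, hgf, hFq.self_of_nhds, hinv hqe]
    refine congrArg _ ?_
    have hv := (EuclideanSpace.basisFun (Fin m) ℝ).sum_repr (e x - e q)
    rw [← congrArg (g (e x)) hv, map_sum]
    refine Finset.sum_congr rfl fun i _ => ?_
    change _ = (ψ x • ((e x i : ℝ) : 𝕜) - ψ q • ((e q i : ℝ) : 𝕜)) * (ψ x • g (e x) _)
    have hx1 : ψ x = 1 := hx
    rw [hx1, hψq, one_smul, one_smul, one_smul, map_smul, ← RCLike.ofReal_sub,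
      RCLike.real_smul_eq_coe_mul]
    rfl

/-- Apply `D` to the first order expansion of `f` at `q`: constants are killed, and at `q` the
factors `xᵢ - xᵢ(q)` vanish, so that only the derivatives of the coordinates survive. -/
theorem derivation_apply_eq_sum (D : Derivation 𝕜 (SmoothFunctions m M 𝕜) (SmoothFunctions m M 𝕜))
    {p q : M} (ψ : SmoothBumpFunction (𝓡 m) p)
    (hq : q ∈ (chartAt (EuclideanSpace ℝ (Fin m)) p).source) (hψ : ψ =ᶠ[𝓝 q] 1)
    (f : SmoothFunctions m M 𝕜) :
    (D f).1 q = ∑ i, (D (coordFun ψ i)).1 q * chartDeriv p i f q := by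
  obtain ⟨G, hG, hf⟩ := exists_eventuallyEq_sum ψ hq hψ f
  let c (z : 𝕜) : SmoothFunctions m M 𝕜 := algebraMap 𝕜 _ z
  have hDc (z : 𝕜) : D (c z) = 0 := D.map_algebraMap z
  have h := derivation_apply_congr D (q := q) (f := f)
    (g := c (f.1 q) + ∑ i, (coordFun ψ i - c ((coordFun ψ i).1 q)) * G i) (by
      filter_upwards [hf] with x hx
      rw [hx]
      refine Eq.symm ((map_add (evalHom m M 𝕜 x) _ _).trans ?_)
      rw [map_sum]
      rfl)
  rw [h, map_add, hDc, zero_add, map_sum]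
  refine (map_sum (evalHom m M 𝕜 q) _ _).trans (Finset.sum_congr rfl fun i _ => ?_)
  rw [D.leibniz, map_sub, hDc, sub_zero, smul_eq_mul, smul_eq_mul, map_add, map_mul, map_mul,
    map_sub]
  have h1 : evalHom m M 𝕜 q (c ((coordFun ψ i).1 q)) = evalHom m M 𝕜 q (coordFun ψ i) := rfl
  rw [h1, sub_self, zero_mul, zero_add, mul_comm]
  exact congrArg _ (hG i)

/-- There are no alternating forms of degree larger than the dimension on vector fields. -/
theorem alternatingMap_derivation_eq_zero (Ω : Derivation 𝕜 (SmoothFunctions m M 𝕜)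
    (SmoothFunctions m M 𝕜) [⋀^Fin (m + 1)]→ₗ[SmoothFunctions m M 𝕜] SmoothFunctions m M 𝕜) :
    Ω = 0 := by
  ext D
  refine Subtype.ext (funext fun p => ?_)
  -- Two nested cutoffs: `ψ` globalises coordinates and partial derivatives, while `θ` is supported
  -- where `ψ` is locally `1`. Multiplied by `θ`, every derivation is a global combination of the
  -- `m` fields `ψ ∂ᵢ`.
  obtain ⟨ψ⟩ : Nonempty (SmoothBumpFunction (𝓡 m) p) := inferInstance
  have hU : {q | ψ =ᶠ[𝓝 q] 1} ∈ 𝓝 p := eventually_eventually_nhds.2 ψ.eventuallyEq_one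
  obtain ⟨θ, -, hθ⟩ := (SmoothBumpFunction.nhds_basis_tsupport (I := 𝓡 m) p).mem_iff.1
    (Filter.inter_mem hU (chart_source_mem_nhds (EuclideanSpace ℝ (Fin m)) p))
  let φ : SmoothFunctions m M 𝕜 := bumpSmul θ (fun _ => (1 : 𝕜)) contMDiffOn_const
  have hφ (D : Derivation 𝕜 (SmoothFunctions m M 𝕜) (SmoothFunctions m M 𝕜)) :
      φ • D = ∑ i, (φ * D (coordFun ψ i)) • partialDerivation ψ i := by
    ext f
    refine Subtype.ext (funext fun q => ?_)
    have hsum : (∑ i, (φ * D (coordFun ψ i)) • partialDerivation ψ i) f =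
        ∑ i, φ * D (coordFun ψ i) * partialDerivation ψ i f := by
      rw [← Derivation.coeFnAddMonoidHom_apply, map_sum, Finset.sum_apply]
      rfl
    rw [hsum]
    refine Eq.trans ?_ (map_sum (evalHom m M 𝕜 q) _ _).symm
    change φ.1 q * (D f).1 q =
      ∑ i, φ.1 q * (D (coordFun ψ i)).1 q * (ψ q • chartDeriv p i f q)
    by_cases hq : θ q = 0
    · have : φ.1 q = 0 := (congrArg (· • (1 : 𝕜)) hq).trans (zero_smul _ _)
      simp only [this, zero_mul, Finset.sum_const_zero]
    · obtain ⟨hq1, hq2⟩ := hθ (subset_tsupport _ hq)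
      have hψq : ψ q = 1 := Filter.Eventually.self_of_nhds (p := fun x => ψ x = 1) hq1
      rw [derivation_apply_eq_sum D ψ hq2 hq1 f, Finset.mul_sum]
      simp only [hψq, one_smul, mul_assoc]
  have h := Ω.apply_sum_smul_eq_zero (Nat.lt_succ_self m)
    (fun a i => φ * D a (coordFun ψ i)) (partialDerivation ψ)
  simp only [← hφ] at h
  -- The form vanishes on `m + 1` combinations of `m` fields, so a power of the cutoff times `Ω D`
  -- is zero; the cutoff equals `1` at `p`.
  have h2 := Ω.toMultilinearMap.map_smul_univ (fun _ => φ) D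
  have h3 : (∏ _a : Fin (m + 1), φ) • Ω D = 0 := h2.symm.trans h
  have h4 := congrArg (evalHom m M 𝕜 p) h3
  rw [smul_eq_mul, map_mul, map_prod, map_zero] at h4
  have h5 : evalHom m M 𝕜 p φ = 1 := by
    change θ p • (1 : 𝕜) = 1
    rw [θ.eq_one, one_smul]
  rw [h5, Finset.prod_const_one, one_mul] at h4
  exact h4

end SmoothFunctions

end VectorFieldForms

/-! ### The theorem for smooth bundles -/

theorem corollary2p2 {𝕜 : Type*} [RCLike 𝕜] (m n : ℕ)
    {M : Type*} [TopologicalSpace M] [ChartedSpace (EuclideanSpace ℝ (Fin m)) M]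
    [IsManifold (𝓡 m) ∞ M] [T2Space M] [SecondCountableTopology M]
    (A : M → Type*) [∀ x, AddCommGroup (A x)] [∀ x, Module ℝ (A x)] [∀ x, Module 𝕜 (A x)]
    [∀ x, TopologicalSpace (A x)] [TopologicalSpace (Bundle.TotalSpace (Fin n → 𝕜) A)]
    [FiberBundle (Fin n → 𝕜) A] [VectorBundle ℝ (Fin n → 𝕜) A] [VectorBundle 𝕜 (Fin n → 𝕜) A]
    [ContMDiffVectorBundle ∞ (Fin n → 𝕜) A (𝓡 m)]
    (ℒ : LieAlgebroid 𝕜 (SmoothFunctions m M 𝕜) (SmoothSections m M 𝕜 (Fin n → 𝕜) A))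
    (ℒ' : LieAlgebroid 𝕜 (SmoothFunctions m M 𝕜)
      (Module.Dual (SmoothFunctions m M 𝕜) (SmoothSections m M 𝕜 (Fin n → 𝕜) A)))
    (S : M → Type*) [∀ x, AddCommGroup (S x)] [∀ x, Module ℝ (S x)] [∀ x, Module 𝕜 (S x)]
    [∀ x, TopologicalSpace (S x)] [TopologicalSpace (Bundle.TotalSpace 𝕜 S)]
    [FiberBundle 𝕜 S] [VectorBundle ℝ 𝕜 S] [VectorBundle 𝕜 𝕜 S]
    [ContMDiffVectorBundle ∞ 𝕜 S (𝓡 m)]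
    (sq : SmoothSections m M 𝕜 𝕜 S ⊗[SmoothFunctions m M 𝕜] SmoothSections m M 𝕜 𝕜 S
      ≃ₗ[SmoothFunctions m M 𝕜]
        DetLine 𝕜 (SmoothFunctions m M 𝕜) (SmoothSections m M 𝕜 (Fin n → 𝕜) A) n m) :
    ∃ Ð : Spinor (SmoothFunctions m M 𝕜) (SmoothSections m M 𝕜 (Fin n → 𝕜) A)
          (SmoothSections m M 𝕜 𝕜 S) →ₗ[𝕜]
        Spinor (SmoothFunctions m M 𝕜) (SmoothSections m M 𝕜 (Fin n → 𝕜) A)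
          (SmoothSections m M 𝕜 𝕜 S),
      IsCanonicalDirac ℒ ℒ' sq Ð ∧
      (∀ Ð', IsCanonicalDirac ℒ ℒ' sq Ð' → Ð' = Ð) ∧
      (LieAlgebroid.IsLieBialgebroid ℒ ℒ' ↔
        IsDiracGeneratingOperator
          (pairingForm 𝕜 (SmoothFunctions m M 𝕜) (SmoothSections m M 𝕜 (Fin n → 𝕜) A))
          (Spinor.spinModule 𝕜 (SmoothFunctions m M 𝕜) (SmoothSections m M 𝕜 (Fin n → 𝕜) A)
            (SmoothSections m M 𝕜 𝕜 S))
          (Spinor.parity (SmoothFunctions m M 𝕜) (SmoothSections m M 𝕜 (Fin n → 𝕜) A)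
            (SmoothSections m M 𝕜 𝕜 S)) Ð) := by
  obtain ⟨F⟩ := SmoothSections.exists_frameOfRank m M 𝕜 (Fin n → 𝕜) A
  obtain ⟨FS⟩ := SmoothSections.exists_frameOfRank m M 𝕜 𝕜 S
  rw [Module.finrank_fin_fun] at F
  rw [Module.finrank_self] at FS
  exact exists_isCanonicalDirac F FS
    SmoothFunctions.alternatingMap_derivation_eq_zero ℒ ℒ' sq
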